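/- Let $0<d<2$. For an integer $n>1$ let $\Phi=\Phi_n$ be the random 2-SAT formula with Boolean variables $x_1,\dots,x_n$ and $m\sim\mathrm{Po}(dn/2)$ clauses $a_1,\dots,a_m$, drawn uniformly and independently from the $4n(n-1)$ possible clauses, a clause being an ordered pair of literals on two distinct variables. Encode 'true' and 'false' by $\pm1$. Let $S(\Phi)$ be the set of satisfying assignments, $Z(\Phi)=|S(\Phi)|$, let $\mu_\Phi$ be the uniform distribution on $S(\Phi)$ (if $Z(\Phi)>0$), and let $\sigma$ be a sample from $\mu_\Phi$. Let $G(\Phi)$ be the bipartite graph in which each clause is adjacent to the two variables it contains; write $\partial v$ for the set of neighbours of $v$, and $\partial^{k}v$ for the set of vertices at distance exactly $k$ from $v$. Belief Propagation starts from $\nu^{(0)}_{a\to x}(\pm1)=\nu^{(0)}_{x\to a}(\pm1)=\frac12$ for all adjacent $a,x$. For $\ell\ge1$, $t=\pm1$ and a clause $a$ that contains the variables $x,y$ with signs $r,s\in\{\pm1\}$, respectively, it sets $$\nu^{(\ell)}_{a\to x}(t)=\frac{1-\mathbf 1\{r\ne t\}\,\nu^{(\ell-1)}_{y\to a}(-s)}{1+\nu^{(\ell-1)}_{y\to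 a}(s)},\qquad \nu^{(\ell)}_{x\to a}(t)=\frac{\prod_{b\in\partial x\setminus\{a\}}\nu^{(\ell)}_{b\to x}(t)}{\prod_{b\in\partial x\setminus\{a\}}\nu^{(\ell)}_{b\to x}(1)+\prod_{b\in\partial x\setminus\{a\}}\nu^{(\ell)}_{b\to x}(-1)}.$$ The estimate of the marginal of $x$ after $\ell$ rounds is $$\nu^{(\ell)}_{\Phi,x}(t)=\frac{\prod_{a\in\partial x}\nu^{(\ell)}_{a\to x}(t)}{\prod_{a\in\partial x}\nu^{(\ell)}_{a\to x}(1)+\prod_{a\in\partial x}\nu^{(\ell)}_{a\to x}(-1)}.$$ Each of the last two quotients is read as $\frac12$ if its denominator vanishes. Then Belief Propagation approximates the marginal of $x_1$ uniformly over all boundary conditions at distance $2\ell$: $$\lim_{\ell\to\infty}\limsup_{n\to\infty}\ \mathbb E\Big[\max_{\tau\in S(\Phi)}\big|\mu_\Phi(\sigma_{x_1}=1\mid\sigma_{\partial^{2\ell}x_1}=\tau_{\partial^{2\ell}x_1})-\nu^{(\ell)}_{\Phi,x_1}(1)\big|\ \Big|\ Z(\Phi)>0\Big]=0.$$ Moreover,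 the following hold. (i) (Unconditional marginals) For each $t\in\{\pm1\}$, $$\lim_{\ell\to\infty}\limsup_{n\to\infty}\mathbb E\big[|\mu_\Phi(\sigma_{x_1}=t)-\nu^{(\ell)}_{\Phi,x_1}(t)|\ \big|\ Z(\Phi)>0\big]=0.$$ (ii) (Gibbs uniqueness) $$\lim_{\ell\to\infty}\limsup_{n\to\infty}\ \mathbb E\Big[\max_{\tau\in S(\Phi)}\big|\mu_\Phi(\sigma_{x_1}=1\mid\sigma_{\partial^{2\ell}x_1}=\tau_{\partial^{2\ell}x_1})-\mu_\Phi(\sigma_{x_1}=1)\big|\ \Big|\ Z(\Phi)>0\Big]=0.$$ (iii) (Replica symmetry) $$\lim_{n\to\infty}\sum_{s,t\in\{\pm1\}}\mathbb E\big[|\mu_\Phi(\sigma_{x_1}=s,\sigma_{x_2}=t)-\mu_\Phi(\sigma_{x_1}=s)\,\mu_\Phi(\sigma_{x_2}=t)|\ \big|\ Z(\Phi)>0\big]=0.$$ -/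

import Mathlib

open MeasureTheory ProbabilityTheory Filter Topology

namespace TwoSat

/-- Variables are the elements of `Fin n`, and the truth values `+1`, `-1` are encoded by
`true`, `false`. A literal is a pair of a variable and the sign with which it appears, and a
clause is an ordered pair of literals whose underlying variables are distinct.
There are `4 * n * (n - 1)` clauses. -/
abbrev Clause (n : ℕ) : Type :=
  {c : Fin 2 → Fin n × Bool // (c 0).1 ≠ (c 1).1}

/-- A 2-SAT formula with variables in `Fin n`: a number `m` of clauses and a sequence of `m`
clauses (repetitions are allowed). -/
abbrev Formula (n : ℕ) : Type := Σ m : ℕ, (Fin m → Clause n)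

/-- The distribution of the random formula with `n` variables: the number `m` of clauses is
Poisson with mean `d * n / 2` and, given `m`, the `m` clauses are drawn uniformly and
independently, i.e. the sequence of clauses is uniform on `Fin m → Clause n`. -/
noncomputable def randomFormula (d : ℝ) (n : ℕ) : Measure (Formula n) :=
  (poissonMeasure (d * n / 2).toNNReal).bind
    fun m => (uniformOn (Set.univ : Set (Fin m → Clause n))).map (Sigma.mk m)

variable {n : ℕ}

/-- The number of clauses. -/
abbrev Formula.numClauses (Φ : Formula n) : ℕ := Φ.1

/-- The variable in position `j` of clause `a`. -/
def Formula.var (Φ : Formula n) (a : Fin Φ.numClauses) (j : Fin 2) : Fin n :=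
  ((Φ.2 a).1 j).1

/-- The sign of the variable in position `j` of clause `a`. -/
def Formula.sign (Φ : Formula n) (a : Fin Φ.numClauses) (j : Fin 2) : Bool :=
  ((Φ.2 a).1 j).2

/-- The set `S(Φ)` of satisfying assignments. -/
def Formula.solutions (Φ : Formula n) : Set (Fin n → Bool) :=
  {σ | ∀ a : Fin Φ.numClauses, ∃ j : Fin 2, σ (Φ.var a j) = Φ.sign a j}

/-- The number `Z(Φ)` of satisfying assignments. -/
noncomputable def Formula.Z (Φ : Formula n) : ℕ := Φ.solutions.ncard

/-- The uniform distribution `μ_Φ` on the set of satisfying assignments. -/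
noncomputable def Formula.gibbs (Φ : Formula n) : Measure (Fin n → Bool) :=
  uniformOn Φ.solutions

/-- The bipartite graph `G(Φ)`: a variable `x` and a clause `a` are adjacent if `x` occurs
in `a`. -/
def Formula.graph (Φ : Formula n) : SimpleGraph (Fin n ⊕ Fin Φ.numClauses) :=
  SimpleGraph.fromRel fun v w =>
    ∃ (a : Fin Φ.numClauses) (j : Fin 2), v = Sum.inl (Φ.var a j) ∧ w = Sum.inr a

/-- The variables at distance precisely `k` from the variable `x` in `G(Φ)`. -/
def Formula.sphere (Φ : Formula n) (k : ℕ) (x : Fin n) : Set (Fin n) :=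
  {y | Φ.graph.edist (Sum.inl x) (Sum.inl y) = k}

/-- The marginal `μ_Φ(σ_x = t)`. -/
noncomputable def Formula.marginal (Φ : Formula n) (x : Fin n) (t : Bool) : ℝ :=
  Φ.gibbs.real {σ | σ x = t}

/-- The conditional marginal `μ_Φ(σ_x = t ∣ ∀ y ∈ ∂^k x, σ_y = τ_y)`. -/
noncomputable def Formula.condMarginal (Φ : Formula n) (k : ℕ) (τ : Fin n → Bool)
    (x : Fin n) (t : Bool) : ℝ :=
  (cond Φ.gibbs {σ | ∀ y ∈ Φ.sphere k x, σ y = τ y}).real {σ | σ x = t}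

/-- Normalization of a pair of weights, which yields `1/2` if the total weight vanishes. -/
noncomputable def normalizePair (w : Bool → ℝ) (t : Bool) : ℝ :=
  if w true + w false = 0 then 1 / 2 else w t / (w true + w false)

/-- A family of messages along the edges of `G(Φ)` in one direction. The edge between a clause
`a` and the variable in its position `j` is represented by `(a, j)`. -/
abbrev Formula.Messages (Φ : Formula n) : Type := Fin Φ.numClauses → Fin 2 → Bool → ℝ

/-- Clause-to-variable messages from variable-to-clause messages. If `x` has sign `r` and
position `j` in `a`, and the other variable `y` of `a` has sign `s`, the new message from `a`
to `x` at `t` is `(1 - 1{r ≠ t} ν_{y → a}(-s)) / (1 + ν_{y → a}(s))`. -/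
noncomputable def Formula.clauseUpdate (Φ : Formula n) (ν : Φ.Messages) : Φ.Messages :=
  fun a j t =>
    (1 - if Φ.sign a j ≠ t then ν a j.rev (!(Φ.sign a j.rev)) else 0) /
      (1 + ν a j.rev (Φ.sign a j.rev))

/-- Variable-to-clause messages from clause-to-variable messages: the message from `x` to `a`
is the normalized product of the messages `b → x` over all clauses `b ≠ a` that contain `x`. -/
noncomputable def Formula.varUpdate (Φ : Formula n) (ν : Φ.Messages) : Φ.Messages :=
  fun a j => normalizePair fun t =>
    ∏ e : Fin Φ.numClauses × Fin 2,
      if Φ.var e.1 e.2 = Φ.var a j ∧ e.1 ≠ a then ν e.1 e.2 t else 1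

/-- The messages after `ℓ` rounds of Belief Propagation: the first component holds the messages
from clauses to variables, the second one those from variables to clauses. -/
noncomputable def Formula.bpMessages (Φ : Formula n) : ℕ → Φ.Messages × Φ.Messages
  | 0 => (fun _ _ _ => 1 / 2, fun _ _ _ => 1 / 2)
  | ℓ + 1 =>
    (Φ.clauseUpdate (Φ.bpMessages ℓ).2, Φ.varUpdate (Φ.clauseUpdate (Φ.bpMessages ℓ).2))

/-- The Belief Propagation estimate of the marginal of `x` after `ℓ` rounds. -/
noncomputable def Formula.bpMarginal (Φ : Formula n) (ℓ : ℕ) (x : Fin n) : Bool → ℝ :=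
  normalizePair fun t =>
    ∏ e : Fin Φ.numClauses × Fin 2,
      if Φ.var e.1 e.2 = x then (Φ.bpMessages ℓ).1 e.1 e.2 t else 1

/-- The conditional expectation `E[f(Φ) ∣ Z(Φ) > 0]` for the random formula `Φ` with `n`
variables. -/
noncomputable def condExpect (d : ℝ) (n : ℕ) (f : Formula n → ℝ) : ℝ :=
  ∫ Φ, f Φ ∂(cond (randomFormula d n) {Φ | 0 < Φ.Z})

end TwoSat

/-!
The proof compares the marginal of `x₁` under *any* boundary condition with the root marginal of
the computation tree with free boundary, which is what Belief Propagation computes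
(`bpMarginal_eq`). All boundary conditions are treated at once by an upper bound `logBound` on the
log-likelihood ratio of the event that the root takes the value `g`, for `g = ±1`. The sum
`logWidth` of the two bounds is the width of an interval that contains the log-likelihood ratio
for every boundary condition and for the free one. So it dominates the difference of the marginals
(`abs_sub_le_of_ratio_bounds`), and everything reduces to showing that the expected width vanishes.

*Contraction.* Along an edge whose child has sign `c`, the bounds pass through the function
`softplus u = log (1 + exp u)`, and the width `u + w` of the child turns into
`softplus u - softplus (-w)` or `softplus w - softplus (-u)`, according to the value of `c`. Since
`softplus u - softplus (-u) = u`, these add up to `u + w`. The sign `c` is a fair coin that is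
independent of everything below the child. Hence, the expected width contracts by exactly `1 / 2`
per edge (`sum_logWidth`). As there are about `d ^ k` walks of length `k`, this yields the factor
`(d / 2) ^ k`.

*Start of the recursion.* Arbitrary boundary conditions can cause infinite log-likelihood ratios,
but only along paths on which one value forces the next by unit clause propagation. A path of
length `h` is forced with probability `2 ^ (-h)`, so that forced paths across the lower `h` levels of
a tree of depth `h + k` have expected number of order `d ^ k * (d / 2) ^ h` (`sum_deepForced`).
Without them, the ratio at depth `k` is at most two to the power of the size of the forced cluster
(`treeWeight_le_of_forcedPaths_eq_zero`), whose expectation is bounded because `d < 2`. The sum of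
the width and of the number of long forced paths is `bpGap`. Letting first `h` and then `k` tend to
infinity makes its expectation vanish (`exists_gapBound_lt`).

*Passage to the random formula.* The random formula enters only through expected numbers of
patterns of distinct clauses, which factorial moments of the Poisson distribution provide
(`lintegral_occurrences_le`). They bound the numbers of walks (`lintegral_chains_le`), the
probability of a cycle near `x₁` or of a short connection of `x₁` and `x₂`
(`measure_not_locallyAcyclic_le`), and the probability that the formula is not satisfiable
(`measure_unsat_le`). For the latter, an unsatisfiable formula contains a bicycle, i.e. a path of
implications between literals whose two ends run back into its own variables (`exists_bicycle`), and
the expected number of bicycles is of order `1 / n`. So conditioning on satisfiability is harmless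
(`condExpect_le`), and no independence between satisfiability and the local structure is needed.

Replica symmetry follows as the value of `x₂` is a boundary condition for the tree around `x₁`
(`abs_joint_sub_le`).
-/

set_option linter.unusedSectionVars false

namespace TwoSat

/-! ### Recursions along non-backtracking walks -/

section Recursion

variable {V M : Type*} [DecidableEq V] [Fintype M] [DecidableEq M]

/-- The edges `(b, j)` of the bipartite graph that leave the variable `x` towards a clause `b`
other than the clause `a` through which `x` was entered (`none` for the root). The array `v`
lists the variables of all clauses. -/
def outEdges (v : M → Fin 2 → V) (x : V) (a : Option M) : Finset (M × Fin 2) :=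
  Finset.univ.filter fun e => v e.1 e.2 = x ∧ some e.1 ≠ a

/-- The variable at the other end of the clause of `e`. -/
def far (v : M → Fin 2 → V) (e : M × Fin 2) : V := v e.1 e.2.rev

/-- The sign with which the variable `far v e` occurs. -/
def farSign (s : M → Fin 2 → Bool) (e : M × Fin 2) : Bool := s e.1 e.2.rev

/-- The partition function of the computation tree of depth `h` below the variable `x`, entered
through `a`, with root value `t` and weights `leaf` on the variables at depth `h`. -/
noncomputable def treeWeight (v : M → Fin 2 → V) (s : M → Fin 2 → Bool) (leaf : V → Bool → ℝ) :
    ℕ → V → Option M → Bool → ℝ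
  | 0, x, _, t => leaf x t
  | h + 1, x, a, t => ∏ e ∈ outEdges v x a, ∑ t' : Bool,
      if t = s e.1 e.2 ∨ t' = farSign s e then
        treeWeight v s leaf h (far v e) (some e.1) t' else 0

/-- The number of descending paths of length `h` along which the value `x ≠ g` forces all
further variables by unit clause propagation. Only such paths can carry an infinite
log-likelihood ratio towards `g` from the leaves to the root `x`. -/
def forcedPaths (v : M → Fin 2 → V) (s : M → Fin 2 → Bool) : ℕ → V → Option M → Bool → ℕ
  | 0, _, _, _ => 1
  | h + 1, x, a, g => ∑ e ∈ outEdges v x a,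
      if s e.1 e.2 = g then forcedPaths v s h (far v e) (some e.1) (!farSign s e) else 0

/-- The number of descending paths of positive length at most `h` along which the value `x ≠ g`
forces all further variables by unit clause propagation. -/
def forcedCluster (v : M → Fin 2 → V) (s : M → Fin 2 → Bool) : ℕ → V → Option M → Bool → ℕ
  | 0, _, _, _ => 0
  | h + 1, x, a, g => ∑ e ∈ outEdges v x a,
      if s e.1 e.2 = g then 1 + forcedCluster v s h (far v e) (some e.1) (!farSign s e) else 0

/-- The function `u ↦ log (1 + exp u)`. -/
noncomputable def softplus (u : ℝ) : ℝ := Real.log (1 + Real.exp u)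

/-- An upper bound, uniform in the boundary condition, on the log-likelihood ratio of the event
that `x` takes the value `g`. It starts from the size of the forced cluster at depth `k` and
follows the Belief Propagation recursion with extremal children up to the root. -/
noncomputable def logBound (v : M → Fin 2 → V) (s : M → Fin 2 → Bool) (h : ℕ) :
    ℕ → V → Option M → Bool → ℝ
  | 0, x, a, g => Real.log 2 * forcedCluster v s h x a g
  | k + 1, x, a, g => ∑ e ∈ outEdges v x a,
      if s e.1 e.2 = g then softplus (logBound v s h k (far v e) (some e.1) (!farSign s e))
      else - softplus (- logBound v s h k (far v e) (some e.1) (farSign s e))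

/-- The total number of forced paths of length `h` that start at depth `k`. -/
def deepForced (v : M → Fin 2 → V) (s : M → Fin 2 → Bool) (h : ℕ) : ℕ → V → Option M → ℕ
  | 0, x, a => forcedPaths v s h x a true + forcedPaths v s h x a false
  | k + 1, x, a => ∑ e ∈ outEdges v x a, deepForced v s h k (far v e) (some e.1)

/-- The number of non-backtracking walks of length `k`. -/
def numWalks (v : M → Fin 2 → V) : ℕ → V → Option M → ℕ
  | 0, _, _ => 1
  | k + 1, x, a => ∑ e ∈ outEdges v x a, numWalks v k (far v e) (some e.1)

/-- The width of the interval of log-likelihood ratios allowed by `logBound`. -/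
noncomputable def logWidth (v : M → Fin 2 → V) (s : M → Fin 2 → Bool) (h k : ℕ) (x : V)
    (a : Option M) : ℝ :=
  logBound v s h k x a true + logBound v s h k x a false

variable {v : M → Fin 2 → V} {s : M → Fin 2 → Bool} {leaf : V → Bool → ℝ}

lemma treeWeight_nonneg (hl : ∀ x t, 0 ≤ leaf x t) (h : ℕ) (x : V) (a : Option M) (t : Bool) :
    0 ≤ treeWeight v s leaf h x a t := by
  induction h generalizing x a t with
  | zero => exact hl x t
  | succ h ih =>
    refine Finset.prod_nonneg fun e _ => Finset.sum_nonneg fun t' _ => ?_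
    split_ifs
    · exact ih _ _ _
    · exact le_rfl

lemma treeWeight_pos (hl : ∀ x t, 0 < leaf x t) (h : ℕ) (x : V) (a : Option M) (t : Bool) :
    0 < treeWeight v s leaf h x a t := by
  induction h generalizing x a t with
  | zero => exact hl x t
  | succ h ih =>
    refine Finset.prod_pos fun e _ => ?_
    refine Finset.sum_pos' (fun t' _ => ?_) ⟨farSign s e, Finset.mem_univ _, ?_⟩
    · split_ifs
      · exact (ih _ _ _).le
      · exact le_rfl
    · simpa using ih _ _ _

/-- The factor contributed by one clause: both values of the child count if the parent satisfies
the clause, and otherwise only the satisfying one. -/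
lemma sum_clause_weight (w : Bool → ℝ) (t r c : Bool) :
    (∑ t' : Bool, if t = r ∨ t' = c then w t' else 0)
      = if t = r then w c + w (!c) else w c := by
  cases t <;> cases r <;> cases c <;> simp [add_comm]

/-- If each factor is dominated up to a constant, then so is the product. -/
lemma prod_le_mul_prod {ι : Type*} (S : Finset ι) {f g c : ι → ℝ} (hf : ∀ i ∈ S, 0 ≤ f i)
    (hfg : ∀ i ∈ S, f i ≤ c i * g i) : ∏ i ∈ S, f i ≤ (∏ i ∈ S, c i) * ∏ i ∈ S, g i := by
  rw [← Finset.prod_mul_distrib]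
  exact Finset.prod_le_prod hf hfg

/-- If no forced path reaches the leaves, the likelihood ratio is bounded by two to the power of
the size of the forced cluster, whatever the leaf weights. -/
lemma treeWeight_le_of_forcedPaths_eq_zero (hl : ∀ x t, 0 ≤ leaf x t) (h : ℕ) (x : V)
    (a : Option M) (g : Bool) (h0 : forcedPaths v s h x a g = 0) :
    treeWeight v s leaf h x a g
      ≤ 2 ^ forcedCluster v s h x a g * treeWeight v s leaf h x a (!g) := by
  induction h generalizing x a g with
  | zero => simp [forcedPaths] at h0
  | succ h ih =>
    rw [forcedPaths, Finset.sum_eq_zero_iff] at h0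
    simp only [treeWeight, forcedCluster, sum_clause_weight]
    rw [← Finset.prod_pow_eq_pow_sum]
    have hn := treeWeight_nonneg (v := v) (s := s) hl h
    refine prod_le_mul_prod _ (fun e _ => ?_) fun e he => ?_
    · split_ifs
      · exact add_nonneg (hn _ _ _) (hn _ _ _)
      · exact hn _ _ _
    · by_cases hg : s e.1 e.2 = g
      · have h1 := h0 e he
        rw [if_pos hg] at h1
        have h2 := ih _ _ _ h1
        rw [Bool.not_not] at h2
        have h3 := hn (far v e) (some e.1) (farSign s e)
        have h4 : (1 : ℝ) ≤ 2 ^ forcedCluster v s h (far v e) (some e.1) (!farSign s e) :=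
          one_le_pow₀ (by norm_num)
        rw [if_pos hg.symm, if_pos hg, if_neg (by simp [hg]), pow_add, pow_one]
        nlinarith
      · have hg' : (!g) = s e.1 e.2 := by
          revert hg; cases g <;> cases s e.1 e.2 <;> simp
        rw [if_neg (Ne.symm hg), if_pos hg', if_neg hg, pow_zero, one_mul]
        linarith [hn (far v e) (some e.1) (!farSign s e)]

lemma exp_softplus (u : ℝ) : Real.exp (softplus u) = 1 + Real.exp u :=
  Real.exp_log (by positivity)

/-- If no forced path connects depth `k` with the leaves, `logBound` bounds the log-likelihood
ratio at the root for all leaf weights. -/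
lemma treeWeight_le_exp_logBound (hl : ∀ x t, 0 ≤ leaf x t) (h k : ℕ) (x : V) (a : Option M)
    (h0 : deepForced v s h k x a = 0) (g : Bool) :
    treeWeight v s leaf (h + k) x a g
      ≤ Real.exp (logBound v s h k x a g) * treeWeight v s leaf (h + k) x a (!g) := by
  induction k generalizing x a g with
  | zero =>
    have h1 : forcedPaths v s h x a g = 0 := by
      simp only [deepForced] at h0
      cases g <;> omega
    have h2 := treeWeight_le_of_forcedPaths_eq_zero hl h x a g h1
    rw [logBound, mul_comm (Real.log 2), Real.exp_nat_mul, Real.exp_log (by norm_num)]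
    exact h2
  | succ k ih =>
    rw [deepForced, Finset.sum_eq_zero_iff] at h0
    rw [← Nat.add_assoc]
    simp only [treeWeight, logBound, sum_clause_weight]
    rw [Real.exp_sum]
    have hn := treeWeight_nonneg (v := v) (s := s) hl (h + k)
    refine prod_le_mul_prod _ (fun e _ => ?_) fun e he => ?_
    · split_ifs
      · exact add_nonneg (hn _ _ _) (hn _ _ _)
      · exact hn _ _ _
    · have h1 := ih _ _ (h0 e he)
      by_cases hg : s e.1 e.2 = g
      · have h2 := h1 (!farSign s e)
        rw [Bool.not_not] at h2
        rw [if_pos hg.symm, if_pos hg, if_neg (by simp [hg]), exp_softplus]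
        linarith
      · have hg' : (!g) = s e.1 e.2 := by
          revert hg; cases g <;> cases s e.1 e.2 <;> simp
        have h2 := h1 (farSign s e)
        rw [if_neg (Ne.symm hg), if_pos hg', if_neg hg, Real.exp_neg, exp_softplus,
          Real.exp_neg, inv_mul_eq_div, le_div_iff₀ (by positivity)]
        have h3 : (Real.exp (logBound v s h k (far v e) (some e.1) (farSign s e)))⁻¹ *
            treeWeight v s leaf (h + k) (far v e) (some e.1) (farSign s e)
              ≤ treeWeight v s leaf (h + k) (far v e) (some e.1) (!farSign s e) := by
          rw [inv_mul_le_iff₀ (Real.exp_pos _)]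
          exact h2
        linarith

lemma softplus_mono : Monotone softplus := fun u w huw => by
  unfold softplus
  gcongr

lemma softplus_sub_softplus_neg (u : ℝ) : softplus u - softplus (-u) = u := by
  unfold softplus
  rw [← Real.log_div (by positivity) (by positivity)]
  have : (1 + Real.exp u) / (1 + Real.exp (-u)) = Real.exp u := by
    rw [Real.exp_neg]
    field_simp
    ring
  rw [this, Real.log_exp]

lemma logWidth_succ (h k : ℕ) (x : V) (a : Option M) :
    logWidth v s h (k + 1) x a = ∑ e ∈ outEdges v x a,
      (softplus (logBound v s h k (far v e) (some e.1) (!farSign s e))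
        - softplus (- logBound v s h k (far v e) (some e.1) (farSign s e))) := by
  simp only [logWidth, logBound]
  rw [← Finset.sum_add_distrib]
  refine Finset.sum_congr rfl fun e _ => ?_
  cases s e.1 e.2 <;> simp <;> ring

lemma logWidth_nonneg (h k : ℕ) (x : V) (a : Option M) : 0 ≤ logWidth v s h k x a := by
  induction k generalizing x a with
  | zero =>
    have := Real.log_nonneg one_le_two
    simp only [logWidth, logBound]
    positivity
  | succ k ih =>
    rw [logWidth_succ]
    refine Finset.sum_nonneg fun e _ => sub_nonneg.2 (softplus_mono ?_)
    have h1 := ih (far v e) (some e.1)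
    unfold logWidth at h1
    cases farSign s e <;> simp <;> linarith

end Recursion

/-! ### Averaging over the signs -/

section SignAverage

variable {V M : Type*} [DecidableEq V] [Fintype M] [DecidableEq M]

/-- The variables that are reached from `x` by non-backtracking walks of length at most `h`. -/
def treeVars (v : M → Fin 2 → V) : ℕ → V → Option M → Finset V
  | 0, x, _ => {x}
  | h + 1, x, a => insert x ((outEdges v x a).biUnion fun e => treeVars v h (far v e) (some e.1))

/-- The neighbourhood of `x` of depth `h` is a tree: all branches are disjoint. -/
def TreeLike (v : M → Fin 2 → V) : ℕ → V → Option M → Prop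
  | 0, _, _ => True
  | h + 1, x, a =>
    (∀ e ∈ outEdges v x a,
      x ∉ treeVars v h (far v e) (some e.1) ∧ TreeLike v h (far v e) (some e.1)) ∧
    (outEdges v x a : Set (M × Fin 2)).PairwiseDisjoint
      fun e => treeVars v h (far v e) (some e.1)

variable {v : M → Fin 2 → V} {s s' : M → Fin 2 → Bool}

lemma mem_outEdges {x : V} {a : Option M} {e : M × Fin 2} :
    e ∈ outEdges v x a ↔ v e.1 e.2 = x ∧ some e.1 ≠ a := by
  simp [outEdges]

lemma self_mem_treeVars (h : ℕ) (x : V) (a : Option M) : x ∈ treeVars v h x a := by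
  cases h <;> simp [treeVars]

lemma treeVars_far_subset {h : ℕ} {x : V} {a : Option M} {e : M × Fin 2}
    (he : e ∈ outEdges v x a) :
    treeVars v h (far v e) (some e.1) ⊆ treeVars v (h + 1) x a := fun _ hy =>
  Finset.mem_insert_of_mem (Finset.mem_biUnion.2 ⟨e, he, hy⟩)

lemma eq_or_eq_rev (i j : Fin 2) : i = j ∨ i = j.rev := by
  revert i j; decide

/-- A clause inside the tree below `x` does not contain a variable `z` off the tree. -/
lemma ne_of_mem_outEdges {h : ℕ} {x z : V} {a : Option M} (hz : z ∉ treeVars v (h + 1) x a)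
    {e : M × Fin 2} (he : e ∈ outEdges v x a) (j : Fin 2) : v e.1 j ≠ z := by
  rintro rfl
  rcases eq_or_eq_rev j e.2 with rfl | rfl
  · rw [(mem_outEdges.1 he).1] at hz
    exact hz (self_mem_treeVars _ _ _)
  · exact hz (treeVars_far_subset he (self_mem_treeVars _ _ _))

lemma notMem_treeVars_far {h : ℕ} {x z : V} {a : Option M} (hz : z ∉ treeVars v (h + 1) x a)
    {e : M × Fin 2} (he : e ∈ outEdges v x a) : z ∉ treeVars v h (far v e) (some e.1) :=
  fun h' => hz (treeVars_far_subset he h')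

/-- The signs of clauses that contain a variable off the tree do not matter. -/
lemma forcedPaths_congr {z : V} (hs : ∀ b, (∀ j, v b j ≠ z) → s b = s' b) (h : ℕ) (x : V)
    (a : Option M) (hz : z ∉ treeVars v h x a) (g : Bool) :
    forcedPaths v s h x a g = forcedPaths v s' h x a g := by
  induction h generalizing x a g with
  | zero => rfl
  | succ h ih =>
    refine Finset.sum_congr rfl fun e he => ?_
    rw [farSign, farSign, hs e.1 (ne_of_mem_outEdges hz he), ih _ _ (notMem_treeVars_far hz he)]

lemma forcedCluster_congr {z : V} (hs : ∀ b, (∀ j, v b j ≠ z) → s b = s' b) (h : ℕ) (x : V)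
    (a : Option M) (hz : z ∉ treeVars v h x a) (g : Bool) :
    forcedCluster v s h x a g = forcedCluster v s' h x a g := by
  induction h generalizing x a g with
  | zero => rfl
  | succ h ih =>
    refine Finset.sum_congr rfl fun e he => ?_
    rw [farSign, farSign, hs e.1 (ne_of_mem_outEdges hz he), ih _ _ (notMem_treeVars_far hz he)]

lemma logBound_congr {z : V} (hs : ∀ b, (∀ j, v b j ≠ z) → s b = s' b) (h k : ℕ) (x : V)
    (a : Option M) (hz : z ∉ treeVars v (h + k) x a) (g : Bool) :
    logBound v s h k x a g = logBound v s' h k x a g := by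
  induction k generalizing x a g with
  | zero => rw [logBound, logBound, forcedCluster_congr hs h x a hz]
  | succ k ih =>
    refine Finset.sum_congr rfl fun e he => ?_
    rw [farSign, farSign, hs e.1 (ne_of_mem_outEdges hz he), ih _ _ (notMem_treeVars_far hz he),
      ih _ _ (notMem_treeVars_far hz he)]

/-- Negation of the sign of the far variable of `e`. -/
def flipFar (e : M × Fin 2) (s : M → Fin 2 → Bool) : M → Fin 2 → Bool :=
  Function.update s e.1 (Function.update (s e.1) e.2.rev (!farSign s e))

lemma farSign_flipFar (e : M × Fin 2) (s : M → Fin 2 → Bool) :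
    farSign (flipFar e s) e = !farSign s e := by
  simp [farSign, flipFar]

lemma flipFar_involutive (e : M × Fin 2) : Function.Involutive (flipFar (M := M) e) := fun s => by
  simp [flipFar, farSign]

/-- A sum over all sign patterns may be averaged over the two values of one sign. -/
lemma sum_sign_eq_half (e : M × Fin 2) {G H : (M → Fin 2 → Bool) → ℝ}
    (hGH : ∀ s, G s + G (flipFar e s) = H s) : ∑ s, G s = 1 / 2 * ∑ s, H s := by
  have h1 : ∑ s, G (flipFar e s) = ∑ s, G s :=
    Equiv.sum_comp (flipFar_involutive e).toPerm G
  have h2 : ∑ s, H s = ∑ s, G s + ∑ s, G (flipFar e s) := by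
    rw [← Finset.sum_add_distrib]
    exact Finset.sum_congr rfl fun s _ => (hGH s).symm
  rw [h2, h1]
  ring

/-- The number of sign patterns. -/
noncomputable def numSigns (M : Type*) [Fintype M] [DecidableEq M] : ℝ :=
  Fintype.card (M → Fin 2 → Bool)

/-- Flipping the far sign of an edge at `x` affects only clauses that contain `x`. On a tree, the
branch below this edge contains no such clause. -/
lemma flipFar_agree {x : V} {a : Option M} {e : M × Fin 2} (he : e ∈ outEdges v x a)
    (s : M → Fin 2 → Bool) (b : M) (hb : ∀ j, v b j ≠ x) : s b = flipFar e s b := by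
  have : b ≠ e.1 := by
    rintro rfl
    exact hb _ (mem_outEdges.1 he).1
  simp [flipFar, Function.update_of_ne this]

/-- On average over the signs, a walk of length `h` is forced with probability `(1 / 2) ^ h` for
each of the two root values. -/
lemma sum_forcedPaths (h : ℕ) (x : V) (a : Option M) (ht : TreeLike v h x a) :
    ∑ s, ((forcedPaths v s h x a true : ℝ) + forcedPaths v s h x a false)
      = numSigns M * (2 * ((1 / 2) ^ h * numWalks v h x a)) := by
  induction h generalizing x a with
  | zero =>
    simp [forcedPaths, numWalks, numSigns]
    ring
  | succ h ih =>
    have h1 : ∀ s, ((forcedPaths v s (h + 1) x a true : ℝ) + forcedPaths v s (h + 1) x a false)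
        = ∑ e ∈ outEdges v x a, (forcedPaths v s h (far v e) (some e.1) (!farSign s e) : ℝ) := by
      intro s
      simp only [forcedPaths]
      push_cast
      rw [← Finset.sum_add_distrib]
      refine Finset.sum_congr rfl fun e _ => ?_
      cases s e.1 e.2 <;> simp
    simp_rw [h1]
    rw [Finset.sum_comm]
    have h2 : ∀ e ∈ outEdges v x a,
        ∑ s, (forcedPaths v s h (far v e) (some e.1) (!farSign s e) : ℝ)
          = 1 / 2 * (numSigns M * (2 * ((1 / 2) ^ h * numWalks v h (far v e) (some e.1)))) := by
      intro e he
      rw [← ih _ _ (ht.1 e he).2]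
      refine sum_sign_eq_half e fun s => ?_
      rw [farSign_flipFar, ← forcedPaths_congr (flipFar_agree he s) _ _ _ (ht.1 e he).1]
      cases farSign s e <;> simp [add_comm]
    rw [Finset.sum_congr rfl h2, numWalks]
    push_cast
    simp only [Finset.mul_sum]
    refine Finset.sum_congr rfl fun e _ => ?_
    ring

lemma sum_forcedCluster (h : ℕ) (x : V) (a : Option M) (ht : TreeLike v h x a) :
    ∑ s, ((forcedCluster v s h x a true : ℝ) + forcedCluster v s h x a false)
      = numSigns M * ∑ j ∈ Finset.range h, (1 / 2) ^ j * (numWalks v (j + 1) x a : ℝ) := by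
  induction h generalizing x a with
  | zero => simp [forcedCluster]
  | succ h ih =>
    have h1 : ∀ s,
        ((forcedCluster v s (h + 1) x a true : ℝ) + forcedCluster v s (h + 1) x a false)
        = ∑ e ∈ outEdges v x a,
          (1 + (forcedCluster v s h (far v e) (some e.1) (!farSign s e) : ℝ)) := by
      intro s
      simp only [forcedCluster]
      push_cast
      rw [← Finset.sum_add_distrib]
      refine Finset.sum_congr rfl fun e _ => ?_
      cases s e.1 e.2 <;> simp
    simp_rw [h1]
    rw [Finset.sum_comm]
    have h2 : ∀ e ∈ outEdges v x a,
        ∑ s, (1 + (forcedCluster v s h (far v e) (some e.1) (!farSign s e) : ℝ))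
          = numSigns M + 1 / 2 * (numSigns M * ∑ j ∈ Finset.range h,
            (1 / 2) ^ j * (numWalks v (j + 1) (far v e) (some e.1) : ℝ)) := by
      intro e he
      rw [← ih _ _ (ht.1 e he).2, Finset.sum_add_distrib]
      congr 1
      · simp [numSigns]
      refine sum_sign_eq_half e fun s => ?_
      rw [farSign_flipFar, ← forcedCluster_congr (flipFar_agree he s) _ _ _ (ht.1 e he).1]
      cases farSign s e <;> simp [add_comm]
    rw [Finset.sum_congr rfl h2, Finset.sum_range_succ', Finset.sum_add_distrib]
    have h3 : ∀ j, (numWalks v (j + 1 + 1) x a : ℝ)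
        = ∑ e ∈ outEdges v x a, (numWalks v (j + 1) (far v e) (some e.1) : ℝ) := by
      intro j
      rw [numWalks]
      push_cast
      rfl
    simp_rw [h3]
    rw [mul_add, add_comm]
    congr 1
    · simp only [Finset.mul_sum]
      rw [Finset.sum_comm]
      refine Finset.sum_congr rfl fun e _ => Finset.sum_congr rfl fun j _ => ?_
      ring
    · simp [numWalks, mul_comm]

/-- The sign of a child is a fair coin that is independent of everything below, and the two
possible derivatives of the Belief Propagation update add up to one. Hence, the expected width
contracts by `1 / 2` along each edge. -/
lemma sum_logWidth (h k : ℕ) (x : V) (a : Option M) (ht : TreeLike v (h + k) x a) :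
    ∑ s, logWidth v s h k x a = numSigns M * (Real.log 2 * ((1 / 2) ^ k *
      ∑ j ∈ Finset.range h, (1 / 2) ^ j * (numWalks v (j + 1 + k) x a : ℝ))) := by
  induction k generalizing x a with
  | zero =>
    simp only [logWidth, logBound, ← mul_add]
    rw [← Finset.mul_sum, sum_forcedCluster h x a ht]
    simp only [pow_zero, one_mul, add_zero]
    ring
  | succ k ih =>
    simp_rw [logWidth_succ]
    rw [Finset.sum_comm]
    have h2 : ∀ e ∈ outEdges v x a,
        ∑ s, (softplus (logBound v s h k (far v e) (some e.1) (!farSign s e))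
          - softplus (- logBound v s h k (far v e) (some e.1) (farSign s e)))
          = 1 / 2 * (numSigns M * (Real.log 2 * ((1 / 2) ^ k *
            ∑ j ∈ Finset.range h,
              (1 / 2) ^ j * (numWalks v (j + 1 + k) (far v e) (some e.1) : ℝ)))) := by
      intro e he
      rw [← ih _ _ (ht.1 e he).2]
      refine sum_sign_eq_half e fun s => ?_
      rw [farSign_flipFar, ← logBound_congr (flipFar_agree he s) _ _ _ _ (ht.1 e he).1,
        ← logBound_congr (flipFar_agree he s) _ _ _ _ (ht.1 e he).1, Bool.not_not]
      have h3 := softplus_sub_softplus_neg (logBound v s h k (far v e) (some e.1) true)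
      have h4 := softplus_sub_softplus_neg (logBound v s h k (far v e) (some e.1) false)
      unfold logWidth
      cases farSign s e <;> simp <;> linarith
    rw [Finset.sum_congr rfl h2]
    have h3 : ∀ j, (numWalks v (j + 1 + (k + 1)) x a : ℝ)
        = ∑ e ∈ outEdges v x a, (numWalks v (j + 1 + k) (far v e) (some e.1) : ℝ) := by
      intro j
      rw [← Nat.add_assoc, numWalks]
      push_cast
      rfl
    simp_rw [h3]
    simp only [Finset.mul_sum]
    rw [Finset.sum_comm]
    refine Finset.sum_congr rfl fun e _ => Finset.sum_congr rfl fun j _ => ?_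
    ring

lemma sum_deepForced (h k : ℕ) (x : V) (a : Option M) (ht : TreeLike v (h + k) x a) :
    ∑ s, (deepForced v s h k x a : ℝ)
      = numSigns M * (2 * ((1 / 2) ^ h * numWalks v (h + k) x a)) := by
  induction k generalizing x a with
  | zero =>
    simp only [deepForced]
    push_cast
    exact sum_forcedPaths h x a ht
  | succ k ih =>
    simp only [deepForced]
    push_cast
    rw [Finset.sum_comm, Finset.sum_congr rfl fun e he => ih _ _ (ht.1 e he).2,
      ← Nat.add_assoc, numWalks]
    push_cast
    simp only [Finset.mul_sum]

end SignAverage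

/-! ### Counting solutions on trees -/

section Counting

variable {V M : Type*} [DecidableEq V] [Fintype V] [Fintype M] [DecidableEq M]

/-- The variables that are reached from `x` by non-backtracking walks of length less than `h`. -/
def interior (v : M → Fin 2 → V) : ℕ → V → Option M → Finset V
  | 0, _, _ => ∅
  | h + 1, x, a => insert x ((outEdges v x a).biUnion fun e => interior v h (far v e) (some e.1))

/-- The indicator that `σ` satisfies all clauses on the non-backtracking walks of length at
most `h` from `x`. -/
def treeSat (v : M → Fin 2 → V) (s : M → Fin 2 → Bool) (σ : V → Bool) : ℕ → V → Option M → ℝ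
  | 0, _, _ => 1
  | h + 1, x, a => ∏ e ∈ outEdges v x a,
      if σ x = s e.1 e.2 ∨ σ (far v e) = farSign s e then
        treeSat v s σ h (far v e) (some e.1) else 0

/-- The assignments that coincide with `ρ` outside of `I`. -/
def freeOn (I : Finset V) (ρ : V → Bool) : Finset (V → Bool) :=
  Finset.univ.filter fun σ => ∀ y, y ∉ I → σ y = ρ y

variable {v : M → Fin 2 → V} {s : M → Fin 2 → Bool}

lemma mem_freeOn {I : Finset V} {ρ σ : V → Bool} :
    σ ∈ freeOn I ρ ↔ ∀ y, y ∉ I → σ y = ρ y := by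
  simp [freeOn]

/-- Sums of products of functions of disjoint sets of variables factorize. -/
lemma sum_freeOn_union {I J W U : Finset V} (hI : I ⊆ W) (hJ : J ⊆ U) (hWU : Disjoint W U)
    (ρ : V → Bool) {f g : (V → Bool) → ℝ} (hf : ∀ σ σ', (∀ y ∈ W, σ y = σ' y) → f σ = f σ')
    (hg : ∀ σ σ', (∀ y ∈ U, σ y = σ' y) → g σ = g σ') :
    ∑ σ ∈ freeOn (I ∪ J) ρ, f σ * g σ
      = (∑ σ ∈ freeOn I ρ, f σ) * ∑ σ ∈ freeOn J ρ, g σ := by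
  rw [Finset.sum_mul_sum, ← Finset.sum_product']
  have hIU : ∀ y ∈ I, y ∉ U := fun y hy => Finset.disjoint_left.1 hWU (hI hy)
  have hWJ : ∀ y ∈ W, y ∉ J := fun y hy h => Finset.disjoint_left.1 hWU hy (hJ h)
  refine Finset.sum_bij' (fun σ _ => (fun y => if y ∈ I then σ y else ρ y,
    fun y => if y ∈ J then σ y else ρ y)) (fun p _ => fun y => if y ∈ I then p.1 y else p.2 y)
    ?_ ?_ ?_ ?_ ?_
  · intro σ _
    rw [Finset.mem_product, mem_freeOn, mem_freeOn]
    exact ⟨fun y hy => if_neg hy, fun y hy => if_neg hy⟩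
  · intro p hp
    rw [Finset.mem_product, mem_freeOn, mem_freeOn] at hp
    rw [mem_freeOn]
    intro y hy
    rw [Finset.mem_union, not_or] at hy
    simp only [if_neg hy.1, hp.2 y hy.2]
  · intro σ hσ
    rw [mem_freeOn] at hσ
    funext y
    by_cases h1 : y ∈ I
    · simp [h1]
    · by_cases h2 : y ∈ J
      · simp [h1, h2]
      · simp [h1, h2, hσ y (by simp [h1, h2])]
  · intro p hp
    rw [Finset.mem_product, mem_freeOn, mem_freeOn] at hp
    refine Prod.ext (funext fun y => ?_) (funext fun y => ?_)
    · by_cases h1 : y ∈ I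
      · simp [h1]
      · simp [h1, hp.1 y h1]
    · by_cases h2 : y ∈ J
      · have h1 : y ∉ I := fun h1 => hIU y h1 (hJ h2)
        simp [h1, h2]
      · simp [h2, hp.2 y h2]
  · intro σ hσ
    rw [mem_freeOn] at hσ
    dsimp only
    congr 1
    · refine hf _ _ fun y hy => ?_
      by_cases h1 : y ∈ I
      · simp [h1]
      · simp [h1, hσ y (by simp [h1, hWJ y hy])]
    · refine hg _ _ fun y hy => ?_
      by_cases h2 : y ∈ J
      · simp [h2]
      · have h1 : y ∉ I := fun h1 => hIU y h1 hy
        simp [h2, hσ y (by simp [h1, h2])]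

lemma freeOn_empty (ρ : V → Bool) : freeOn ∅ ρ = {ρ} := by
  ext σ
  simp [mem_freeOn, funext_iff]

lemma sum_freeOn_biUnion {ι : Type*} [DecidableEq ι] (S : Finset ι) {I W : ι → Finset V}
    (hI : ∀ i ∈ S, I i ⊆ W i) (hW : (S : Set ι).PairwiseDisjoint W) (ρ : V → Bool)
    {f : ι → (V → Bool) → ℝ}
    (hf : ∀ i ∈ S, ∀ σ σ', (∀ y ∈ W i, σ y = σ' y) → f i σ = f i σ') :
    ∑ σ ∈ freeOn (S.biUnion I) ρ, ∏ i ∈ S, f i σ = ∏ i ∈ S, ∑ σ ∈ freeOn (I i) ρ, f i σ := by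
  induction S using Finset.induction_on with
  | empty => simp [freeOn_empty]
  | insert i S hi ih =>
    rw [Finset.biUnion_insert, Finset.prod_insert hi]
    simp_rw [Finset.prod_insert hi]
    rw [← ih (fun j hj => hI j (Finset.mem_insert_of_mem hj))
      (hW.subset (by simp)) fun j hj => hf j (Finset.mem_insert_of_mem hj)]
    refine sum_freeOn_union (U := S.biUnion W) (hI i (Finset.mem_insert_self _ _))
      (Finset.biUnion_mono fun j hj => hI j (Finset.mem_insert_of_mem hj)) ?_ ρ
      (hf i (Finset.mem_insert_self _ _)) fun σ σ' h => ?_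
    · rw [Finset.disjoint_biUnion_right]
      intro j hj
      refine hW (by simp) (by simp [hj]) ?_
      rintro rfl
      exact hi hj
    · refine Finset.prod_congr rfl fun j hj => hf j (Finset.mem_insert_of_mem hj) _ _ fun y hy => ?_
      exact h y (Finset.mem_biUnion.2 ⟨j, hj, hy⟩)

lemma interior_subset_treeVars (h : ℕ) (x : V) (a : Option M) :
    interior v h x a ⊆ treeVars v h x a := by
  induction h generalizing x a with
  | zero => simp [interior]
  | succ h ih => exact Finset.insert_subset_insert _ (Finset.biUnion_mono fun e _ => ih _ _)

lemma treeSat_congr (h : ℕ) (x : V) (a : Option M) {σ σ' : V → Bool}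
    (hσ : ∀ y ∈ treeVars v h x a, σ y = σ' y) : treeSat v s σ h x a = treeSat v s σ' h x a := by
  induction h generalizing x a with
  | zero => rfl
  | succ h ih =>
    refine Finset.prod_congr rfl fun e he => ?_
    rw [hσ x (self_mem_treeVars _ _ _),
      hσ (far v e) (treeVars_far_subset he (self_mem_treeVars _ _ _)),
      ih _ _ fun y hy => hσ y (treeVars_far_subset he hy)]

/-- On a tree, `treeWeight` counts the ways to extend the boundary condition `ρ` to the interior. -/
lemma sum_treeSat (h : ℕ) (x : V) (a : Option M) (ht : TreeLike v h x a) (ρ : V → Bool)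
    (t : Bool) :
    ∑ σ ∈ freeOn (interior v h x a) ρ with σ x = t, treeSat v s σ h x a
      = treeWeight v s (fun y t => if ρ y = t then 1 else 0) h x a t := by
  induction h generalizing x a ρ t with
  | zero =>
    simp only [interior, freeOn_empty, treeSat, treeWeight, Finset.filter_singleton]
    split_ifs <;> simp
  | succ h ih =>
    set J := (outEdges v x a).biUnion fun e => interior v h (far v e) (some e.1) with hJ
    have hxJ : x ∉ J := by
      intro hx
      obtain ⟨e, he, hx⟩ := Finset.mem_biUnion.1 hx
      exact (ht.1 e he).1 (interior_subset_treeVars _ _ _ hx)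
    have h1 : (freeOn (interior v (h + 1) x a) ρ).filter (fun σ => σ x = t)
        = freeOn J (Function.update ρ x t) := by
      ext σ
      rw [Finset.mem_filter, mem_freeOn, mem_freeOn]
      constructor
      · rintro ⟨h1, h2⟩ y hy
        by_cases hyx : y = x
        · subst hyx; simpa using h2
        · rw [Function.update_of_ne hyx]
          exact h1 y (by simp [interior, ← hJ, hyx, hy])
      · intro h1
        refine ⟨fun y hy => ?_, by simpa using h1 x hxJ⟩
        rw [interior, ← hJ, Finset.mem_insert, not_or] at hy
        rw [h1 y hy.2, Function.update_of_ne hy.1]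
    have h2 : ∀ σ ∈ freeOn J (Function.update ρ x t), treeSat v s σ (h + 1) x a
        = ∏ e ∈ outEdges v x a, if t = s e.1 e.2 ∨ σ (far v e) = farSign s e then
          treeSat v s σ h (far v e) (some e.1) else 0 := by
      intro σ hσ
      have h3 : σ x = t := by simpa using mem_freeOn.1 hσ x hxJ
      rw [treeSat, h3]
    rw [h1, Finset.sum_congr rfl h2, hJ,
      sum_freeOn_biUnion _ (fun e _ => interior_subset_treeVars _ _ _) ht.2, treeWeight]
    · refine Finset.prod_congr rfl fun e he => ?_
      rw [← Finset.sum_fiberwise _ (fun σ => σ (far v e))]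
      refine Finset.sum_congr rfl fun t' _ => ?_
      have h4 : treeWeight v s (fun y t => if ρ y = t then 1 else 0) h (far v e) (some e.1) t'
          = treeWeight v s (fun y t' => if Function.update ρ x t y = t' then 1 else 0) h
            (far v e) (some e.1) t' := by
        have hgen : ∀ (h : ℕ) (z : V) (b : Option M) (t' : Bool), x ∉ treeVars v h z b →
            treeWeight v s (fun y t => if ρ y = t then 1 else 0) h z b t'
              = treeWeight v s (fun y t' => if Function.update ρ x t y = t' then 1 else 0) h
                z b t' := by
          intro h
          induction h with
          | zero =>
            intro z b t' hz
            have : z ≠ x := by rintro rfl; exact hz (self_mem_treeVars _ _ _)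
            simp [treeWeight, Function.update_of_ne this]
          | succ h ih =>
            intro z b t' hz
            refine Finset.prod_congr rfl fun e he => Finset.sum_congr rfl fun t'' _ => ?_
            rw [ih _ _ _ (notMem_treeVars_far hz he)]
        exact hgen _ _ _ _ (ht.1 e he).1
      rw [h4, ← ih _ _ (ht.1 e he).2]
      split_ifs with h5
      · refine Finset.sum_congr rfl fun σ hσ => ?_
        rw [(Finset.mem_filter.1 hσ).2, if_pos h5]
      · refine Finset.sum_eq_zero fun σ hσ => ?_
        rw [(Finset.mem_filter.1 hσ).2, if_neg h5]
    · intro e _ σ σ' hσ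
      rw [hσ _ (self_mem_treeVars _ _ _), treeSat_congr _ _ _ hσ]

lemma treeSat_eq_one {σ : V → Bool} (hσ : ∀ b, ∃ j, σ (v b j) = s b j) (h : ℕ) (x : V)
    (a : Option M) : treeSat v s σ h x a = 1 := by
  induction h generalizing x a with
  | zero => rfl
  | succ h ih =>
    refine Finset.prod_eq_one fun e he => ?_
    rw [if_pos, ih]
    obtain ⟨j, hj⟩ := hσ e.1
    rcases eq_or_eq_rev j e.2 with rfl | rfl
    · rw [(mem_outEdges.1 he).1] at hj
      exact Or.inl hj
    · exact Or.inr hj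

lemma sat_of_treeSat_ne_zero {σ : V → Bool} (h : ℕ) (x : V) (a : Option M)
    (h0 : treeSat v s σ h x a ≠ 0) (b : M) (j : Fin 2) (hb : v b j ∈ interior v h x a) :
    some b = a ∨ ∃ j, σ (v b j) = s b j := by
  induction h generalizing x a with
  | zero => simp [interior] at hb
  | succ h ih =>
    rw [treeSat, Finset.prod_ne_zero_iff] at h0
    have key : ∀ e ∈ outEdges v x a, ∃ j, σ (v e.1 j) = s e.1 j := by
      intro e he
      have h1 := h0 e he
      split_ifs at h1 with h2
      · rcases h2 with h2 | h2
        · exact ⟨e.2, by rw [(mem_outEdges.1 he).1, h2]⟩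
        · exact ⟨e.2.rev, h2⟩
      · exact absurd rfl h1
    rw [interior, Finset.mem_insert, Finset.mem_biUnion] at hb
    rcases hb with hb | ⟨e, he, hb⟩
    · by_cases hba : some b = a
      · exact Or.inl hba
      · exact Or.inr (key (b, j) (mem_outEdges.2 ⟨hb, hba⟩))
    · have h1 := h0 e he
      split_ifs at h1 with h2
      · rcases ih _ _ h1 hb with h3 | h3
        · rw [Option.some.inj h3]
          exact Or.inr (key e he)
        · exact Or.inr h3
      · exact absurd rfl h1

/-- The number of solutions that coincide with the solution `ρ` outside of the interior of the
tree and take the value `t` at the root. -/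
lemma card_solutions_fiber (h : ℕ) (x : V) (ht : TreeLike v h x (none : Option M))
    {ρ : V → Bool} (hρ : ∀ b, ∃ j, ρ (v b j) = s b j) (t : Bool) :
    ((Finset.univ.filter fun σ : V → Bool => (∀ b, ∃ j, σ (v b j) = s b j) ∧
        (∀ y, y ∉ interior v h x (none : Option M) → σ y = ρ y) ∧ σ x = t).card : ℝ)
      = treeWeight v s (fun y t => if ρ y = t then 1 else 0) h x (none : Option M) t := by
  classical
  rw [← sum_treeSat h x none ht ρ t, Finset.card_eq_sum_ones, Nat.cast_sum]
  refine Finset.sum_subset_zero_on_sdiff ?_ ?_ ?_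
  · intro σ hσ
    obtain ⟨-, -, h2, h3⟩ := Finset.mem_filter.1 hσ
    exact Finset.mem_filter.2 ⟨mem_freeOn.2 h2, h3⟩
  · intro σ hσ
    obtain ⟨h1, h2⟩ := Finset.mem_sdiff.1 hσ
    obtain ⟨h3, h4⟩ := Finset.mem_filter.1 h1
    rw [mem_freeOn] at h3
    by_contra h0
    refine h2 (Finset.mem_filter.2 ⟨Finset.mem_univ _, fun b => ?_, h3, h4⟩)
    by_cases hb : ∃ j, v b j ∈ interior v h x (none : Option M)
    · obtain ⟨j, hj⟩ := hb
      rcases sat_of_treeSat_ne_zero h x none h0 b j hj with h5 | h5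
      · cases h5
      · exact h5
    · push Not at hb
      obtain ⟨j, hj⟩ := hρ b
      exact ⟨j, by rw [h3 _ (hb j), hj]⟩
  · intro σ hσ
    rw [treeSat_eq_one (Finset.mem_filter.1 hσ).2.1]
    simp

/-- Two distributions on `Bool` whose log-likelihood ratios lie in the same interval differ by at
most the width of the interval. -/
lemma abs_sub_le_of_ratio_bounds {N Q E : Bool → ℝ} (hN : ∀ t, 0 ≤ N t) (hQ : ∀ t, 0 ≤ Q t)
    (hN0 : 0 < N true + N false) (hQ0 : 0 < Q true + Q false)
    (hNE : ∀ g, N g ≤ Real.exp (E g) * N (!g)) (hQE : ∀ g, Q g ≤ Real.exp (E g) * Q (!g))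
    (t : Bool) :
    |N t / (N true + N false) - Q t / (Q true + Q false)| ≤ E true + E false := by
  have key : ∀ (N Q : Bool → ℝ), (∀ t, 0 ≤ N t) → (∀ t, 0 ≤ Q t) → 0 < N true + N false →
      0 < Q true + Q false → (∀ g, N g ≤ Real.exp (E g) * N (!g)) →
      (∀ g, Q g ≤ Real.exp (E g) * Q (!g)) → ∀ t,
      N t / (N true + N false) - Q t / (Q true + Q false) ≤ E true + E false := by
    intro N Q hN hQ hN0 hQ0 hNE hQE t
    have hsN : N true + N false = N t + N (!t) := by cases t <;> simp [add_comm]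
    have hsQ : Q true + Q false = Q t + Q (!t) := by cases t <;> simp [add_comm]
    have hsE : E true + E false = E t + E (!t) := by cases t <;> simp [add_comm]
    rw [hsN, hsQ, hsE]
    rw [hsN] at hN0
    rw [hsQ] at hQ0
    have h1 := hNE t
    have h2 := hQE (!t)
    rw [Bool.not_not] at h2
    set X := E t + E (!t) with hX
    have h3 : N t * Q (!t) ≤ Real.exp X * (N (!t) * Q t) := by
      rw [hX, Real.exp_add]
      calc N t * Q (!t) ≤ (Real.exp (E t) * N (!t)) * (Real.exp (E (!t)) * Q t) :=
            mul_le_mul h1 h2 (hQ _) (mul_nonneg (Real.exp_pos _).le (hN _))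
        _ = _ := by ring
    have h4 : N t / (N t + N (!t)) - Q t / (Q t + Q (!t))
        = (N t * Q (!t) - N (!t) * Q t) / ((N t + N (!t)) * (Q t + Q (!t))) := by
      field_simp
      ring
    rw [h4, div_le_iff₀ (mul_pos hN0 hQ0)]
    have h5 : Real.exp (-X) * (N t * Q (!t)) ≤ N (!t) * Q t := by
      rw [Real.exp_neg, inv_mul_le_iff₀ (Real.exp_pos _)]
      exact h3
    have h6 : 1 - X ≤ Real.exp (-X) := by linarith [Real.add_one_le_exp (-X)]
    have ha := mul_nonneg (hN t) (hQ (!t))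
    have hb := mul_nonneg (hN (!t)) (hQ t)
    have hc := mul_nonneg (hN t) (hQ t)
    have hd := mul_nonneg (hN (!t)) (hQ (!t))
    rcases le_or_gt 0 X with hX0 | hX0
    · nlinarith [mul_nonneg hX0 hb, mul_nonneg hX0 hc, mul_nonneg hX0 hd]
    · exfalso
      -- the bounds on `N` alone force the width to be nonnegative
      have h7 := hNE (!t)
      rw [Bool.not_not] at h7
      have h8 : N t ≤ Real.exp X * N t := by
        rw [hX, Real.exp_add]
        calc N t ≤ Real.exp (E t) * N (!t) := h1
          _ ≤ Real.exp (E t) * (Real.exp (E (!t)) * N t) := by gcongr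
          _ = _ := by ring
      have h9 : N (!t) ≤ Real.exp X * N (!t) := by
        rw [hX, Real.exp_add]
        calc N (!t) ≤ Real.exp (E (!t)) * N t := h7
          _ ≤ Real.exp (E (!t)) * (Real.exp (E t) * N (!t)) := by gcongr
          _ = _ := by ring
      have h10 : Real.exp X < 1 := Real.exp_zero ▸ Real.exp_lt_exp.2 hX0
      nlinarith
  rw [abs_sub_le_iff]
  exact ⟨key N Q hN hQ hN0 hQ0 hNE hQE t, key Q N hQ hN hQ0 hN0 hQE hNE t⟩

/-- A bound that holds conditionally on the values outside of `I` also holds on average. -/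
lemma abs_card_sub_le_of_fibers (S : Finset (V → Bool)) (I : Finset V) (P : (V → Bool) → Prop)
    [DecidablePred P] {q B : ℝ}
    (hS : ∀ ρ ∈ S, |((S.filter fun σ => (∀ y, y ∉ I → σ y = ρ y) ∧ P σ).card : ℝ)
        - q * (S.filter fun σ => ∀ y, y ∉ I → σ y = ρ y).card|
      ≤ B * (S.filter fun σ => ∀ y, y ∉ I → σ y = ρ y).card) :
    |((S.filter P).card : ℝ) - q * S.card| ≤ B * S.card := by
  classical
  set r : (V → Bool) → (V → Bool) := fun σ y => if y ∈ I then false else σ y with hr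
  have hrr : ∀ σ ρ, r σ = r ρ ↔ ∀ y, y ∉ I → σ y = ρ y := by
    intro σ ρ
    rw [funext_iff]
    refine forall_congr' fun y => ?_
    by_cases hy : y ∈ I <;> simp [hr, hy]
  have h1 : ((S.filter P).card : ℝ)
      = ∑ c ∈ S.image r, (((S.filter P).filter fun σ => r σ = c).card : ℝ) := by
    rw [← Nat.cast_sum, Finset.card_eq_sum_card_fiberwise (t := S.image r) (f := r)]
    intro σ hσ
    exact Finset.mem_coe.2 (Finset.mem_image_of_mem _ (Finset.mem_filter.1 hσ).1)
  have h2 : (S.card : ℝ) = ∑ c ∈ S.image r, ((S.filter fun σ => r σ = c).card : ℝ) := by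
    rw [← Nat.cast_sum, Finset.card_eq_sum_card_image r]
  rw [h1, h2, Finset.mul_sum, Finset.mul_sum, ← Finset.sum_sub_distrib]
  refine (Finset.abs_sum_le_sum_abs _ _).trans (Finset.sum_le_sum fun c hc => ?_)
  obtain ⟨ρ, hρ, rfl⟩ := Finset.mem_image.1 hc
  have h3 := hS ρ hρ
  have h4 : (S.filter fun σ => r σ = r ρ) = S.filter fun σ => ∀ y, y ∉ I → σ y = ρ y :=
    Finset.filter_congr fun σ _ => hrr σ ρ
  have h5 : ((S.filter P).filter fun σ => r σ = r ρ)
      = S.filter fun σ => (∀ y, y ∉ I → σ y = ρ y) ∧ P σ := by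
    rw [Finset.filter_filter]
    exact Finset.filter_congr fun σ _ => by rw [hrr, and_comm]
  rw [h4, h5]
  exact h3

/-- The bound on the difference between conditional marginals and Belief Propagation, for
conditioning on any event `A` that is determined by the values outside of the tree. -/
lemma abs_card_sub_le (h k : ℕ) (x : V) (ht : TreeLike v (h + k) x (none : Option M))
    (A : (V → Bool) → Prop) [DecidablePred A]
    (hA : ∀ σ σ', (∀ y, y ∉ interior v (h + k) x (none : Option M) → σ y = σ' y) → A σ → A σ')
    {leaf : V → Bool → ℝ} (hl : ∀ y t, 0 < leaf y t) (t : Bool) :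
    |((Finset.univ.filter fun σ : V → Bool =>
        ((∀ b, ∃ j, σ (v b j) = s b j) ∧ A σ) ∧ σ x = t).card : ℝ)
      - treeWeight v s leaf (h + k) x (none : Option M) t
          / (treeWeight v s leaf (h + k) x (none : Option M) true
            + treeWeight v s leaf (h + k) x (none : Option M) false)
        * (Finset.univ.filter fun σ : V → Bool =>
          (∀ b, ∃ j, σ (v b j) = s b j) ∧ A σ).card|
    ≤ (logWidth v s h k x none + deepForced v s h k x none)
        * (Finset.univ.filter fun σ : V → Bool =>
          (∀ b, ∃ j, σ (v b j) = s b j) ∧ A σ).card := by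
  classical
  set I := interior v (h + k) x (none : Option M) with hI
  set S := Finset.univ.filter fun σ : V → Bool => (∀ b, ∃ j, σ (v b j) = s b j) ∧ A σ with hS
  set Q := treeWeight v s leaf (h + k) x (none : Option M) with hQ
  have hQpos : ∀ t, 0 < Q t := fun t => treeWeight_pos hl _ _ _ _
  have h1 : (Finset.univ.filter fun σ : V → Bool =>
      ((∀ b, ∃ j, σ (v b j) = s b j) ∧ A σ) ∧ σ x = t) = S.filter fun σ => σ x = t := by
    rw [hS, Finset.filter_filter]
  rw [h1]
  refine abs_card_sub_le_of_fibers S I (fun σ => σ x = t) fun ρ hρ => ?_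
  obtain ⟨-, hρs, hρA⟩ := Finset.mem_filter.1 hρ
  set N := treeWeight v s (fun y t => if ρ y = t then (1 : ℝ) else 0) (h + k) x (none : Option M)
    with hN
  have hfib : ∀ t, ((S.filter fun σ => (∀ y, y ∉ I → σ y = ρ y) ∧ σ x = t).card : ℝ) = N t := by
    intro t
    rw [hN, ← card_solutions_fiber (h + k) x ht hρs t, hS, Finset.filter_filter]
    congr 2
    refine Finset.filter_congr fun σ _ => ?_
    constructor
    · rintro ⟨⟨h1, -⟩, h2, h3⟩
      exact ⟨h1, h2, h3⟩
    · rintro ⟨h1, h2, h3⟩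
      exact ⟨⟨h1, hA ρ σ (fun y hy => (h2 y hy).symm) hρA⟩, h2, h3⟩
  have hsum : ((S.filter fun σ => ∀ y, y ∉ I → σ y = ρ y).card : ℝ) = N true + N false := by
    rw [← hfib true, ← hfib false, ← Nat.cast_add,
      ← Finset.card_filter_add_card_filter_not (s := S.filter fun σ => ∀ y, y ∉ I → σ y = ρ y)
        (p := fun σ => σ x = true)]
    simp only [Bool.not_eq_true, Finset.filter_filter]
  have hpos : 0 < N true + N false := by
    rw [← hsum, Nat.cast_pos, Finset.card_pos]
    exact ⟨ρ, Finset.mem_filter.2 ⟨hρ, fun _ _ => rfl⟩⟩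
  have hNn : ∀ t, 0 ≤ N t := fun t =>
    treeWeight_nonneg (fun y t => by split_ifs <;> norm_num) _ _ _ _
  rw [hfib t, hsum]
  have h2 : |N t / (N true + N false) - Q t / (Q true + Q false)|
      ≤ logWidth v s h k x none + deepForced v s h k x none := by
    by_cases h0 : deepForced v s h k x none = 0
    · rw [h0, Nat.cast_zero, add_zero]
      refine abs_sub_le_of_ratio_bounds hNn (fun t => (hQpos t).le) hpos
        (add_pos (hQpos _) (hQpos _)) (E := logBound v s h k x none) (fun g => ?_) (fun g => ?_) t
      · exact treeWeight_le_exp_logBound (fun y t => by split_ifs <;> norm_num) h k x none h0 g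
      · exact treeWeight_le_exp_logBound (fun y t => (hl y t).le) h k x none h0 g
    · have h3 : (1 : ℝ) ≤ deepForced v s h k x none := by
        exact_mod_cast Nat.one_le_iff_ne_zero.2 h0
      have h4 := logWidth_nonneg (v := v) (s := s) h k x none
      have h5 : ∀ R : Bool → ℝ, (∀ t, 0 ≤ R t) → 0 < R true + R false →
          0 ≤ R t / (R true + R false) ∧ R t / (R true + R false) ≤ 1 := by
        intro R hR hR0
        refine ⟨div_nonneg (hR t) hR0.le, (div_le_one hR0).2 ?_⟩
        cases t
        · linarith [hR true]
        · linarith [hR false]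
      have h6 := h5 N hNn hpos
      have h7 := h5 Q (fun t => (hQpos t).le) (add_pos (hQpos _) (hQpos _))
      rw [abs_le]
      constructor <;> linarith
  have h3 : N t - Q t / (Q true + Q false) * (N true + N false)
      = (N t / (N true + N false) - Q t / (Q true + Q false)) * (N true + N false) := by
    field_simp
  rw [h3, abs_mul, abs_of_pos hpos]
  exact mul_le_mul_of_nonneg_right h2 hpos.le

end Counting

/-! ### Belief Propagation and marginals of a formula -/

section Marginals

variable {n : ℕ} (Φ : Formula n)

/-- The partition functions of the computation trees with free boundary. -/
noncomputable abbrev freeWeight : ℕ → Fin n → Option (Fin Φ.numClauses) → Bool → ℝ :=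
  treeWeight Φ.var Φ.sign fun _ _ => 1

lemma normalizePair_eq {w W : Bool → ℝ} {c : ℝ} (hc : 0 < c) (hw : ∀ t, w t = c * W t)
    (hW : ∀ t, 0 < W t) (t : Bool) : normalizePair w t = W t / (W true + W false) := by
  have h1 : w true + w false ≠ 0 := by
    rw [hw, hw, ← mul_add]
    exact (mul_pos hc (add_pos (hW _) (hW _))).ne'
  rw [normalizePair, if_neg h1, hw, hw, hw, ← mul_add, mul_div_mul_left _ _ hc.ne']

lemma freeWeight_pos (h : ℕ) (x : Fin n) (a : Option (Fin Φ.numClauses)) (t : Bool) :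
    0 < freeWeight Φ h x a t :=
  treeWeight_pos (fun _ _ => one_pos) h x a t

/-- If the incoming messages are the normalized partition functions of the computation trees, then
the clause update yields the factor of the clause in the recursion for `treeWeight`, up to a
positive constant that does not depend on the value. -/
lemma clauseUpdate_eq {h : ℕ} {ν : Φ.Messages}
    (hν : ∀ a j t, ν a j t = freeWeight Φ h (Φ.var a j) (some a) t /
      (freeWeight Φ h (Φ.var a j) (some a) true + freeWeight Φ h (Φ.var a j) (some a) false))
    (e : Fin Φ.numClauses × Fin 2) :
    ∃ c : ℝ, 0 < c ∧ ∀ t, Φ.clauseUpdate ν e.1 e.2 t = c * ∑ t' : Bool,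
      if t = Φ.sign e.1 e.2 ∨ t' = farSign Φ.sign e then
        freeWeight Φ h (far Φ.var e) (some e.1) t' else 0 := by
  set W := freeWeight Φ h (far Φ.var e) (some e.1) with hW
  have hpos : ∀ t, 0 < W t := fun t => freeWeight_pos Φ _ _ _ _
  have hT := hpos true
  have hF := hpos false
  have hS : 0 < W true + W false := add_pos hT hF
  have hν' : ∀ t, ν e.1 e.2.rev t = W t / (W true + W false) := fun t => hν _ _ _
  refine ⟨(W true + W false + W (farSign Φ.sign e))⁻¹, inv_pos.2 (add_pos hS (hpos _)), ?_⟩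
  intro t
  have hfar : Φ.sign e.1 e.2.rev = farSign Φ.sign e := rfl
  rw [sum_clause_weight, Formula.clauseUpdate, hν', hν', hfar]
  have h1 := hpos (farSign Φ.sign e)
  have h2 : W (farSign Φ.sign e) + W (!farSign Φ.sign e) = W true + W false := by
    cases farSign Φ.sign e <;> simp [add_comm]
  by_cases ht : t = Φ.sign e.1 e.2
  · rw [if_pos ht, if_neg (by simp [ht]), h2]
    field_simp
    simp
  · rw [if_neg ht, if_pos (Ne.symm ht), ← h2]
    have h3 : W (farSign Φ.sign e) + W (!farSign Φ.sign e) ≠ 0 := by rw [h2]; exact hS.ne'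
    have h4 : W (farSign Φ.sign e) + W (!farSign Φ.sign e) + W (farSign Φ.sign e) ≠ 0 := by
      rw [h2]; exact (add_pos hS h1).ne'
    field_simp
    ring

lemma prod_clauseUpdate {h : ℕ} {ν : Φ.Messages}
    (hν : ∀ a j t, ν a j t = freeWeight Φ h (Φ.var a j) (some a) t /
      (freeWeight Φ h (Φ.var a j) (some a) true + freeWeight Φ h (Φ.var a j) (some a) false))
    (x : Fin n) (a : Option (Fin Φ.numClauses)) (t : Bool) :
    normalizePair (fun t => ∏ e ∈ outEdges Φ.var x a, Φ.clauseUpdate ν e.1 e.2 t) t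
      = freeWeight Φ (h + 1) x a t /
        (freeWeight Φ (h + 1) x a true + freeWeight Φ (h + 1) x a false) := by
  choose c hc hct using clauseUpdate_eq Φ hν
  refine normalizePair_eq (c := ∏ e ∈ outEdges Φ.var x a, c e) (W := freeWeight Φ (h + 1) x a)
    (Finset.prod_pos fun e _ => hc e) (fun t => ?_) (fun t => freeWeight_pos Φ _ _ _ _) t
  rw [freeWeight, treeWeight, ← Finset.prod_mul_distrib]
  exact Finset.prod_congr rfl fun e _ => hct e t

lemma bpMessages_eq (h : ℕ) (a : Fin Φ.numClauses) (j : Fin 2) (t : Bool) :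
    (Φ.bpMessages h).2 a j t = freeWeight Φ h (Φ.var a j) (some a) t /
      (freeWeight Φ h (Φ.var a j) (some a) true + freeWeight Φ h (Φ.var a j) (some a) false) := by
  induction h generalizing a j t with
  | zero => norm_num [Formula.bpMessages, treeWeight]
  | succ h ih =>
    rw [← prod_clauseUpdate Φ ih]
    simp only [Formula.bpMessages, Formula.varUpdate]
    congr 1
    funext t
    rw [outEdges, Finset.prod_filter]
    refine Finset.prod_congr rfl fun e _ => ?_
    simp

/-- The Belief Propagation estimate is the root marginal of the computation tree with free
boundary. -/
lemma bpMarginal_eq (h : ℕ) (x : Fin n) (t : Bool) :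
    Φ.bpMarginal (h + 1) x t = freeWeight Φ (h + 1) x none t /
      (freeWeight Φ (h + 1) x none true + freeWeight Φ (h + 1) x none false) := by
  rw [← prod_clauseUpdate Φ (bpMessages_eq Φ h)]
  simp only [Formula.bpMarginal, Formula.bpMessages]
  congr 1
  funext t
  rw [outEdges, Finset.prod_filter]
  refine Finset.prod_congr rfl fun e _ => ?_
  simp

lemma edist_far_le (e : Fin Φ.numClauses × Fin 2) :
    Φ.graph.edist (Sum.inl (Φ.var e.1 e.2)) (Sum.inl (far Φ.var e)) ≤ 2 := by
  have h1 : Φ.graph.Adj (Sum.inl (Φ.var e.1 e.2)) (Sum.inr e.1) := by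
    rw [Formula.graph, SimpleGraph.fromRel_adj]
    exact ⟨by simp, Or.inl ⟨e.1, e.2, rfl, rfl⟩⟩
  have h2 : Φ.graph.Adj (Sum.inr e.1) (Sum.inl (far Φ.var e)) := by
    rw [Formula.graph, SimpleGraph.fromRel_adj]
    exact ⟨by simp, Or.inr ⟨e.1, e.2.rev, rfl, rfl⟩⟩
  exact (SimpleGraph.Walk.cons h1 (SimpleGraph.Walk.cons h2 .nil)).edist_le

/-- The interior of the tree of depth `h + 1` lies at distance at most `2 * h`, so that the sphere
of radius `2 * (h + 1)` does not meet it. -/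
lemma edist_interior (h : ℕ) (x y : Fin n) (a : Option (Fin Φ.numClauses))
    (hy : y ∈ interior Φ.var (h + 1) x a) :
    Φ.graph.edist (Sum.inl x) (Sum.inl y) ≤ (2 * h : ℕ) := by
  induction h generalizing x a with
  | zero =>
    have : y = x := by simpa [interior] using hy
    simp [this]
  | succ h ih =>
    rw [interior, Finset.mem_insert, Finset.mem_biUnion] at hy
    rcases hy with rfl | ⟨e, he, hy⟩
    · simp
    · refine (SimpleGraph.edist_triangle (v := Sum.inl (far Φ.var e))).trans ?_
      have h1 := edist_far_le Φ e
      rw [(mem_outEdges.1 he).1] at h1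
      refine (add_le_add h1 (ih _ _ hy)).trans ?_
      rw [mul_add, add_comm]
      push_cast
      exact le_rfl

lemma notMem_interior_of_mem_sphere {h : ℕ} {x y : Fin n} (hy : y ∈ Φ.sphere (2 * h) x) :
    y ∉ interior Φ.var h x none := by
  intro h1
  cases h with
  | zero => simp [interior] at h1
  | succ h =>
    have h2 := edist_interior Φ h x y none h1
    have h3 : Φ.graph.edist (Sum.inl x) (Sum.inl y) = (2 * (h + 1) : ℕ) := hy
    rw [h3, Nat.cast_le] at h2
    omega

lemma real_uniformOn_eq (P Q : (Fin n → Bool) → Prop) [DecidablePred P]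
    [DecidablePred Q] :
    (uniformOn {σ | P σ}).real {σ : Fin n → Bool | Q σ}
      = ((Finset.univ.filter fun σ => P σ ∧ Q σ).card : ℝ) / (Finset.univ.filter P).card := by
  have h1 : ∀ (R : (Fin n → Bool) → Prop) [DecidablePred R],
      Measure.count {σ | R σ} = ((Finset.univ.filter R).card : ENNReal) := by
    intro R _
    rw [← Measure.count_apply_finset]
    simp
  rw [uniformOn, measureReal_def, cond_apply (Set.toFinite _).measurableSet, Set.ofPred_and.symm,
    h1, h1, ENNReal.toReal_mul, ENNReal.toReal_inv, ENNReal.toReal_natCast, ENNReal.toReal_natCast,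
    inv_mul_eq_div]

/-- Conditioning the Gibbs measure on an event gives the uniform distribution on the solutions
that belong to it. -/
lemma gibbs_cond_eq (A : (Fin n → Bool) → Prop) :
    cond Φ.gibbs {σ | A σ} = uniformOn {σ | (∀ b, ∃ j, σ (Φ.var b j) = Φ.sign b j) ∧ A σ} := by
  rw [Formula.gibbs, uniformOn, uniformOn,
    cond_cond_eq_cond_inter (Set.toFinite _).measurableSet (Set.toFinite _).measurableSet]
  rfl

/-- The deviation of conditional marginals from the Belief Propagation estimate that the signs of
the formula allow on trees of depth `h + k`. -/
noncomputable def bpGap (h k : ℕ) (x : Fin n) : ℝ :=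
  logWidth Φ.var Φ.sign h k x none + deepForced Φ.var Φ.sign h k x none

/-- The marginal of the root under conditioning on any event `A` outside of the interior of the
tree differs from the Belief Propagation estimate by at most `bpGap`. Conditioning on the sphere, on
nothing, and on the value of a distant variable are the cases of interest. -/
lemma abs_cond_sub_bpMarginal_le {h k : ℕ} (hk : 1 ≤ h + k) (x : Fin n)
    (ht : TreeLike Φ.var (h + k) x none) (A : (Fin n → Bool) → Prop)
    (hA : ∀ σ σ', (∀ y, y ∉ interior Φ.var (h + k) x none → σ y = σ' y) → A σ → A σ')
    (hne : ∃ σ ∈ Φ.solutions, A σ) (t : Bool) :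
    |(cond Φ.gibbs {σ | A σ}).real {σ | σ x = t} - Φ.bpMarginal (h + k) x t|
      ≤ bpGap Φ h k x := by
  have : DecidablePred A := Classical.decPred A
  have h1 := abs_card_sub_le (s := Φ.sign) h k x ht A hA (leaf := fun _ _ => 1)
    (fun _ _ => one_pos) t
  have h2 : Φ.bpMarginal (h + k) x t = freeWeight Φ (h + k) x none t /
      (freeWeight Φ (h + k) x none true + freeWeight Φ (h + k) x none false) := by
    obtain ⟨l, hl⟩ := Nat.exists_eq_add_of_le' hk
    rw [hl]
    exact bpMarginal_eq Φ l x t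
  rw [gibbs_cond_eq, real_uniformOn_eq, h2]
  rw [← bpGap] at h1
  set S := Finset.univ.filter fun σ : Fin n → Bool =>
    (∀ b, ∃ j, σ (Φ.var b j) = Φ.sign b j) ∧ A σ with hS
  have hpos : (0 : ℝ) < S.card := by
    obtain ⟨σ, hσ, hσA⟩ := hne
    rw [Nat.cast_pos, Finset.card_pos]
    exact ⟨σ, Finset.mem_filter.2 ⟨Finset.mem_univ _, hσ, hσA⟩⟩
  rw [← mul_le_mul_iff_of_pos_right hpos]
  rw [← abs_of_pos hpos, ← abs_mul, abs_of_pos hpos, sub_mul, div_mul_cancel₀ _ hpos.ne']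
  convert! h1

variable {Φ}

lemma solutions_nonempty (hZ : 0 < Φ.Z) : Φ.solutions.Nonempty :=
  (Set.ncard_pos (Set.toFinite _)).1 hZ

lemma isProbabilityMeasure_gibbs (hZ : 0 < Φ.Z) : IsProbabilityMeasure Φ.gibbs :=
  isProbabilityMeasure_uniformOn (Set.toFinite _) (solutions_nonempty hZ)

lemma abs_condMarginal_sub_le {h k : ℕ} (hk : 1 ≤ h + k) (x : Fin n)
    (ht : TreeLike Φ.var (h + k) x none) (τ : Fin n → Bool) (hτ : τ ∈ Φ.solutions) (t : Bool) :
    |Φ.condMarginal (2 * (h + k)) τ x t - Φ.bpMarginal (h + k) x t| ≤ bpGap Φ h k x := by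
  refine abs_cond_sub_bpMarginal_le Φ hk x ht
    (fun σ => ∀ y ∈ Φ.sphere (2 * (h + k)) x, σ y = τ y) ?_ ⟨τ, hτ, fun _ _ => rfl⟩ t
  intro σ σ' hσ h1 y hy
  rw [← hσ y (notMem_interior_of_mem_sphere Φ hy), h1 y hy]

lemma abs_marginal_sub_le (hZ : 0 < Φ.Z) {h k : ℕ} (hk : 1 ≤ h + k) (x : Fin n)
    (ht : TreeLike Φ.var (h + k) x none) (t : Bool) :
    |Φ.marginal x t - Φ.bpMarginal (h + k) x t| ≤ bpGap Φ h k x := by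
  obtain ⟨σ, hσ⟩ := solutions_nonempty hZ
  have := isProbabilityMeasure_gibbs hZ
  have h1 := abs_cond_sub_bpMarginal_le Φ hk x ht (fun _ => True) (fun _ _ _ h => h)
    ⟨σ, hσ, trivial⟩ t
  have h2 : {σ : Fin n → Bool | True} = Set.univ := by ext; simp
  rw [h2, cond_univ] at h1
  exact h1

lemma abs_condMarginal_sub_marginal_le (hZ : 0 < Φ.Z) {h k : ℕ} (hk : 1 ≤ h + k) (x : Fin n)
    (ht : TreeLike Φ.var (h + k) x none) (τ : Fin n → Bool) (hτ : τ ∈ Φ.solutions) (t : Bool) :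
    |Φ.condMarginal (2 * (h + k)) τ x t - Φ.marginal x t| ≤ 2 * bpGap Φ h k x := by
  have h1 := abs_condMarginal_sub_le hk x ht τ hτ t
  have h2 := abs_marginal_sub_le hZ hk x ht t
  rw [abs_le] at *
  constructor <;> linarith

/-- If `y` lies outside of a tree around `x`, then the value of `y` hardly influences the
marginal of `x`. -/
lemma abs_joint_sub_le (hZ : 0 < Φ.Z) {h k : ℕ} (hk : 1 ≤ h + k) (x y : Fin n)
    (ht : TreeLike Φ.var (h + k) x none) (hy : y ∉ interior Φ.var (h + k) x none) (t u : Bool) :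
    |Φ.gibbs.real {σ | σ x = t ∧ σ y = u} - Φ.marginal x t * Φ.marginal y u|
      ≤ 2 * bpGap Φ h k x := by
  have := isProbabilityMeasure_gibbs hZ
  have hgap : 0 ≤ bpGap Φ h k x := (abs_nonneg _).trans (abs_marginal_sub_le hZ hk x ht t)
  by_cases hne : ∃ σ ∈ Φ.solutions, σ y = u
  · have h1 := abs_cond_sub_bpMarginal_le Φ hk x ht (fun σ => σ y = u)
      (fun σ σ' hσ hu => by rw [← hσ y hy, hu]) hne t
    have h2 := abs_marginal_sub_le hZ hk x ht t
    have h3 : Φ.gibbs.real {σ | σ x = t ∧ σ y = u}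
        = (cond Φ.gibbs {σ | σ y = u}).real {σ | σ x = t} * Φ.marginal y u := by
      rw [Formula.marginal, mul_comm, measureReal_def (cond _ _),
        cond_apply (Set.toFinite _).measurableSet, ENNReal.toReal_mul, ENNReal.toReal_inv,
        ← measureReal_def, ← measureReal_def]
      have h4 : {σ : Fin n → Bool | σ y = u} ∩ {σ | σ x = t} = {σ | σ x = t ∧ σ y = u} := by
        ext σ
        exact and_comm
      rw [h4]
      by_cases h5 : Φ.gibbs.real {σ | σ y = u} = 0
      · rw [h5, zero_mul]
        refine le_antisymm ?_ measureReal_nonneg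
        rw [← h5]
        exact measureReal_mono fun σ hσ => hσ.2
      · rw [mul_inv_cancel_left₀ h5]
    have h6 : 0 ≤ Φ.marginal y u := measureReal_nonneg
    have h7 : Φ.marginal y u ≤ 1 := measureReal_le_one
    rw [h3, ← sub_mul, abs_mul, abs_of_nonneg h6]
    have h8 : |(cond Φ.gibbs {σ | σ y = u}).real {σ | σ x = t} - Φ.marginal x t|
        ≤ 2 * bpGap Φ h k x := by
      rw [abs_le] at *
      constructor <;> linarith
    exact (mul_le_of_le_one_right (abs_nonneg _) h7).trans h8
  · have h1 : Φ.marginal y u = 0 := by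
      push Not at hne
      rw [Formula.marginal, measureReal_eq_zero_iff, Formula.gibbs,
        uniformOn_eq_zero_iff (Set.toFinite _)]
      ext σ
      simpa using hne σ
    have h2 : Φ.gibbs.real {σ | σ x = t ∧ σ y = u} = 0 := by
      refine le_antisymm ?_ measureReal_nonneg
      rw [← h1]
      exact measureReal_mono fun σ hσ => hσ.2
    rw [h1, h2]
    simpa using hgap

end Marginals

/-! ### Explorations of the bipartite graph and tree-like neighbourhoods -/

section Exploration

variable {V M : Type*}

/-- The variables that are discovered by the list of edges `l`, most recent first, when the
exploration starts from the list `S`. -/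
def verts (v : M → Fin 2 → V) (S : List V) (l : List (M × Fin 2)) : List V :=
  l.map (far v) ++ S

/-- The list of edges `l`, most recent first, is an exploration from `S`: every edge leaves a
variable that was discovered before. -/
def Grows (v : M → Fin 2 → V) (S : List V) : List (M × Fin 2) → Prop
  | [] => True
  | e :: l => Grows v S l ∧ v e.1 e.2 ∈ verts v S l

/-- Explorations from `S` along at most `R` distinct clauses never discover a variable twice. -/
def AcyclicFrom (v : M → Fin 2 → V) (S : List V) (R : ℕ) : Prop :=
  ∀ l, Grows v S l → (l.map Prod.fst).Nodup → l.length ≤ R → (verts v S l).Nodup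

/-- The final variable of a walk from `x`, with the edges listed most recent first. -/
def endpoint (v : M → Fin 2 → V) (x : V) : List (M × Fin 2) → V
  | [] => x
  | e :: _ => far v e

/-- The final clause of a walk. -/
def lastClause : List (M × Fin 2) → Option M
  | [] => none
  | e :: _ => some e.1

/-- Non-backtracking walks from `x`, with the edges listed most recent first. -/
def IsWalk (v : M → Fin 2 → V) (x : V) : List (M × Fin 2) → Prop
  | [] => True
  | e :: l => IsWalk v x l ∧ v e.1 e.2 = endpoint v x l ∧ some e.1 ≠ lastClause l

/-- A walk that is allowed to backtrack, with the edges listed in their order. -/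
def Chains (v : M → Fin 2 → V) : V → List (M × Fin 2) → Prop
  | _, [] => True
  | x, e :: l => v e.1 e.2 = x ∧ Chains v (far v e) l

/-- An exploration whose most recent edge closes a cycle. -/
def Closes (v : M → Fin 2 → V) (S : List V) : List (M × Fin 2) → Prop
  | [] => False
  | e :: l => Grows v S (e :: l) ∧ far v e ∈ verts v S l

variable {v : M → Fin 2 → V} {S : List V} {x : V} {R : ℕ}

@[simp] lemma verts_cons (e : M × Fin 2) (l : List (M × Fin 2)) :
    verts v S (e :: l) = far v e :: verts v S l := rfl

lemma verts_append (l l' : List (M × Fin 2)) :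
    verts v S (l ++ l') = l.map (far v) ++ verts v S l' := by
  simp [verts]

lemma Grows.mem_verts {l : List (M × Fin 2)} (hl : Grows v S l) {f : M × Fin 2} (hf : f ∈ l)
    (j : Fin 2) : v f.1 j ∈ verts v S l := by
  induction l with
  | nil => simp at hf
  | cons e l ih =>
    rw [verts_cons]
    rcases List.mem_cons.1 hf with rfl | hf
    · rcases eq_or_eq_rev j f.2 with rfl | rfl
      · exact List.mem_cons_of_mem _ hl.2
      · exact List.mem_cons_self
    · exact List.mem_cons_of_mem _ (ih hl.1 hf)

lemma endpoint_mem_verts (hx : x ∈ S) (l : List (M × Fin 2)) :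
    endpoint v x l ∈ verts v S l := by
  cases l with
  | nil => simpa [verts, endpoint]
  | cons e l => exact List.mem_cons_self

lemma IsWalk.grows (hx : x ∈ S) {l : List (M × Fin 2)} (hl : IsWalk v x l) : Grows v S l := by
  induction l with
  | nil => trivial
  | cons e l ih => exact ⟨ih hl.1, by rw [hl.2.1]; exact endpoint_mem_verts hx l⟩

lemma IsWalk.of_append {l l' : List (M × Fin 2)} (hl : IsWalk v x (l ++ l')) : IsWalk v x l' := by
  induction l with
  | nil => exact hl
  | cons e l ih => exact ih hl.1

lemma IsWalk.nodup (hR : AcyclicFrom v S R) (hx : x ∈ S) {l : List (M × Fin 2)}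
    (hl : IsWalk v x l) (hlen : l.length ≤ R) : (l.map Prod.fst).Nodup := by
  induction l with
  | nil => simp
  | cons e l ih =>
    have h1 := ih hl.1 (by simp at hlen; omega)
    rw [List.map_cons, List.nodup_cons]
    refine ⟨fun he => ?_, h1⟩
    obtain ⟨f, hf, hfe⟩ := List.mem_map.1 he
    cases l with
    | nil => simp at hf
    | cons g l =>
      rcases List.mem_cons.1 hf with rfl | hf
      · exact hl.2.2 (by rw [lastClause, hfe])
      · have h2 := hR _ (hl.1.grows hx) h1 (by simp at hlen ⊢; omega)
        rw [verts_cons, List.nodup_cons] at h2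
        have h3 := (hl.1.1.grows hx).mem_verts hf e.2
        rw [hfe, hl.2.1] at h3
        exact h2.1 h3

lemma IsWalk.mem_far {p w : List (M × Fin 2)} {c : M × Fin 2} (hp : IsWalk v x (p ++ c :: w))
    {f : M × Fin 2} (hf : f ∈ p) (j : Fin 2) : v f.1 j ∈ (p ++ [c]).map (far v) := by
  induction p with
  | nil => simp at hf
  | cons e p ih =>
    rcases List.mem_cons.1 hf with rfl | hf
    · rcases eq_or_eq_rev j f.2 with rfl | rfl
      · rw [hp.2.1]
        cases p <;> simp [endpoint]
      · exact List.mem_cons_self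
    · exact List.mem_cons_of_mem _ (ih hp.1 hf)

lemma endpoint_append_cons_mem (q w : List (M × Fin 2)) (c : M × Fin 2) :
    endpoint v x (q ++ c :: w) ∈ (q ++ [c]).map (far v) := by
  cases q <;> simp [endpoint]

/-- Two walks that split at some point form an exploration along distinct clauses. -/
lemma grows_branches (hv : ∀ b, v b 0 ≠ v b 1) (hR : AcyclicFrom v S R) (hx : x ∈ S)
    {p q w : List (M × Fin 2)} {c c' : M × Fin 2} (hc : c ≠ c')
    (hp : IsWalk v x (p ++ c :: w)) (hq : IsWalk v x (q ++ c' :: w))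
    (hlen : q.length + p.length + w.length + 2 ≤ R) :
    Grows v S (q ++ c' :: (p ++ c :: w)) ∧
      ((q ++ c' :: (p ++ c :: w)).map Prod.fst).Nodup := by
  have hpn := hp.nodup hR hx (by simp; omega)
  have hpv := hR _ (hp.grows hx) hpn (by simp; omega)
  induction q with
  | nil =>
    have hw : endpoint v x w ∈ verts v S w := endpoint_mem_verts hx w
    have hb : v c'.1 c'.2 = endpoint v x w := hq.2.1
    refine ⟨⟨hp.grows hx, ?_⟩, ?_⟩
    · rw [hb, verts_append, verts_cons]
      exact List.mem_append_right _ (List.mem_cons_of_mem _ hw)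
    · rw [List.nil_append, List.map_cons, List.nodup_cons]
      refine ⟨fun he => ?_, hpn⟩
      obtain ⟨f, hf, hfe⟩ := List.mem_map.1 he
      rcases List.mem_append.1 hf with hf | hf
      · have h1 := hp.mem_far hf c'.2
        rw [hfe, hb] at h1
        have h2 : verts v S (p ++ c :: w) = (p ++ [c]).map (far v) ++ verts v S w := by
          rw [verts_append]; simp
        rw [h2] at hpv
        exact (List.disjoint_of_nodup_append hpv) h1 hw
      · rcases List.mem_cons.1 hf with rfl | hf
        · refine hc (Prod.ext hfe ?_)
          have h1 : v c'.1 f.2 = v c'.1 c'.2 := by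
            rw [hb, ← hfe]
            exact hp.of_append.2.1
          have h2 := hv c'.1
          generalize f.2 = i at *
          generalize c'.2 = j at *
          revert h1
          fin_cases i <;> fin_cases j <;> simp [h2, h2.symm]
        · have h1 : ((c' :: w).map Prod.fst).Nodup := IsWalk.nodup hR hx hq (by simp; omega)
          rw [List.map_cons, List.nodup_cons] at h1
          exact h1.1 (List.mem_map.2 ⟨f, hf, hfe⟩)
  | cons e q ih =>
    obtain ⟨h1, h2⟩ := ih hq.1 (by simp at hlen; omega)
    have h3 := hR _ h1 h2 (by simp at hlen ⊢; omega)
    have hbe : v e.1 e.2 ∈ (q ++ [c']).map (far v) := by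
      rw [hq.2.1]
      exact endpoint_append_cons_mem _ _ _
    have h4 : verts v S (q ++ c' :: (p ++ c :: w))
        = (q ++ [c']).map (far v) ++ verts v S (p ++ c :: w) := by
      rw [verts_append]; simp
    refine ⟨⟨h1, ?_⟩, ?_⟩
    · change v e.1 e.2 ∈ verts v S (q ++ c' :: (p ++ c :: w))
      rw [h4]
      exact List.mem_append_left _ hbe
    · rw [List.cons_append, List.map_cons, List.nodup_cons]
      refine ⟨fun he => ?_, h2⟩
      obtain ⟨f, hf, hfe⟩ := List.mem_map.1 he
      have h5 : ((e :: q ++ c' :: w).map Prod.fst).Nodup :=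
        IsWalk.nodup hR hx hq (by simp at hlen ⊢; omega)
      rw [List.cons_append, List.map_cons, List.nodup_cons] at h5
      have h6 : f ∈ p ++ c :: w := by
        rcases List.mem_append.1 hf with hf | hf
        · exact absurd (List.mem_map.2 ⟨f, List.mem_append_left _ hf, hfe⟩) h5.1
        · rcases List.mem_cons.1 hf with rfl | hf
          · exact absurd (List.mem_map.2 ⟨f, by simp, hfe⟩) h5.1
          · exact hf
      have h7 := (hp.grows hx).mem_verts h6 e.2
      rw [hfe] at h7
      rw [h4] at h3
      exact (List.disjoint_of_nodup_append h3) hbe h7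

lemma exists_closes_of_not_acyclicFrom (hS : S.Nodup) (h : ¬ AcyclicFrom v S R) :
    ∃ l, Closes v S l ∧ (l.map Prod.fst).Nodup ∧ l.length ≤ R := by
  by_contra hno
  push Not at hno
  refine h fun l => ?_
  induction l with
  | nil => intro _ _ _; simpa [verts]
  | cons e l ih =>
    intro h1 h2 h3
    rw [verts_cons, List.nodup_cons]
    refine ⟨fun h4 => ?_, ih h1.1 (List.nodup_cons.1 h2).2 (by simp at h3; omega)⟩
    have := hno (e :: l) ⟨h1, h4⟩ h2
    omega

variable [DecidableEq V] [Fintype M] [DecidableEq M]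

lemma isWalk_cons_iff {w : List (M × Fin 2)} (hw : IsWalk v x w) {e : M × Fin 2} :
    IsWalk v x (e :: w) ↔ e ∈ outEdges v (endpoint v x w) (lastClause w) := by
  rw [mem_outEdges]
  exact ⟨fun h => h.2, fun h => ⟨hw, h⟩⟩

lemma exists_walk_of_mem_treeVars (h : ℕ) {w : List (M × Fin 2)} (hw : IsWalk v x w) {y : V}
    (hy : y ∈ treeVars v h (endpoint v x w) (lastClause w)) :
    ∃ p : List (M × Fin 2), p.length ≤ h ∧ IsWalk v x (p ++ w) ∧ endpoint v x (p ++ w) = y := by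
  induction h generalizing w with
  | zero => exact ⟨[], le_rfl, hw, (Finset.mem_singleton.1 hy).symm⟩
  | succ h ih =>
    rw [treeVars, Finset.mem_insert, Finset.mem_biUnion] at hy
    rcases hy with hy | ⟨e, he, hy⟩
    · exact ⟨[], Nat.zero_le _, hw, hy.symm⟩
    · obtain ⟨p, h1, h2, h3⟩ := ih (w := e :: w) ((isWalk_cons_iff hw).2 he) hy
      exact ⟨p ++ [e], by simpa using h1, by simpa using h2, by simpa using h3⟩

/-- Acyclicity implies that neighbourhoods are trees in the recursive sense. -/
lemma AcyclicFrom.treeLike (hv : ∀ b, v b 0 ≠ v b 1) (hR : AcyclicFrom v S R) (hx : x ∈ S)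
    (h : ℕ) {w : List (M × Fin 2)} (hw : IsWalk v x w) (hlen : w.length + 2 * h ≤ R) :
    TreeLike v h (endpoint v x w) (lastClause w) := by
  induction h generalizing w with
  | zero => trivial
  | succ h ih =>
    refine ⟨fun e he => ⟨fun hmem => ?_, ?_⟩, fun c hc c' hc' hcc => ?_⟩
    · have he' := (isWalk_cons_iff hw).2 he
      obtain ⟨p, h1, h2, h3⟩ := exists_walk_of_mem_treeVars h he' hmem
      have h4 := hR _ (h2.grows hx) (h2.nodup hR hx (by simp; omega)) (by simp; omega)
      have h5 : verts v S (p ++ e :: w) = (p ++ [e]).map (far v) ++ verts v S w := by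
        rw [verts_append]; simp
      rw [h5] at h4
      refine (List.disjoint_of_nodup_append h4) ?_ (endpoint_mem_verts hx w)
      rw [← h3]
      exact endpoint_append_cons_mem _ _ _
    · exact ih (w := e :: w) ((isWalk_cons_iff hw).2 he) (by simp; omega)
    · rw [Function.onFun, Finset.disjoint_left]
      intro y hy hy'
      obtain ⟨p, h1, h2, h3⟩ := exists_walk_of_mem_treeVars h
        ((isWalk_cons_iff hw).2 hc) hy
      obtain ⟨q, h1', h2', h3'⟩ := exists_walk_of_mem_treeVars h
        ((isWalk_cons_iff hw).2 hc') hy'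
      obtain ⟨h4, h5⟩ := grows_branches hv hR hx hcc h2 h2' (by omega)
      have h6 := hR _ h4 h5 (by simp; omega)
      have h7 : verts v S (q ++ c' :: (p ++ c :: w))
          = (q ++ [c']).map (far v) ++ verts v S (p ++ c :: w) := by
        rw [verts_append]; simp
      rw [h7] at h6
      refine (List.disjoint_of_nodup_append h6) (a := y) ?_ ?_
      · rw [← h3']
        exact endpoint_append_cons_mem _ _ _
      · rw [← h3]
        exact endpoint_mem_verts hx _

lemma AcyclicFrom.notMem_treeVars (hR : AcyclicFrom v S R) (hx : x ∈ S) {y : V} (hy : y ∈ S)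
    (hxy : y ≠ x) {h : ℕ} (hlen : h ≤ R) : y ∉ treeVars v h x none := by
  intro hmem
  obtain ⟨p, h1, h2, h3⟩ := exists_walk_of_mem_treeVars (x := x) h (w := []) trivial hmem
  rw [List.append_nil] at h2 h3
  have h4 := hR _ (h2.grows hx) (h2.nodup hR hx (by omega)) (by omega)
  cases p with
  | nil => exact hxy h3.symm
  | cons e p =>
    rw [verts_cons, List.nodup_cons] at h4
    exact h4.1 (List.mem_append_right _ (by rw [show far v e = y from h3]; exact hy))

/-- The number of non-backtracking walks is at most the number of walks along distinct clauses, as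
long as the neighbourhood is acyclic. -/
lemma AcyclicFrom.numWalks_le (hR : AcyclicFrom v S R) (hx : x ∈ S) (k : ℕ) (hk : k ≤ R) :
    numWalks v k x none ≤ Nat.card {f : Fin k → M × Fin 2 //
      Function.Injective (fun i => (f i).1) ∧ Chains v x (List.ofFn f)} := by
  classical
  have key : ∀ (k : ℕ) (w : List (M × Fin 2)), IsWalk v x w → w.length + k ≤ R →
      numWalks v k (endpoint v x w) (lastClause w) ≤ Nat.card {f : Fin k → M × Fin 2 //
        ((w.reverse ++ List.ofFn f).map Prod.fst).Nodup
          ∧ Chains v (endpoint v x w) (List.ofFn f)} := by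
    intro k
    induction k with
    | zero =>
      intro w hw hlen
      rw [numWalks]
      refine Nat.one_le_iff_ne_zero.2 (Nat.card_ne_zero.2 ⟨⟨⟨Fin.elim0, ?_, ?_⟩⟩, inferInstance⟩)
      · have := hw.nodup hR hx (by omega)
        simpa [List.map_reverse] using this
      · simp [Chains]
    | succ k ih =>
      intro w hw hlen
      rw [numWalks]
      have h1 : ∀ e ∈ outEdges v (endpoint v x w) (lastClause w),
          numWalks v k (far v e) (some e.1) ≤ Nat.card {f : Fin k → M × Fin 2 //
            (((e :: w).reverse ++ List.ofFn f).map Prod.fst).Nodup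
              ∧ Chains v (far v e) (List.ofFn f)} := fun e he =>
        ih (e :: w) ((isWalk_cons_iff hw).2 he) (by simp; omega)
      refine (Finset.sum_le_sum h1).trans ?_
      rw [← Finset.sum_coe_sort, ← Nat.card_sigma]
      refine Nat.card_le_card_of_injective (fun p => ⟨Fin.cons p.1.1 p.2.1, ?_, ?_⟩) ?_
      · have := p.2.2.1
        rw [List.ofFn_cons]
        simpa using this
      · rw [List.ofFn_cons]
        exact ⟨(mem_outEdges.1 p.1.2).1, p.2.2.2⟩
      · rintro ⟨⟨e, he⟩, f, hf⟩ ⟨⟨e', he'⟩, f', hf'⟩ h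
        have h2 : (Fin.cons e f : Fin (k + 1) → M × Fin 2) = Fin.cons e' f' :=
          congrArg Subtype.val h
        obtain ⟨rfl, rfl⟩ := Fin.cons_injective2 h2
        rfl
  refine (key k [] trivial (by simpa using hk)).trans ?_
  refine Nat.card_mono (Set.toFinite _) fun f hf => ⟨?_, hf.2⟩
  have h1 := hf.1
  rw [List.reverse_nil, List.nil_append, List.map_ofFn] at h1
  exact List.nodup_ofFn.1 h1

end Exploration

/-! ### Factorial moments of the random formula -/

section Moments

open scoped ENNReal

variable {n : ℕ}

instance discreteMeasurableSpace_formula : DiscreteMeasurableSpace (Formula n) where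
  forall_measurableSet s := by
    refine (MeasurableSpace.measurableSet_iInf).2 fun m => ?_
    exact MeasurableSet.of_discrete (α := Fin m → Clause n)

lemma lintegral_poisson (r : NNReal) (F : ℕ → ℝ≥0∞) :
    ∫⁻ m, F m ∂(poissonMeasure r)
      = ∑' m, ENNReal.ofReal (Real.exp (-r) * r ^ m / m.factorial) * F m := by
  rw [poissonMeasure, lintegral_sum_measure]
  refine tsum_congr fun m => ?_
  rw [lintegral_smul_measure, lintegral_dirac, smul_eq_mul]

lemma lintegral_uniformOn_univ {α : Type*} [Fintype α] [MeasurableSpace α]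
    [MeasurableSingletonClass α] (F : α → ℝ≥0∞) :
    ∫⁻ a, F a ∂(uniformOn (Set.univ : Set α)) = (Fintype.card α : ℝ≥0∞)⁻¹ * ∑ a, F a := by
  rw [lintegral_fintype, Finset.mul_sum]
  refine Finset.sum_congr rfl fun a _ => ?_
  rw [uniformOn_univ, Measure.count_singleton, mul_comm, one_div]

/-- Integration with respect to the random formula. -/
lemma lintegral_randomFormula (d : ℝ) (F : Formula n → ℝ≥0∞) :
    ∫⁻ Φ, F Φ ∂(randomFormula d n) = ∫⁻ m, (Fintype.card (Fin m → Clause n) : ℝ≥0∞)⁻¹ *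
      ∑ φ : Fin m → Clause n, F ⟨m, φ⟩ ∂(poissonMeasure (d * n / 2).toNNReal) := by
  rw [randomFormula, Measure.lintegral_bind Measurable.of_discrete.aemeasurable
    Measurable.of_discrete.aemeasurable]
  refine lintegral_congr fun m => ?_
  rw [lintegral_map Measurable.of_discrete Measurable.of_discrete, lintegral_uniformOn_univ]

lemma isProbabilityMeasure_randomFormula (d : ℝ) (hn : Nonempty (Clause n)) :
    IsProbabilityMeasure (randomFormula d n) := by
  constructor
  rw [← lintegral_one, lintegral_randomFormula]
  have h1 : ∀ m : ℕ, (Fintype.card (Fin m → Clause n) : ℝ≥0∞)⁻¹ *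
      ∑ _φ : Fin m → Clause n, (1 : ℝ≥0∞) = 1 := by
    intro m
    rw [Finset.sum_const, Finset.card_univ, nsmul_eq_mul, mul_one]
    exact ENNReal.inv_mul_cancel (Nat.cast_ne_zero.2 Fintype.card_ne_zero)
      (ENNReal.natCast_ne_top _)
  simp_rw [h1]
  simp

/-- The factorial moments of the Poisson distribution. -/
lemma tsum_poisson_descFactorial (r : NNReal) (k : ℕ) :
    ∑' m : ℕ, ENNReal.ofReal (Real.exp (-r) * r ^ m / m.factorial) * (m.descFactorial k : ℝ≥0∞)
      = (r : ℝ≥0∞) ^ k := by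
  rw [← (add_left_injective k).tsum_eq]
  · have h1 : ∀ m : ℕ, ENNReal.ofReal (Real.exp (-r) * r ^ (m + k) / (m + k).factorial)
        * ((m + k).descFactorial k : ℝ≥0∞)
        = (r : ℝ≥0∞) ^ k * ENNReal.ofReal (Real.exp (-r) * r ^ m / m.factorial) := by
      intro m
      rw [← ENNReal.ofReal_natCast ((m + k).descFactorial k), ← ENNReal.ofReal_coe_nnreal,
        ← ENNReal.ofReal_pow r.coe_nonneg, ← ENNReal.ofReal_mul (by positivity),
        ← ENNReal.ofReal_mul (by positivity)]
      congr 1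
      have h2 : ((m + k).factorial : ℝ) = m.factorial * (m + k).descFactorial k := by
        have := Nat.factorial_mul_descFactorial (n := m + k) (k := k) (by omega)
        rw [Nat.add_sub_cancel] at this
        exact_mod_cast this.symm
      have h3 : ((m + k).descFactorial k : ℝ) ≠ 0 := by
        have : (m + k).descFactorial k ≠ 0 := by
          rw [Ne, Nat.descFactorial_eq_zero_iff_lt]
          omega
        exact_mod_cast this
      have h4 : (m.factorial : ℝ) ≠ 0 := by positivity
      rw [h2, pow_add]
      field_simp
    simp_rw [h1]
    rw [ENNReal.tsum_mul_left, ← ENNReal.ofReal_tsum_of_nonneg (fun m => by positivity)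
      (hasSum_one_poissonMeasure r).summable, (hasSum_one_poissonMeasure r).tsum_eq]
    simp
  · intro m hm
    rw [Function.mem_support] at hm
    refine ⟨m - k, Nat.sub_add_cancel (not_lt.1 fun hmk => hm ?_)⟩
    rw [Nat.descFactorial_eq_zero_iff_lt.2 hmk]
    simp

/-- The number of lists of `r` elements with property `Q`. -/
noncomputable def listCount {α : Type*} (r : ℕ) (Q : List α → Prop) : ℕ :=
  Nat.card {g : Fin r → α // Q (List.ofFn g)}

/-- The number of ways in which a list of `r` oriented clauses with property `Q` occurs in `Φ`, at
distinct positions. -/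
noncomputable def occurrences (r : ℕ) (Q : List (Clause n × Fin 2) → Prop) (Φ : Formula n) : ℕ :=
  Nat.card {f : Fin r → Fin Φ.numClauses × Fin 2 // Function.Injective (fun i => (f i).1) ∧
    Q (List.ofFn fun i => (Φ.2 (f i).1, (f i).2))}

lemma sum_occurrences_le (m r : ℕ) (Q : List (Clause n × Fin 2) → Prop) :
    ∑ φ : Fin m → Clause n, occurrences r Q ⟨m, φ⟩
      ≤ m.descFactorial r * (listCount r Q * Fintype.card (Clause n) ^ (m - r)) := by
  classical
  have h1 : ∀ a : Fin r ↪ Fin m, Nat.card {p : (Fin m → Clause n) × (Fin r → Fin 2) //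
      Q (List.ofFn fun i => (p.1 (a i), p.2 i))}
        ≤ listCount r Q * Fintype.card (Clause n) ^ (m - r) := by
    intro a
    have h2 : Fintype.card {b : Fin m // b ∉ Set.range a} = m - r := by
      rw [Fintype.card_subtype_compl, Fintype.card_fin]
      congr 1
      exact (Set.card_range_of_injective a.injective).trans (by simp)
    rw [← h2, ← Fintype.card_fun, ← Nat.card_eq_fintype_card, listCount, ← Nat.card_prod]
    refine Nat.card_le_card_of_injective (fun p => (⟨fun i => (p.1.1 (a i), p.1.2 i), p.2⟩,
      fun b : {b : Fin m // b ∉ Set.range a} => p.1.1 b)) ?_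
    rintro ⟨⟨φ, i⟩, hp⟩ ⟨⟨φ', i'⟩, hp'⟩ h
    obtain ⟨h3, h4⟩ := Prod.mk.inj h
    have h5 := fun k => congrFun (congrArg Subtype.val h3) k
    refine Subtype.ext (Prod.ext (funext fun b => ?_) (funext fun k => (Prod.mk.inj (h5 k)).2))
    by_cases hb : b ∈ Set.range a
    · obtain ⟨k, rfl⟩ := hb
      exact (Prod.mk.inj (h5 k)).1
    · exact congrFun h4 ⟨b, hb⟩
  unfold occurrences
  rw [← Nat.card_sigma]
  calc Nat.card (Σ φ : Fin m → Clause n, {f : Fin r → Fin m × Fin 2 //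
        Function.Injective (fun i => (f i).1) ∧ Q (List.ofFn fun i => (φ (f i).1, (f i).2))})
      ≤ Nat.card {q : (Fin r ↪ Fin m) × ((Fin m → Clause n) × (Fin r → Fin 2)) //
        Q (List.ofFn fun i => (q.2.1 (q.1 i), q.2.2 i))} := by
        refine Nat.card_le_card_of_injective (fun p => ⟨(⟨fun i => (p.2.1 i).1, p.2.2.1⟩,
          (p.1, fun i => (p.2.1 i).2)), p.2.2.2⟩) ?_
        rintro ⟨φ, f, hf⟩ ⟨φ', f', hf'⟩ h
        obtain ⟨h2, h3⟩ := Prod.mk.inj (congrArg Subtype.val h)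
        obtain ⟨rfl, h4⟩ := Prod.mk.inj h3
        have h5 : f = f' := funext fun i => Prod.ext (DFunLike.congr_fun h2 i) (congrFun h4 i)
        subst h5
        rfl
    _ = ∑ a : Fin r ↪ Fin m, Nat.card {p : (Fin m → Clause n) × (Fin r → Fin 2) //
        Q (List.ofFn fun i => (p.1 (a i), p.2 i))} := by
        rw [← Nat.card_sigma]
        exact Nat.card_congr (Equiv.subtypeProdEquivSigmaSubtype
          fun (a : Fin r ↪ Fin m) (p : (Fin m → Clause n) × (Fin r → Fin 2)) =>
            Q (List.ofFn fun i => (p.1 (a i), p.2 i)))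
    _ ≤ ∑ _a : Fin r ↪ Fin m, listCount r Q * Fintype.card (Clause n) ^ (m - r) :=
        Finset.sum_le_sum fun a _ => h1 a
    _ = _ := by
        rw [Finset.sum_const, Finset.card_univ, Fintype.card_embedding_eq]
        simp

/-- The expected number of occurrences of a pattern of `r` clauses: each of the possible patterns
contributes the `r`th power of the mean number of copies of a single clause. -/
lemma lintegral_occurrences_le (d : ℝ) (hn : Nonempty (Clause n)) (r : ℕ)
    (Q : List (Clause n × Fin 2) → Prop) :
    ∫⁻ Φ, (occurrences r Q Φ : ℝ≥0∞) ∂(randomFormula d n)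
      ≤ (((d * n / 2).toNNReal : ℝ≥0∞) / Fintype.card (Clause n)) ^ r * listCount r Q := by
  rw [lintegral_randomFormula, lintegral_poisson]
  set c : ℝ≥0∞ := ((Fintype.card (Clause n) : ℕ) : ℝ≥0∞) with hc
  have hc0 : c ≠ 0 := Nat.cast_ne_zero.2 Fintype.card_ne_zero
  have hct : c ≠ ⊤ := ENNReal.natCast_ne_top _
  have h1 : ∀ m : ℕ, (Fintype.card (Fin m → Clause n) : ℝ≥0∞)⁻¹ *
      ∑ φ : Fin m → Clause n, (occurrences r Q ⟨m, φ⟩ : ℝ≥0∞)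
        ≤ (m.descFactorial r : ℝ≥0∞) * (c⁻¹ ^ r * listCount r Q) := by
    intro m
    have h2 : ∑ φ : Fin m → Clause n, (occurrences r Q ⟨m, φ⟩ : ℝ≥0∞)
        ≤ (m.descFactorial r : ℝ≥0∞) * (listCount r Q * c ^ (m - r)) := by
      rw [hc]
      exact_mod_cast sum_occurrences_le m r Q
    refine (mul_le_mul_right h2 _).trans ?_
    by_cases hmr : m < r
    · rw [Nat.descFactorial_eq_zero_iff_lt.2 hmr]
      simp
    · rw [Fintype.card_fun, Fintype.card_fin, Nat.cast_pow, ← hc]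
      have h3 : (c ^ m)⁻¹ * c ^ (m - r) = c⁻¹ ^ r := by
        obtain ⟨k, rfl⟩ := Nat.exists_eq_add_of_le (not_lt.1 hmr)
        rw [Nat.add_sub_cancel_left, pow_add, ENNReal.mul_inv (Or.inl (pow_ne_zero _ hc0))
          (Or.inl (ENNReal.pow_ne_top hct)), mul_assoc,
          ENNReal.inv_mul_cancel (pow_ne_zero _ hc0) (ENNReal.pow_ne_top hct), mul_one,
          ENNReal.inv_pow]
      rw [← h3]
      exact le_of_eq (by ring)
  refine (ENNReal.tsum_le_tsum fun m => mul_le_mul_right (h1 m) _).trans ?_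
  simp_rw [← mul_assoc]
  rw [ENNReal.tsum_mul_right, ENNReal.tsum_mul_right, tsum_poisson_descFactorial, div_eq_mul_inv _ c,
    mul_pow]

end Moments

/-! ### First moments of walks and cycles -/

section FirstMoments

open scoped ENNReal

variable {n : ℕ}

/-- Count lists by choosing the tail first, and then at most `B` heads for each tail. -/
lemma listCount_succ_le {α : Type*} [Finite α] {r B : ℕ} {Q Q' : List α → Prop}
    {P : List α → α → Prop} (hQ : ∀ e l, Q (e :: l) → Q' l ∧ P l e)
    (hB : ∀ l, l.length = r → Nat.card {e // P l e} ≤ B) :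
    listCount (r + 1) Q ≤ listCount r Q' * B := by
  classical
  have := Fintype.ofFinite α
  calc listCount (r + 1) Q
      ≤ Nat.card (Σ g : {g : Fin r → α // Q' (List.ofFn g)}, {e // P (List.ofFn g.1) e}) := by
        refine Nat.card_le_card_of_injective (fun g => ⟨⟨Fin.tail g.1, ?_⟩, ⟨g.1 0, ?_⟩⟩) ?_
        · have := g.2
          rw [List.ofFn_succ] at this
          exact (hQ _ _ this).1
        · have := g.2
          rw [List.ofFn_succ] at this
          exact (hQ _ _ this).2
        · intro g g' h
          have h1 := congrArg (fun p => (Fin.cons p.2.1 p.1.1 : Fin (r + 1) → α)) h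
          exact Subtype.ext (by simpa only [Fin.cons_self_tail] using h1)
    _ = ∑ g : {g : Fin r → α // Q' (List.ofFn g)}, Nat.card {e // P (List.ofFn g.1) e} :=
        Nat.card_sigma
    _ ≤ ∑ _g : {g : Fin r → α // Q' (List.ofFn g)}, B :=
        Finset.sum_le_sum fun g _ => hB _ (by simp)
    _ = listCount r Q' * B := by
        rw [Finset.sum_const, Finset.card_univ, smul_eq_mul, listCount, Nat.card_eq_fintype_card]

/-- Count lists by choosing the head first, and then at most `B` tails for each head. -/
lemma listCount_cons_le {α : Type*} [Finite α] {r A B : ℕ} {Q : List α → Prop} {P : α → Prop}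
    {Q' : α → List α → Prop} (hQ : ∀ e l, Q (e :: l) → P e ∧ Q' e l)
    (hA : Nat.card {e // P e} ≤ A) (hB : ∀ e, listCount r (Q' e) ≤ B) :
    listCount (r + 1) Q ≤ A * B := by
  classical
  have := Fintype.ofFinite α
  calc listCount (r + 1) Q
      ≤ Nat.card (Σ e : {e // P e}, {g : Fin r → α // Q' e.1 (List.ofFn g)}) := by
        refine Nat.card_le_card_of_injective (fun g => ⟨⟨g.1 0, ?_⟩, ⟨Fin.tail g.1, ?_⟩⟩) ?_
        · have := g.2
          rw [List.ofFn_succ] at this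
          exact (hQ _ _ this).1
        · have := g.2
          rw [List.ofFn_succ] at this
          exact (hQ _ _ this).2
        · intro g g' h
          have h1 := congrArg (fun p => (Fin.cons p.1.1 p.2.1 : Fin (r + 1) → α)) h
          exact Subtype.ext (by simpa only [Fin.cons_self_tail] using h1)
    _ = ∑ e : {e // P e}, listCount r (Q' e.1) := Nat.card_sigma
    _ ≤ ∑ _e : {e // P e}, B := Finset.sum_le_sum fun e _ => hB _
    _ = Nat.card {e // P e} * B := by
        rw [Finset.sum_const, Finset.card_univ, smul_eq_mul, Nat.card_eq_fintype_card]
    _ ≤ A * B := Nat.mul_le_mul_right _ hA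

lemma listCount_zero_le {α : Type*} (Q : List α → Prop) : listCount 0 Q ≤ 1 := by
  rw [listCount]
  have : Subsingleton {g : Fin 0 → α // Q (List.ofFn g)} :=
    ⟨fun g g' => Subtype.ext (Subsingleton.elim _ _)⟩
  exact Finite.card_le_one_iff_subsingleton.2 this

/-- The array of the variables of all possible clauses. -/
def clauseVar (c : Clause n) (j : Fin 2) : Fin n := (c.1 j).1

/-- The array of the signs of all possible clauses. -/
def clauseSign (c : Clause n) (j : Fin 2) : Bool := (c.1 j).2

lemma far_ne (e : Clause n × Fin 2) : far clauseVar e ≠ clauseVar e.1 e.2 := by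
  obtain ⟨c, j⟩ := e
  have h := c.2
  fin_cases j
  · exact h.symm
  · exact h

/-- An oriented clause is determined by its variables, its signs and its orientation. -/
lemma orientedClause_ext {e e' : Clause n × Fin 2} (h1 : clauseVar e.1 e.2 = clauseVar e'.1 e'.2)
    (h2 : far clauseVar e = far clauseVar e')
    (h3 : clauseSign e.1 e.2 = clauseSign e'.1 e'.2)
    (h4 : farSign clauseSign e = farSign clauseSign e') (h5 : e.2 = e'.2) : e = e' := by
  obtain ⟨c, j⟩ := e
  obtain ⟨c', j'⟩ := e'
  obtain rfl : j = j' := h5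
  refine Prod.ext (Subtype.ext (funext fun i => ?_)) rfl
  rcases eq_or_eq_rev i j with rfl | rfl
  · exact Prod.ext h1 h3
  · exact Prod.ext h2 h4

lemma card_oriented_base_le (x : Fin n) :
    Nat.card {e : Clause n × Fin 2 // clauseVar e.1 e.2 = x} ≤ 8 * (n - 1) := by
  have h : Nat.card ({y : Fin n // y ≠ x} × (Bool × Bool × Fin 2)) = 8 * (n - 1) := by
    rw [Nat.card_prod, Nat.card_eq_fintype_card, Nat.card_eq_fintype_card]
    simp [mul_comm]
  rw [← h]
  refine Nat.card_le_card_of_injective (fun e => (⟨far clauseVar e.1, ?_⟩,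
    (clauseSign e.1.1 e.1.2, farSign clauseSign e.1, e.1.2))) ?_
  · have h1 := far_ne e.1
    rwa [e.2] at h1
  · rintro ⟨e, he⟩ ⟨e', he'⟩ h
    simp only [Prod.mk.injEq, Subtype.mk.injEq] at h
    exact Subtype.ext (orientedClause_ext (he.trans he'.symm) h.1 h.2.1 h.2.2.1 h.2.2.2)

lemma card_oriented_base_mem_le (L : List (Fin n)) :
    Nat.card {e : Clause n × Fin 2 // clauseVar e.1 e.2 ∈ L} ≤ L.length * (8 * (n - 1)) := by
  classical
  calc Nat.card {e : Clause n × Fin 2 // clauseVar e.1 e.2 ∈ L}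
      ≤ Nat.card (Σ x : {x // x ∈ L.toFinset},
          {e : Clause n × Fin 2 // clauseVar e.1 e.2 = x}) := by
        refine Nat.card_le_card_of_injective
          (fun e => ⟨⟨clauseVar e.1.1 e.1.2, List.mem_toFinset.2 e.2⟩, ⟨e.1, rfl⟩⟩) ?_
        exact fun e e' h => Subtype.ext (congrArg (fun p => p.2.1) h)
    _ = ∑ x : {x // x ∈ L.toFinset}, Nat.card {e : Clause n × Fin 2 // clauseVar e.1 e.2 = x} :=
        Nat.card_sigma
    _ ≤ ∑ _x : {x // x ∈ L.toFinset}, 8 * (n - 1) :=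
        Finset.sum_le_sum fun x _ => card_oriented_base_le _
    _ ≤ L.length * (8 * (n - 1)) := by
        rw [Finset.sum_const, Finset.card_univ, Fintype.card_coe, smul_eq_mul]
        exact Nat.mul_le_mul_right _ (List.toFinset_card_le L)

lemma card_oriented_both_mem_le (L : List (Fin n)) :
    Nat.card {e : Clause n × Fin 2 // clauseVar e.1 e.2 ∈ L ∧ far clauseVar e ∈ L}
      ≤ 8 * L.length ^ 2 := by
  classical
  have h : Nat.card (({x // x ∈ L.toFinset} × {x // x ∈ L.toFinset}) × (Bool × Bool × Fin 2))
      ≤ 8 * L.length ^ 2 := by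
    rw [Nat.card_prod, Nat.card_prod, Nat.card_eq_fintype_card, Nat.card_eq_fintype_card,
      Fintype.card_coe]
    have := List.toFinset_card_le L
    simp only [Fintype.card_prod, Fintype.card_bool, Fintype.card_fin]
    nlinarith
  refine le_trans ?_ h
  refine Nat.card_le_card_of_injective (fun e =>
    ((⟨clauseVar e.1.1 e.1.2, List.mem_toFinset.2 e.2.1⟩,
      ⟨far clauseVar e.1, List.mem_toFinset.2 e.2.2⟩),
      (clauseSign e.1.1 e.1.2, farSign clauseSign e.1, e.1.2))) ?_
  rintro ⟨e, he⟩ ⟨e', he'⟩ h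
  simp only [Prod.mk.injEq, Subtype.mk.injEq] at h
  exact Subtype.ext (orientedClause_ext h.1.1 h.1.2 h.2.1 h.2.2.1 h.2.2.2)

lemma listCount_chains_le (r : ℕ) (x : Fin n) :
    listCount r (Chains clauseVar x) ≤ (8 * (n - 1)) ^ r := by
  induction r generalizing x with
  | zero => exact listCount_zero_le _
  | succ r ih =>
    rw [pow_succ']
    exact listCount_cons_le (fun e l h => h) (card_oriented_base_le x) fun e => ih _

lemma listCount_grows_le (S : List (Fin n)) (r : ℕ) :
    listCount r (Grows clauseVar S) ≤ ((r + S.length) * (8 * (n - 1))) ^ r := by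
  induction r with
  | zero => exact listCount_zero_le _
  | succ r ih =>
    rw [pow_succ]
    refine (listCount_succ_le (B := (r + 1 + S.length) * (8 * (n - 1))) (fun e l h => h)
      fun l hl => ?_).trans ?_
    · refine (card_oriented_base_mem_le _).trans (Nat.mul_le_mul_right _ ?_)
      simp [verts, hl]
    · refine Nat.mul_le_mul_right _ (ih.trans (Nat.pow_le_pow_left ?_ _))
      exact Nat.mul_le_mul_right _ (by omega)

lemma listCount_closes_le (S : List (Fin n)) (r : ℕ) :
    listCount (r + 1) (Closes clauseVar S)
      ≤ ((r + S.length) * (8 * (n - 1))) ^ r * (8 * (r + S.length) ^ 2) := by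
  refine (listCount_succ_le (B := 8 * (r + S.length) ^ 2) (Q' := Grows clauseVar S)
    (P := fun l e => clauseVar e.1 e.2 ∈ verts clauseVar S l ∧ far clauseVar e ∈ verts clauseVar S l)
    (fun e l h => ⟨h.1.1, h.1.2, h.2⟩)
    fun l hl => ?_).trans ?_
  · refine (card_oriented_both_mem_le _).trans ?_
    simp [verts, hl]
  · exact Nat.mul_le_mul_right _ (listCount_grows_le S r)

lemma le_card_clause (n : ℕ) : 4 * n * (n - 1) ≤ Fintype.card (Clause n) := by
  have h : Nat.card ((Σ x : Fin n, {y : Fin n // y ≠ x}) × (Bool × Bool)) = 4 * n * (n - 1) := by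
    rw [Nat.card_prod, Nat.card_sigma]
    simp only [Nat.card_eq_fintype_card]
    simp
    ring
  rw [← h, ← Nat.card_eq_fintype_card]
  refine Nat.card_le_card_of_injective (fun p =>
    ⟨![(p.1.1, p.2.1), (p.1.2.1, p.2.2)], fun h => p.1.2.2 h.symm⟩) ?_
  rintro ⟨⟨x, y, hy⟩, s, t⟩ ⟨⟨x', y', hy'⟩, s', t'⟩ h
  have h1 := congrFun (congrArg Subtype.val h) 0
  have h2 := congrFun (congrArg Subtype.val h) 1
  simp at h1 h2
  obtain ⟨rfl, rfl⟩ := h1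
  obtain ⟨rfl, rfl⟩ := h2
  rfl

instance nonempty_clause (n : ℕ) : Nonempty (Clause (n + 2)) :=
  ⟨⟨![(0, true), (1, true)], by simp⟩⟩

/-- The mean number of copies of a single clause is at most `d / (8 * (n + 1))` for `n + 2`
variables. -/
lemma clauseMean_le (d : ℝ) (n : ℕ) :
    ((d * (n + 2 : ℕ) / 2).toNNReal : ℝ≥0∞) / Fintype.card (Clause (n + 2))
      ≤ ENNReal.ofReal (d / (8 * (n + 1))) := by
  have h1 : ((4 * (n + 2) * (n + 1) : ℕ) : ℝ≥0∞) ≤ Fintype.card (Clause (n + 2)) := by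
    exact_mod_cast le_card_clause (n + 2)
  refine (ENNReal.div_le_div_left h1 _).trans ?_
  rw [← ENNReal.ofReal_natCast]
  change ENNReal.ofReal _ / _ ≤ _
  rw [← ENNReal.ofReal_div_of_pos (by positivity)]
  refine ENNReal.ofReal_le_ofReal (le_of_eq ?_)
  push_cast
  field_simp
  ring

/-- The first moment bound for patterns of `r` clauses, of which there are at most `B`. -/
lemma lintegral_occurrences_le_of_count {d : ℝ} (hd : 0 ≤ d) (n r : ℕ)
    (Q : List (Clause (n + 2) × Fin 2) → Prop) {B : ℝ} (hB : (listCount r Q : ℝ) ≤ B) :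
    ∫⁻ Φ, (occurrences r Q Φ : ℝ≥0∞) ∂(randomFormula d (n + 2))
      ≤ ENNReal.ofReal ((d / (8 * (n + 1))) ^ r * B) := by
  refine (lintegral_occurrences_le d inferInstance r Q).trans ?_
  rw [ENNReal.ofReal_mul (by positivity), ENNReal.ofReal_pow (by positivity)]
  refine mul_le_mul' (pow_le_pow_left' (clauseMean_le d n) r) ?_
  rw [← ENNReal.ofReal_natCast]
  exact ENNReal.ofReal_le_ofReal hB

/-- The expected number of walks of length `r` along distinct clauses is at most `d ^ r`. -/
lemma lintegral_chains_le {d : ℝ} (hd : 0 ≤ d) (n r : ℕ) (x : Fin (n + 2)) :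
    ∫⁻ Φ, (occurrences r (Chains clauseVar x) Φ : ℝ≥0∞) ∂(randomFormula d (n + 2))
      ≤ ENNReal.ofReal (d ^ r) := by
  have h1 : (listCount r (Chains clauseVar x) : ℝ) ≤ (8 * (n + 1)) ^ r := by
    exact_mod_cast listCount_chains_le r x
  refine (lintegral_occurrences_le_of_count hd n r _ h1).trans (le_of_eq ?_)
  rw [← mul_pow]
  congr 2
  field_simp

/-- Closing a cycle costs a factor of order `1 / n`: both variables of the last clause have been
discovered before. -/
lemma lintegral_closes_le {d : ℝ} (hd : 0 ≤ d) (n r : ℕ) (S : List (Fin (n + 2))) :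
    ∫⁻ Φ, (occurrences (r + 1) (Closes clauseVar S) Φ : ℝ≥0∞) ∂(randomFormula d (n + 2))
      ≤ ENNReal.ofReal (d ^ (r + 1) * (r + S.length) ^ (r + 2) / (n + 1)) := by
  have h1 : (listCount (r + 1) (Closes clauseVar S) : ℝ)
      ≤ ((r + S.length) * (8 * (n + 1))) ^ r * (8 * (r + S.length) ^ 2) := by
    exact_mod_cast listCount_closes_le S r
  refine (lintegral_occurrences_le_of_count hd n _ _ h1).trans (le_of_eq ?_)
  congr 1
  rw [mul_pow, div_pow, pow_succ (8 * ((n : ℝ) + 1)), pow_add _ r 2]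
  field_simp

end FirstMoments

/-! ### The expected gap -/

section ExpectedGap

open scoped ENNReal

variable {n : ℕ}

/-- An occurrence of a clause of `Φ`, as an oriented clause. -/
def Formula.orient (Φ : Formula n) (e : Fin Φ.numClauses × Fin 2) : Clause n × Fin 2 :=
  (Φ.2 e.1, e.2)

lemma verts_orient (Φ : Formula n) (S : List (Fin n)) (l : List (Fin Φ.numClauses × Fin 2)) :
    verts clauseVar S (l.map Φ.orient) = verts Φ.var S l := by
  rw [verts, verts, List.map_map]
  rfl

lemma Grows.orient {Φ : Formula n} {S : List (Fin n)} {l : List (Fin Φ.numClauses × Fin 2)}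
    (hl : Grows Φ.var S l) : Grows clauseVar S (l.map Φ.orient) := by
  induction l with
  | nil => trivial
  | cons e l ih => exact ⟨ih hl.1, by rw [verts_orient]; exact hl.2⟩

lemma Closes.orient {Φ : Formula n} {S : List (Fin n)} {l : List (Fin Φ.numClauses × Fin 2)}
    (hl : Closes Φ.var S l) : Closes clauseVar S (l.map Φ.orient) := by
  cases l with
  | nil => exact hl
  | cons e l => exact ⟨hl.1.orient, by rw [verts_orient]; exact hl.2⟩

lemma Chains.orient {Φ : Formula n} {x : Fin n} {l : List (Fin Φ.numClauses × Fin 2)}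
    (hl : Chains Φ.var x l) : Chains clauseVar x (l.map Φ.orient) := by
  induction l generalizing x with
  | nil => trivial
  | cons e l ih => exact ⟨hl.1, ih hl.2⟩

/-- A list of distinct clauses of `Φ` with property `Q` witnesses an occurrence. -/
lemma one_le_occurrences {Φ : Formula n} {Q : List (Clause n × Fin 2) → Prop}
    {l : List (Fin Φ.numClauses × Fin 2)} (hl : (l.map Prod.fst).Nodup)
    (hQ : Q (l.map Φ.orient)) : 1 ≤ occurrences l.length Q Φ := by
  refine Nat.one_le_iff_ne_zero.2 (Nat.card_ne_zero.2 ⟨⟨⟨l.get, ?_, ?_⟩⟩, inferInstance⟩)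
  · rw [← List.nodup_ofFn]
    have h1 : l.map Prod.fst = List.ofFn fun i => (l.get i).1 := by
      conv_lhs => rw [← List.ofFn_get l, List.map_ofFn]
      rfl
    rwa [h1] at hl
  · have h1 : l.map Φ.orient = List.ofFn fun i => (Φ.2 (l.get i).1, (l.get i).2) := by
      conv_lhs => rw [← List.ofFn_get l, List.map_ofFn]
      rfl
    rwa [h1] at hQ

/-- Explorations from the variables `0` and `1` along at most `R` clauses find no cycle, and they do
not connect `0` with `1`. -/
def LocallyAcyclic (R : ℕ) (Φ : Formula (n + 2)) : Prop :=
  AcyclicFrom Φ.var [0, 1] R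

lemma var_ne (Φ : Formula n) (b : Fin Φ.numClauses) : Φ.var b 0 ≠ Φ.var b 1 := (Φ.2 b).2

lemma LocallyAcyclic.treeLike {Φ : Formula (n + 2)} {R ℓ : ℕ} (hΦ : LocallyAcyclic R Φ)
    (hR : 2 * ℓ ≤ R) : TreeLike Φ.var ℓ 0 none :=
  AcyclicFrom.treeLike (x := 0) (w := []) (var_ne Φ) hΦ (by simp) ℓ trivial (by simpa using hR)

lemma LocallyAcyclic.one_notMem {Φ : Formula (n + 2)} {R ℓ : ℕ} (hΦ : LocallyAcyclic R Φ)
    (hR : ℓ ≤ R) : (1 : Fin (n + 2)) ∉ interior Φ.var ℓ 0 none := fun h =>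
  AcyclicFrom.notMem_treeVars hΦ (by simp) (by simp) (by simp) hR (interior_subset_treeVars _ _ _ h)

lemma LocallyAcyclic.numWalks_le {Φ : Formula (n + 2)} {R k : ℕ} (hΦ : LocallyAcyclic R Φ)
    (hR : k ≤ R) : numWalks Φ.var k 0 none ≤ occurrences k (Chains clauseVar 0) Φ := by
  refine (AcyclicFrom.numWalks_le (x := 0) hΦ (by simp) k hR).trans ?_
  refine Nat.card_mono (Set.toFinite _) fun f hf => ⟨hf.1, ?_⟩
  have h1 := hf.2.orient
  rwa [List.map_ofFn] at h1

/-- A bound on the probability that `LocallyAcyclic R` fails, up to the factor `1 / (n + 1)`. -/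
noncomputable def cycleBound (d : ℝ) (R : ℕ) : ℝ :=
  ∑ r ∈ Finset.range R, d ^ (r + 1) * (r + 2 : ℝ) ^ (r + 2)

lemma measure_not_locallyAcyclic_le {d : ℝ} (hd : 0 ≤ d) (n R : ℕ) :
    randomFormula d (n + 2) {Φ | ¬ LocallyAcyclic R Φ}
      ≤ ENNReal.ofReal (cycleBound d R / (n + 1)) := by
  calc randomFormula d (n + 2) {Φ | ¬ LocallyAcyclic R Φ}
      = ∫⁻ Φ, {Φ : Formula (n + 2) | ¬ LocallyAcyclic R Φ}.indicator 1 Φ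
          ∂(randomFormula d (n + 2)) := (lintegral_indicator_one .of_discrete).symm
    _ ≤ ∫⁻ Φ, ∑ r ∈ Finset.range R, (occurrences (r + 1) (Closes clauseVar [0, 1]) Φ : ℝ≥0∞)
          ∂(randomFormula d (n + 2)) := by
        refine lintegral_mono fun Φ => ?_
        by_cases h : LocallyAcyclic R Φ
        · rw [Set.indicator_of_notMem (by simpa using h)]
          exact zero_le
        · rw [Set.indicator_of_mem (by simpa using h), Pi.one_apply]
          obtain ⟨l, h1, h2, h3⟩ := exists_closes_of_not_acyclicFrom (by simp) h
          cases l with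
          | nil => exact absurd h1 id
          | cons e l =>
            have h4 := one_le_occurrences h2 h1.orient
            refine le_trans ?_ (Finset.single_le_sum (fun _ _ => zero_le)
              (Finset.mem_range.2 (show l.length < R by simpa using h3)))
            exact_mod_cast h4
    _ = ∑ r ∈ Finset.range R, ∫⁻ Φ, (occurrences (r + 1) (Closes clauseVar [0, 1]) Φ : ℝ≥0∞)
          ∂(randomFormula d (n + 2)) := lintegral_finsetSum _ fun _ _ => .of_discrete
    _ ≤ ∑ r ∈ Finset.range R, ENNReal.ofReal (d ^ (r + 1) * (r + 2 : ℝ) ^ (r + 2) / (n + 1)) := by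
        refine Finset.sum_le_sum fun r _ => (lintegral_closes_le hd n r _).trans (le_of_eq ?_)
        simp
    _ = _ := by
        rw [← ENNReal.ofReal_sum_of_nonneg (fun r _ => by positivity), cycleBound, Finset.sum_div]

/-- The formula with the same variables as `Φ` and with signs `s`. -/
def Formula.resign (Φ : Formula n) (s : Fin Φ.numClauses → Fin 2 → Bool) : Formula n :=
  ⟨Φ.1, fun a => ⟨fun j => (Φ.var a j, s a j), (Φ.2 a).2⟩⟩

/-- The signs of a random formula are uniformly random given its variables, so that it suffices to
bound averages over the signs. -/
lemma lintegral_le_of_sum_resign_le (d : ℝ) {F G : Formula n → ℝ≥0∞}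
    (h : ∀ Φ : Formula n, ∑ s, F (Φ.resign s)
      ≤ Fintype.card (Fin Φ.numClauses → Fin 2 → Bool) * G Φ) :
    ∫⁻ Φ, F Φ ∂(randomFormula d n) ≤ ∫⁻ Φ, G Φ ∂(randomFormula d n) := by
  rw [lintegral_randomFormula, lintegral_randomFormula]
  refine lintegral_mono fun m => mul_le_mul_right ?_ _
  set c : ℝ≥0∞ := ((Fintype.card (Fin m → Fin 2 → Bool) : ℕ) : ℝ≥0∞) with hc
  have hc0 : c ≠ 0 := Nat.cast_ne_zero.2 Fintype.card_ne_zero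
  have hct : c ≠ ⊤ := ENNReal.natCast_ne_top _
  let twist : (Fin m → Fin 2 → Bool) → (Fin m → Clause n) → (Fin m → Clause n) := fun s φ a =>
    ⟨fun j => (((φ a).1 j).1, xor ((φ a).1 j).2 (s a j)), (φ a).2⟩
  have h1 : ∀ s, Function.Involutive (twist s) := fun s φ => by
    funext a
    refine Subtype.ext (funext fun j => Prod.ext rfl ?_)
    simp [twist]
  have h2 : ∀ s, ∑ φ, F ⟨m, twist s φ⟩ = ∑ φ, F ⟨m, φ⟩ := fun s =>
    Equiv.sum_comp (h1 s).toPerm fun φ => F ⟨m, φ⟩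
  have h3 : ∀ φ : Fin m → Clause n,
      ∑ s, F ⟨m, twist s φ⟩ = ∑ s, F (Formula.resign ⟨m, φ⟩ s) := by
    intro φ
    have h4 : Function.Involutive
        (fun (s : Fin m → Fin 2 → Bool) (a : Fin m) (j : Fin 2) => xor ((φ a).1 j).2 (s a j)) :=
      fun s => by funext a j; simp
    exact Equiv.sum_comp h4.toPerm fun s => F (Formula.resign ⟨m, φ⟩ s)
  have h5 : c * ∑ φ, F ⟨m, φ⟩ ≤ c * ∑ φ : Fin m → Clause n, G ⟨m, φ⟩ := by
    calc c * ∑ φ, F ⟨m, φ⟩ = ∑ s : Fin m → Fin 2 → Bool, ∑ φ, F ⟨m, twist s φ⟩ := by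
          simp_rw [h2]
          rw [Finset.sum_const, Finset.card_univ, nsmul_eq_mul]
      _ = ∑ φ : Fin m → Clause n, ∑ s, F (Formula.resign ⟨m, φ⟩ s) := by
          rw [Finset.sum_comm]
          exact Finset.sum_congr rfl fun φ _ => h3 φ
      _ ≤ ∑ φ : Fin m → Clause n, c * G ⟨m, φ⟩ := Finset.sum_le_sum fun φ _ => h ⟨m, φ⟩
      _ = _ := by rw [Finset.mul_sum]
  exact (ENNReal.mul_le_mul_iff_right hc0 hct).1 h5

lemma bpGap_nonneg (Φ : Formula n) (h k : ℕ) (x : Fin n) : 0 ≤ bpGap Φ h k x :=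
  add_nonneg (logWidth_nonneg _ _ _ _) (Nat.cast_nonneg _)

/-- On a tree, the average of `bpGap` over the signs depends only on the numbers of walks. -/
lemma sum_bpGap_resign (Φ : Formula n) (h k : ℕ) (x : Fin n)
    (ht : TreeLike Φ.var (h + k) x none) :
    ∑ s, bpGap (Φ.resign s) h k x = numSigns (Fin Φ.numClauses) *
      (Real.log 2 * ((1 / 2) ^ k * ∑ j ∈ Finset.range h,
          (1 / 2) ^ j * (numWalks Φ.var (j + 1 + k) x none : ℝ))
        + 2 * ((1 / 2) ^ h * numWalks Φ.var (h + k) x none)) := by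
  rw [mul_add, ← sum_logWidth h k x none ht, ← sum_deepForced h k x none ht,
    ← Finset.sum_add_distrib]
  rfl

/-- The bound on the expectation of `bpGap` on locally acyclic formulas. It vanishes in the limit of
first `h` and then `k` to infinity. -/
noncomputable def gapBound (d : ℝ) (h k : ℕ) : ℝ :=
  Real.log 2 * ((1 / 2) ^ k * ∑ j ∈ Finset.range h, (1 / 2) ^ j * d ^ (j + 1 + k))
    + 2 * ((1 / 2) ^ h * d ^ (h + k))

/-- Average over the signs first, and bound the expected numbers of walks in the result. -/
lemma lintegral_bpGap_le {d : ℝ} (hd : 0 ≤ d) (n h k R : ℕ) (hR : 2 * (h + k) ≤ R) :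
    ∫⁻ Φ in {Φ | LocallyAcyclic R Φ}, ENNReal.ofReal (bpGap Φ h k 0) ∂(randomFormula d (n + 2))
      ≤ ENNReal.ofReal (gapBound d h k) := by
  classical
  set occ : ℕ → Formula (n + 2) → ℝ := fun r Φ => occurrences r (Chains clauseVar 0) Φ with hocc
  have hlog := Real.log_nonneg one_le_two
  have hocc0 : ∀ r Φ, 0 ≤ occ r Φ := fun r Φ => Nat.cast_nonneg _
  rw [← lintegral_indicator .of_discrete]
  calc ∫⁻ Φ, {Φ | LocallyAcyclic R Φ}.indicator (fun Φ => ENNReal.ofReal (bpGap Φ h k 0)) Φ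
        ∂(randomFormula d (n + 2))
      ≤ ∫⁻ Φ, ENNReal.ofReal (Real.log 2 * ((1 / 2) ^ k * ∑ j ∈ Finset.range h,
          (1 / 2) ^ j * occ (j + 1 + k) Φ) + 2 * ((1 / 2) ^ h * occ (h + k) Φ))
            ∂(randomFormula d (n + 2)) := by
        refine lintegral_le_of_sum_resign_le d fun Φ => ?_
        by_cases hΦ : LocallyAcyclic R Φ
        · have h1 : ∀ s, {Φ | LocallyAcyclic R Φ}.indicator
              (fun Φ => ENNReal.ofReal (bpGap Φ h k 0)) (Φ.resign s)
              = ENNReal.ofReal (bpGap (Φ.resign s) h k 0) := fun s =>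
            Set.indicator_of_mem (s := {Φ | LocallyAcyclic R Φ}) (a := Φ.resign s) hΦ _
          simp_rw [h1]
          rw [← ENNReal.ofReal_sum_of_nonneg fun s _ => bpGap_nonneg _ _ _ _,
            sum_bpGap_resign _ _ _ _ (hΦ.treeLike hR), numSigns, ENNReal.ofReal_mul (by positivity),
            ENNReal.ofReal_natCast]
          have h2 : ∀ r, r ≤ h + k → (numWalks Φ.var r 0 none : ℝ) ≤ occ r Φ := fun r hr => by
            exact Nat.cast_le.2 (hΦ.numWalks_le (k := r) (by omega))
          gcongr with j hj
          · exact h2 _ (by have := Finset.mem_range.1 hj; omega)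
          · exact h2 _ le_rfl
        · have h1 : ∀ s, {Φ | LocallyAcyclic R Φ}.indicator
              (fun Φ => ENNReal.ofReal (bpGap Φ h k 0)) (Φ.resign s) = 0 := fun s =>
            Set.indicator_of_notMem (s := {Φ | LocallyAcyclic R Φ}) (a := Φ.resign s) hΦ _
          simp_rw [h1]
          simp
    _ = ENNReal.ofReal (Real.log 2) * (ENNReal.ofReal ((1 / 2) ^ k) * ∑ j ∈ Finset.range h,
          ENNReal.ofReal ((1 / 2) ^ j) *
            ∫⁻ Φ, ENNReal.ofReal (occ (j + 1 + k) Φ) ∂(randomFormula d (n + 2)))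
        + ENNReal.ofReal 2 * (ENNReal.ofReal ((1 / 2) ^ h) *
            ∫⁻ Φ, ENNReal.ofReal (occ (h + k) Φ) ∂(randomFormula d (n + 2))) := by
        have h1 : ∀ Φ : Formula (n + 2),
            ENNReal.ofReal (Real.log 2 * ((1 / 2) ^ k * ∑ j ∈ Finset.range h,
              (1 / 2) ^ j * occ (j + 1 + k) Φ) + 2 * ((1 / 2) ^ h * occ (h + k) Φ))
            = ENNReal.ofReal (Real.log 2) * (ENNReal.ofReal ((1 / 2) ^ k) * ∑ j ∈ Finset.range h,
                ENNReal.ofReal ((1 / 2) ^ j) * ENNReal.ofReal (occ (j + 1 + k) Φ))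
              + ENNReal.ofReal 2 * (ENNReal.ofReal ((1 / 2) ^ h) *
                ENNReal.ofReal (occ (h + k) Φ)) := by
          intro Φ
          have hs : 0 ≤ ∑ j ∈ Finset.range h, (1 / 2 : ℝ) ^ j * occ (j + 1 + k) Φ :=
            Finset.sum_nonneg fun j _ => mul_nonneg (by positivity) (hocc0 _ _)
          rw [ENNReal.ofReal_add
            (mul_nonneg hlog (mul_nonneg (by positivity) hs))
            (mul_nonneg two_pos.le (mul_nonneg (by positivity) (hocc0 _ _))),
            ENNReal.ofReal_mul hlog, ENNReal.ofReal_mul (by positivity),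
            ENNReal.ofReal_sum_of_nonneg fun j _ => mul_nonneg (by positivity) (hocc0 _ _),
            ENNReal.ofReal_mul two_pos.le, ENNReal.ofReal_mul (by positivity)]
          congr 3
          exact Finset.sum_congr rfl fun j _ => ENNReal.ofReal_mul (by positivity)
        simp_rw [h1]
        rw [lintegral_add_left .of_discrete, lintegral_const_mul _ .of_discrete,
          lintegral_const_mul _ .of_discrete, lintegral_const_mul _ .of_discrete,
          lintegral_const_mul _ .of_discrete, lintegral_finsetSum _ fun _ _ => .of_discrete]
        congr 3
        exact Finset.sum_congr rfl fun j _ => lintegral_const_mul _ .of_discrete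
    _ ≤ ENNReal.ofReal (Real.log 2) * (ENNReal.ofReal ((1 / 2) ^ k) * ∑ j ∈ Finset.range h,
          ENNReal.ofReal ((1 / 2) ^ j) * ENNReal.ofReal (d ^ (j + 1 + k)))
        + ENNReal.ofReal 2 * (ENNReal.ofReal ((1 / 2) ^ h) * ENNReal.ofReal (d ^ (h + k))) := by
        have h1 : ∀ r, ∫⁻ Φ, ENNReal.ofReal (occ r Φ) ∂(randomFormula d (n + 2))
            ≤ ENNReal.ofReal (d ^ r) := by
          intro r
          simp_rw [hocc, ENNReal.ofReal_natCast]
          exact lintegral_chains_le hd n r 0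
        gcongr with j hj
        · exact h1 _
        · exact h1 _
    _ = ENNReal.ofReal (gapBound d h k) := by
        have hs : 0 ≤ ∑ j ∈ Finset.range h, (1 / 2 : ℝ) ^ j * d ^ (j + 1 + k) := by positivity
        rw [gapBound, ENNReal.ofReal_add (by positivity) (by positivity),
          ENNReal.ofReal_mul hlog, ENNReal.ofReal_mul (by positivity),
          ENNReal.ofReal_sum_of_nonneg fun j _ => by positivity,
          ENNReal.ofReal_mul two_pos.le, ENNReal.ofReal_mul (by positivity)]
        congr 3
        exact Finset.sum_congr rfl fun j _ => (ENNReal.ofReal_mul (by positivity)).symm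

end ExpectedGap

/-! ### Implications and bicycles -/

section Implications

variable {V M : Type*}

/-- The negation of a literal. -/
def litNeg (w : V × Bool) : V × Bool := (w.1, !w.2)

/-- The oriented clause `e` reads as the implication from `impSource v s e`, the negation of the
literal at its base, to `impTarget v s e`. -/
def impSource (v : M → Fin 2 → V) (s : M → Fin 2 → Bool) (e : M × Fin 2) : V × Bool :=
  (v e.1 e.2, !s e.1 e.2)

/-- The literal that is implied by `impSource v s e`. -/
def impTarget (v : M → Fin 2 → V) (s : M → Fin 2 → Bool) (e : M × Fin 2) : V × Bool :=
  (far v e, farSign s e)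

/-- The implication relation between literals. -/
def Implies (v : M → Fin 2 → V) (s : M → Fin 2 → Bool) (w w' : V × Bool) : Prop :=
  ∃ e, impSource v s e = w ∧ impTarget v s e = w'

variable {v : M → Fin 2 → V} {s : M → Fin 2 → Bool}

@[simp] lemma litNeg_litNeg (w : V × Bool) : litNeg (litNeg w) = w := by
  simp [litNeg]

lemma litNeg_ne (w : V × Bool) : litNeg w ≠ w := fun h => by
  have := congrArg Prod.snd h
  simp [litNeg] at this

lemma eq_litNeg_of_fst_eq {w w' : V × Bool} (h : w.1 = w'.1) (hne : w ≠ w') : w = litNeg w' := by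
  obtain ⟨x, b⟩ := w
  obtain ⟨y, c⟩ := w'
  obtain rfl : x = y := h
  refine Prod.ext rfl ?_
  cases b <;> cases c <;> simp [litNeg] at hne ⊢

lemma impSource_rev (e : M × Fin 2) :
    impSource v s (e.1, e.2.rev) = litNeg (impTarget v s e) := rfl

lemma impTarget_rev (e : M × Fin 2) :
    impTarget v s (e.1, e.2.rev) = litNeg (impSource v s e) := by
  simp [impTarget, impSource, far, farSign, litNeg]

lemma Implies.contrapositive {w w' : V × Bool} (h : Implies v s w w') :
    Implies v s (litNeg w') (litNeg w) := by
  obtain ⟨e, rfl, rfl⟩ := h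
  exact ⟨(e.1, e.2.rev), impSource_rev e, impTarget_rev e⟩

lemma reaches_contrapositive {w w' : V × Bool} (h : Relation.ReflTransGen (Implies v s) w w') :
    Relation.ReflTransGen (Implies v s) (litNeg w') (litNeg w) := by
  induction h with
  | refl => exact .refl
  | tail _ h ih => exact .head h.contrapositive ih

/-- A formula is satisfiable unless some literal implies its negation and conversely. A maximal
consistent set of literals that is closed under implications is a satisfying assignment. -/
lemma exists_solution_of_no_contradiction [Finite V]
    (h : ∀ w, ¬ (Relation.ReflTransGen (Implies v s) w (litNeg w) ∧
      Relation.ReflTransGen (Implies v s) (litNeg w) w)) :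
    ∃ σ : V → Bool, ∀ b, ∃ j, σ (v b j) = s b j := by
  classical
  set good : Set (Set (V × Bool)) := {T | (∀ w ∈ T, ∀ w', Implies v s w w' → w' ∈ T) ∧
    ∀ w ∈ T, litNeg w ∉ T} with hgood
  obtain ⟨T, hTg, hTm⟩ := (Set.toFinite good).exists_maximal ⟨∅, by simp [hgood]⟩
  have hclosed : ∀ w ∈ T, ∀ w', Relation.ReflTransGen (Implies v s) w w' → w' ∈ T := by
    intro w hw w' hww'
    induction hww' with
    | refl => exact hw
    | tail _ h ih => exact hTg.1 _ ih _ h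
  have hcover : ∀ w, w ∈ T ∨ litNeg w ∈ T := by
    by_contra hcon
    push Not at hcon
    obtain ⟨w, hw, hw'⟩ := hcon
    obtain ⟨y, hy1, hy2, hy3⟩ : ∃ y, y ∉ T ∧ litNeg y ∉ T ∧
        ¬ Relation.ReflTransGen (Implies v s) y (litNeg y) := by
      by_cases h1 : Relation.ReflTransGen (Implies v s) w (litNeg w)
      · exact ⟨litNeg w, hw', by simpa using hw, fun h2 => h w ⟨h1, by simpa using h2⟩⟩
      · exact ⟨w, hw, hw', h1⟩
    have hmem : T ∪ {z | Relation.ReflTransGen (Implies v s) y z} ∈ good := by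
      refine ⟨?_, ?_⟩
      · rintro z (hz | hz) z' hzz'
        · exact Or.inl (hTg.1 z hz z' hzz')
        · exact Or.inr (Relation.ReflTransGen.tail hz hzz')
      · rintro z (hz | hz) (hz' | hz')
        · exact hTg.2 z hz hz'
        · refine hy2 (hclosed z hz _ ?_)
          have h1 := reaches_contrapositive hz'
          rwa [litNeg_litNeg] at h1
        · refine hy2 (hclosed _ hz' _ (reaches_contrapositive hz))
        · have h1 := reaches_contrapositive hz'
          rw [litNeg_litNeg] at h1
          exact hy3 (Relation.ReflTransGen.trans hz h1)
    exact hy1 (hTm hmem Set.subset_union_left (Or.inr .refl))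
  refine ⟨fun x => decide ((x, true) ∈ T), fun b => ?_⟩
  by_contra hcon
  push Not at hcon
  have hnot : ∀ j, (v b j, !s b j) ∈ T := by
    intro j
    have h1 := hcon j
    cases hs : s b j
    · rw [hs] at h1
      simpa using h1
    · rw [hs] at h1
      rcases hcover (v b j, true) with h2 | h2
      · simp [h2] at h1
      · exact h2
  have h1 : impTarget v s (b, 0) ∈ T := hTg.1 _ (hnot 0) _ ⟨(b, 0), rfl, rfl⟩
  exact hTg.2 _ h1 (hnot 1)

/-- The final literal of a path of implications from `x`, listed most recent first. -/
def litEnd (v : M → Fin 2 → V) (s : M → Fin 2 → Bool) (x : V × Bool) : List (M × Fin 2) → V × Bool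
  | [] => x
  | e :: _ => impTarget v s e

/-- Paths of implications from the literal `x`, listed most recent first. -/
def LitPath (v : M → Fin 2 → V) (s : M → Fin 2 → Bool) (x : V × Bool) : List (M × Fin 2) → Prop
  | [] => True
  | e :: l => LitPath v s x l ∧ impSource v s e = litEnd v s x l

/-- The literals on a path of implications from `x`. -/
def lits (v : M → Fin 2 → V) (s : M → Fin 2 → Bool) (x : V × Bool) (l : List (M × Fin 2)) :
    List (V × Bool) :=
  l.map (impTarget v s) ++ [x]

/-- A bicycle: a path of implications from the literal `x` together with an implication that ends
in `x` and an implication that starts at the end of the path; the other variables of these two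
implications occur on the path as well. -/
def BicycleAt (v : M → Fin 2 → V) (s : M → Fin 2 → Bool) (x : V × Bool) : List (M × Fin 2) → Prop
  | e₀ :: e₁ :: l => (LitPath v s x l ∧ impSource v s e₁ = litEnd v s x l ∧
      far v e₁ ∈ (lits v s x l).map Prod.fst) ∧
      impTarget v s e₀ = x ∧ v e₀.1 e₀.2 ∈ (lits v s x l).map Prod.fst
  | _ => False

variable {x : V × Bool} {l : List (M × Fin 2)}

lemma lits_cons (e : M × Fin 2) : lits v s x (e :: l) = impTarget v s e :: lits v s x l := rfl

lemma litEnd_mem_lits : litEnd v s x l ∈ lits v s x l := by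
  cases l <;> simp [litEnd, lits]

lemma start_mem_lits : x ∈ lits v s x l := by
  simp [lits]

lemma map_fst_lits : (lits v s x l).map Prod.fst = verts v [x.1] l := by
  simp [lits, verts, impTarget, Function.comp_def]

lemma LitPath.grows (hl : LitPath v s x l) : Grows v [x.1] l := by
  induction l with
  | nil => trivial
  | cons e l ih =>
    refine ⟨ih hl.1, ?_⟩
    rw [← map_fst_lits (s := s)]
    refine List.mem_map.2 ⟨_, litEnd_mem_lits, ?_⟩
    rw [← hl.2]
    rfl

lemma LitPath.source_mem_tail (hl : LitPath v s x l) {f : M × Fin 2} (hf : f ∈ l) :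
    impSource v s f ∈ (lits v s x l).tail := by
  induction l with
  | nil => simp at hf
  | cons e l ih =>
    rw [lits_cons, List.tail_cons]
    rcases List.mem_cons.1 hf with rfl | hf
    · rw [hl.2]
      exact litEnd_mem_lits
    · exact List.mem_of_mem_tail (ih hl.1 hf)

lemma Grows.nodup_clauses {S : List V} (hl : Grows v S l) (hn : (verts v S l).Nodup) :
    (l.map Prod.fst).Nodup := by
  induction l with
  | nil => simp
  | cons e l ih =>
    rw [verts_cons, List.nodup_cons] at hn
    rw [List.map_cons, List.nodup_cons]
    refine ⟨fun he => ?_, ih hl.1 hn.2⟩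
    obtain ⟨f, hf, hfe⟩ := List.mem_map.1 he
    have h1 := hl.1.mem_verts hf e.2.rev
    rw [hfe] at h1
    exact hn.1 h1

lemma eq_of_mem_lits (hn : ((lits v s x l).map Prod.fst).Nodup) {w w' : V × Bool}
    (hw : w ∈ lits v s x l) (hw' : w' ∈ lits v s x l) (h : w.1 = w'.1) : w = w' :=
  List.inj_on_of_nodup_map hn hw hw' h

lemma eq_or_eq_rev_of_fst_eq {e f : M × Fin 2} (h : f.1 = e.1) : e = f ∨ e = (f.1, f.2.rev) := by
  rcases eq_or_eq_rev e.2 f.2 with h1 | h1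
  · exact Or.inl (Prod.ext h.symm h1)
  · exact Or.inr (Prod.ext h.symm h1)

/-- The clauses of a bicycle are distinct if its literals have distinct variables and its final
implication ends in the negation of a literal of the path. -/
lemma BicycleAt.nodup {e₀ e₁ : M × Fin 2} (hb : BicycleAt v s x (e₀ :: e₁ :: l))
    (hn : ((lits v s x l).map Prod.fst).Nodup)
    (hneg : litNeg (impTarget v s e₁) ∈ lits v s x l) :
    ((e₀ :: e₁ :: l).map Prod.fst).Nodup := by
  obtain ⟨⟨hl, h1, -⟩, h0, -⟩ := hb
  have hend : litEnd v s x l ∈ lits v s x l := litEnd_mem_lits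
  have hstart : x ∈ lits v s x l := start_mem_lits
  have htarget : ∀ f ∈ l, impTarget v s f ∈ lits v s x l := fun f hf =>
    List.mem_append_left _ (List.mem_map_of_mem hf)
  have hsource : ∀ f ∈ l, impSource v s f ∈ lits v s x l := fun f hf =>
    List.mem_of_mem_tail (hl.source_mem_tail hf)
  -- a literal and its negation cannot both lie on the path
  have hno : ∀ w ∈ lits v s x l, litNeg w ∉ lits v s x l := fun w hw hw' =>
    litNeg_ne w (eq_of_mem_lits hn hw' hw rfl)
  rw [List.map_cons, List.map_cons, List.nodup_cons, List.nodup_cons]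
  refine ⟨fun he => ?_, fun he => ?_, hl.grows.nodup_clauses (by rwa [map_fst_lits] at hn)⟩
  · rcases List.mem_cons.1 he with he | he
    · rcases eq_or_eq_rev_of_fst_eq he.symm with h2 | h2
      · rw [h2] at h0
        rw [h0] at hneg
        exact hno x hstart hneg
      · rw [h2, impTarget_rev, h1] at h0
        exact hno _ hend (by rw [h0]; exact hstart)
    · obtain ⟨f, hf, hfe⟩ := List.mem_map.1 he
      rcases eq_or_eq_rev_of_fst_eq hfe with h2 | h2
      · rw [h2] at h0
        rw [lits, h0.symm, List.map_append] at hn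
        refine (List.disjoint_of_nodup_append hn) (a := (impTarget v s f).1) ?_ (by simp)
        exact List.mem_map_of_mem (List.mem_map_of_mem hf)
      · rw [h2, impTarget_rev] at h0
        exact hno _ (hsource f hf) (h0 ▸ hstart)
  · obtain ⟨f, hf, hfe⟩ := List.mem_map.1 he
    rcases eq_or_eq_rev_of_fst_eq hfe with h2 | h2
    · rw [h2] at h1
      have h3 := hl.source_mem_tail hf
      cases l with
      | nil => simp at hf
      | cons e l =>
        rw [lits_cons, List.map_cons, List.nodup_cons] at hn
        rw [lits_cons, List.tail_cons, h1] at h3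
        exact hn.1 (List.mem_map_of_mem h3)
    · rw [h2, impSource_rev] at h1
      exact hno _ (htarget f hf) (h1 ▸ hend)

lemma exists_prefix_of_mem_lits (hl : LitPath v s x l)
    (hn : ((lits v s x l).map Prod.fst).Nodup) {w : V × Bool} (hw : w ∈ lits v s x l) :
    ∃ l', LitPath v s x l' ∧ ((lits v s x l').map Prod.fst).Nodup ∧ litEnd v s x l' = w := by
  induction l with
  | nil => exact ⟨[], trivial, hn, (by simpa [lits] using hw : w = x).symm⟩
  | cons e l ih =>
    rw [lits_cons] at hw
    rcases List.mem_cons.1 hw with rfl | hw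
    · exact ⟨e :: l, hl, hn, rfl⟩
    · rw [lits_cons, List.map_cons, List.nodup_cons] at hn
      exact ih hl.1 hn.2 hw

/-- If `x` implies its negation, then some simple path of implications from `x` runs into the
negation of one of its literals. -/
lemma exists_lasso (h : Relation.ReflTransGen (Implies v s) x (litNeg x)) :
    ∃ (l : List (M × Fin 2)) (e₁ : M × Fin 2), LitPath v s x l ∧
      ((lits v s x l).map Prod.fst).Nodup ∧ impSource v s e₁ = litEnd v s x l ∧
      litNeg (impTarget v s e₁) ∈ lits v s x l := by
  by_contra hno
  push Not at hno
  have key : ∀ z, Relation.ReflTransGen (Implies v s) x z → ∃ l, LitPath v s x l ∧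
      ((lits v s x l).map Prod.fst).Nodup ∧ litEnd v s x l = z := by
    intro z hz
    induction hz with
    | refl => exact ⟨[], trivial, by simp [lits], rfl⟩
    | tail _ h ih =>
      obtain ⟨l, h1, h2, h3⟩ := ih
      obtain ⟨e, h4, h5⟩ := h
      have h6 := hno l e h1 h2 (h4.trans h3.symm)
      rw [h5] at h6
      rename_i z z' _
      by_cases hz' : z' ∈ lits v s x l
      · exact exists_prefix_of_mem_lits h1 h2 hz'
      · refine ⟨e :: l, ⟨h1, h4.trans h3.symm⟩, ?_, h5⟩
        rw [lits_cons, List.map_cons, List.nodup_cons, h5]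
        refine ⟨fun hmem => ?_, h2⟩
        obtain ⟨w, hw, hwz⟩ := List.mem_map.1 hmem
        refine h6 ?_
        rw [← eq_litNeg_of_fst_eq hwz fun hwz' => hz' (hwz' ▸ hw)]
        exact hw
  obtain ⟨l, h1, h2, h3⟩ := key _ h
  refine litNeg_ne x (eq_of_mem_lits h2 ?_ start_mem_lits rfl)
  rw [← h3]
  exact litEnd_mem_lits

/-- If `x` and its negation imply each other, then there is a bicycle: extend the lasso that starts
from `x` backwards until its first variable repeats. -/
lemma exists_bicycle (h : Relation.ReflTransGen (Implies v s) x (litNeg x))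
    (h' : Relation.ReflTransGen (Implies v s) (litNeg x) x) :
    ∃ (y : V × Bool) (l : List (M × Fin 2)) (e₀ e₁ : M × Fin 2),
      BicycleAt v s y (e₀ :: e₁ :: l) ∧ ((e₀ :: e₁ :: l).map Prod.fst).Nodup ∧
      ((lits v s y l).map Prod.fst).Nodup := by
  obtain ⟨l₀, e₁, hl₀, hn₀, hs₀, ht₀⟩ := exists_lasso h
  by_contra hno
  push Not at hno
  have key : ∀ z, Relation.ReflTransGen (Implies v s) (litNeg x) z → ∃ l,
      LitPath v s (litNeg z) l ∧ ((lits v s (litNeg z) l).map Prod.fst).Nodup ∧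
      impSource v s e₁ = litEnd v s (litNeg z) l ∧
      litNeg (impTarget v s e₁) ∈ lits v s (litNeg z) l ∧ x ∈ lits v s (litNeg z) l := by
    intro z hz
    induction hz with
    | refl =>
      rw [litNeg_litNeg]
      exact ⟨l₀, hl₀, hn₀, hs₀, ht₀, start_mem_lits⟩
    | tail _ himp ih =>
      obtain ⟨l, h1, h2, h3, h4, h5⟩ := ih
      obtain ⟨e, he, he'⟩ := himp.contrapositive
      rename_i z z' _
      have hb : v e.1 e.2 = (litNeg z').1 := by rw [← he]; rfl
      by_cases hmem : (litNeg z').1 ∈ (lits v s (litNeg z) l).map Prod.fst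
      · exfalso
        have hB : BicycleAt v s (litNeg z) (e :: e₁ :: l) :=
          ⟨⟨h1, h3, List.mem_map.2 ⟨_, h4, rfl⟩⟩, he', by rw [hb]; exact hmem⟩
        exact hno _ _ _ _ hB (hB.nodup h2 h4) h2
      · have hlits : lits v s (litNeg z') (l ++ [e]) = lits v s (litNeg z) l ++ [litNeg z'] := by
          simp [lits, he']
        have hend : ∀ l, litEnd v s (litNeg z') (l ++ [e]) = litEnd v s (litNeg z) l := by
          intro l
          cases l
          · exact he'
          · rfl
        have hpath : ∀ l, LitPath v s (litNeg z) l → LitPath v s (litNeg z') (l ++ [e]) := by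
          intro l hl
          induction l with
          | nil => exact ⟨trivial, he⟩
          | cons f l ih => exact ⟨ih hl.1, hl.2.trans (hend l).symm⟩
        refine ⟨l ++ [e], hpath l h1, ?_, by rw [hend]; exact h3, ?_, ?_⟩
        · rw [hlits, List.map_append, List.nodup_append']
          refine ⟨h2, by simp, ?_⟩
          simpa using hmem
        · rw [hlits]
          exact List.mem_append_left _ h4
        · rw [hlits]
          exact List.mem_append_left _ h5
  obtain ⟨l, -, h2, -, -, h5⟩ := key _ h'
  exact litNeg_ne x (eq_of_mem_lits h2 start_mem_lits h5 rfl)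

end Implications

/-! ### The random formula is satisfiable with high probability -/

section Satisfiability

open scoped ENNReal

variable {n : ℕ}

/-- An oriented clause whose source literal `w` is given is determined by its far literal and its
orientation. -/
lemma card_oriented_source_le (w : Fin n × Bool) :
    Nat.card {e : Clause n × Fin 2 // impSource clauseVar clauseSign e = w} ≤ 4 * (n - 1) := by
  have h : Nat.card ({y : Fin n // y ≠ w.1} × (Bool × Fin 2)) = 4 * (n - 1) := by
    rw [Nat.card_prod, Nat.card_eq_fintype_card, Nat.card_eq_fintype_card]
    simp [mul_comm]
  rw [← h]
  refine Nat.card_le_card_of_injective (fun e => (⟨far clauseVar e.1, ?_⟩,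
    (farSign clauseSign e.1, e.1.2))) ?_
  · have h1 := far_ne e.1
    have h2 : (impSource clauseVar clauseSign e.1).1 = w.1 := by rw [e.2]
    change clauseVar e.1.1 e.1.2 = w.1 at h2
    rwa [h2] at h1
  · rintro ⟨e, he⟩ ⟨e', he'⟩ h
    simp only [Prod.mk.injEq, Subtype.mk.injEq] at h
    have h1 := Prod.mk.inj (he.trans he'.symm)
    exact Subtype.ext (orientedClause_ext h1.1 h.1 (by simpa using h1.2) h.2.1 h.2.2)

lemma card_oriented_source_far_le (w : Fin n × Bool) (L : List (Fin n)) :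
    Nat.card {e : Clause n × Fin 2 // impSource clauseVar clauseSign e = w ∧
      far clauseVar e ∈ L} ≤ 4 * L.length := by
  classical
  have h : Nat.card ({y // y ∈ L.toFinset} × (Bool × Fin 2)) ≤ 4 * L.length := by
    rw [Nat.card_prod, Nat.card_eq_fintype_card, Nat.card_eq_fintype_card, Fintype.card_coe]
    have := List.toFinset_card_le L
    simp only [Fintype.card_prod, Fintype.card_bool, Fintype.card_fin]
    omega
  refine le_trans (Nat.card_le_card_of_injective (fun e =>
    (⟨far clauseVar e.1, List.mem_toFinset.2 e.2.2⟩, (farSign clauseSign e.1, e.1.2))) ?_) h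
  rintro ⟨e, he⟩ ⟨e', he'⟩ h
  simp only [Prod.mk.injEq, Subtype.mk.injEq] at h
  have h1 := Prod.mk.inj (he.1.trans he'.1.symm)
  exact Subtype.ext (orientedClause_ext h1.1 h.1 (by simpa using h1.2) h.2.1 h.2.2)

lemma card_oriented_target_base_le (w : Fin n × Bool) (L : List (Fin n)) :
    Nat.card {e : Clause n × Fin 2 // impTarget clauseVar clauseSign e = w ∧
      clauseVar e.1 e.2 ∈ L} ≤ 4 * L.length := by
  classical
  have h : Nat.card ({y // y ∈ L.toFinset} × (Bool × Fin 2)) ≤ 4 * L.length := by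
    rw [Nat.card_prod, Nat.card_eq_fintype_card, Nat.card_eq_fintype_card, Fintype.card_coe]
    have := List.toFinset_card_le L
    simp only [Fintype.card_prod, Fintype.card_bool, Fintype.card_fin]
    omega
  refine le_trans (Nat.card_le_card_of_injective (fun e =>
    (⟨clauseVar e.1.1 e.1.2, List.mem_toFinset.2 e.2.2⟩, (clauseSign e.1.1 e.1.2, e.1.2))) ?_) h
  rintro ⟨e, he⟩ ⟨e', he'⟩ h
  simp only [Prod.mk.injEq, Subtype.mk.injEq] at h
  have h1 := Prod.mk.inj (he.1.trans he'.1.symm)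
  exact Subtype.ext (orientedClause_ext h.1 h1.1 h.2.1 h1.2 h.2.2)

/-- A path of implications has half as many continuations as a walk, as the sign of the source
is prescribed. -/
lemma listCount_litPath_le (x : Fin n × Bool) (r : ℕ) :
    listCount r (LitPath clauseVar clauseSign x) ≤ (4 * (n - 1)) ^ r := by
  induction r with
  | zero => exact listCount_zero_le _
  | succ r ih =>
    rw [pow_succ]
    exact (listCount_succ_le (fun e l h => h) fun l _ => card_oriented_source_le _).trans
      (Nat.mul_le_mul_right _ ih)

/-- The two clauses at the ends of a bicycle contain only variables of its path, which leaves a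
bounded number of choices for each of them, in place of order `n`. -/
lemma listCount_bicycleAt_le (x : Fin n × Bool) (r : ℕ) :
    listCount (r + 2) (BicycleAt clauseVar clauseSign x)
      ≤ (4 * (n - 1)) ^ r * (4 * (r + 1)) * (4 * (r + 1)) := by
  refine (listCount_succ_le (r := r + 1) (B := 4 * (r + 1))
    (Q' := fun L => ∃ e l, L = e :: l ∧ LitPath clauseVar clauseSign x l ∧
      impSource clauseVar clauseSign e = litEnd clauseVar clauseSign x l ∧
      far clauseVar e ∈ (lits clauseVar clauseSign x l).map Prod.fst)
    (P := fun L e => impTarget clauseVar clauseSign e = x ∧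
      clauseVar e.1 e.2 ∈ (lits clauseVar clauseSign x L.tail).map Prod.fst) ?_ ?_).trans
    (Nat.mul_le_mul_right _ ?_)
  · rintro e₀ (_ | ⟨e₁, l⟩) h
    · exact absurd h id
    · exact ⟨⟨e₁, l, rfl, h.1⟩, h.2⟩
  · intro L hL
    refine (card_oriented_target_base_le _ _).trans (le_of_eq ?_)
    simp [lits, hL]
  · refine (listCount_succ_le (B := 4 * (r + 1)) (Q' := LitPath clauseVar clauseSign x)
      (P := fun l e => impSource clauseVar clauseSign e = litEnd clauseVar clauseSign x l ∧
        far clauseVar e ∈ (lits clauseVar clauseSign x l).map Prod.fst) ?_ ?_).trans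
      (Nat.mul_le_mul_right _ (listCount_litPath_le x r))
    · rintro e l ⟨e', l', h, h'⟩
      obtain ⟨rfl, rfl⟩ := List.cons.inj h
      exact h'
    · intro l hl
      refine (card_oriented_source_far_le _ _).trans (le_of_eq ?_)
      simp [lits, hl]

lemma litEnd_orient (Φ : Formula n) (x : Fin n × Bool) (l : List (Fin Φ.numClauses × Fin 2)) :
    litEnd clauseVar clauseSign x (l.map Φ.orient) = litEnd Φ.var Φ.sign x l := by
  cases l <;> rfl

lemma lits_orient (Φ : Formula n) (x : Fin n × Bool) (l : List (Fin Φ.numClauses × Fin 2)) :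
    lits clauseVar clauseSign x (l.map Φ.orient) = lits Φ.var Φ.sign x l := by
  rw [lits, lits, List.map_map]
  rfl

lemma LitPath.orient {Φ : Formula n} {x : Fin n × Bool} {l : List (Fin Φ.numClauses × Fin 2)}
    (hl : LitPath Φ.var Φ.sign x l) : LitPath clauseVar clauseSign x (l.map Φ.orient) := by
  induction l with
  | nil => trivial
  | cons e l ih => exact ⟨ih hl.1, by rw [litEnd_orient]; exact hl.2⟩

lemma BicycleAt.orient {Φ : Formula n} {x : Fin n × Bool} {e₀ e₁ : Fin Φ.numClauses × Fin 2}
    {l : List (Fin Φ.numClauses × Fin 2)} (hl : BicycleAt Φ.var Φ.sign x (e₀ :: e₁ :: l)) :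
    BicycleAt clauseVar clauseSign x ((e₀ :: e₁ :: l).map Φ.orient) := by
  obtain ⟨⟨h1, h2, h3⟩, h4, h5⟩ := hl
  refine ⟨⟨h1.orient, ?_, ?_⟩, h4, ?_⟩
  · rw [litEnd_orient]; exact h2
  · rw [lits_orient]; exact h3
  · rw [lits_orient]; exact h5

/-- An unsatisfiable formula contains a bicycle with distinct clauses. -/
lemma exists_occurrence_of_unsat {Φ : Formula n} (hΦ : ¬ 0 < Φ.Z) :
    ∃ x : Fin n × Bool, ∃ r < n, 1 ≤ occurrences (r + 2) (BicycleAt clauseVar clauseSign x) Φ := by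
  have h1 : ¬ ∃ σ : Fin n → Bool, ∀ b, ∃ j, σ (Φ.var b j) = Φ.sign b j := by
    rintro ⟨σ, hσ⟩
    exact hΦ ((Set.ncard_pos (Set.toFinite _)).2 ⟨σ, hσ⟩)
  have h2 := mt exists_solution_of_no_contradiction h1
  push Not at h2
  obtain ⟨w, hw, hw'⟩ := h2
  obtain ⟨x, l, e₀, e₁, h3, h4, h5⟩ := exists_bicycle hw hw'
  refine ⟨x, l.length, ?_, one_le_occurrences h4 h3.orient⟩
  have h6 := h5.length_le_card
  simp [lits] at h6
  omega

lemma lintegral_bicycleAt_le {d : ℝ} (hd : 0 ≤ d) (n r : ℕ) (x : Fin (n + 2) × Bool) :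
    ∫⁻ Φ, (occurrences (r + 2) (BicycleAt clauseVar clauseSign x) Φ : ℝ≥0∞)
        ∂(randomFormula d (n + 2))
      ≤ ENNReal.ofReal ((r + 1) ^ 2 * (d / 2) ^ r * (d ^ 2 / (4 * (n + 1) ^ 2))) := by
  have h1 : (listCount (r + 2) (BicycleAt clauseVar clauseSign x) : ℝ)
      ≤ (4 * (n + 1)) ^ r * (4 * (r + 1)) * (4 * (r + 1)) := by
    exact_mod_cast listCount_bicycleAt_le x r
  refine (lintegral_occurrences_le_of_count hd n _ _ h1).trans (le_of_eq ?_)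
  congr 1
  have h2 : d / (8 * ((n : ℝ) + 1)) * (4 * (n + 1)) = d / 2 := by
    field_simp
    ring
  rw [pow_add, ← h2, mul_pow (d / (8 * ((n : ℝ) + 1)))]
  field_simp
  ring

/-- A bound on the expected number of bicycles with distinct clauses, up to the factor `1 / (n + 1)`. -/
noncomputable def bicycleBound (d : ℝ) : ℝ := d ^ 2 * ∑' r : ℕ, ((r : ℝ) + 1) ^ 2 * (d / 2) ^ r

lemma summable_bicycle {d : ℝ} (hd0 : 0 < d) (hd2 : d < 2) :
    Summable fun r : ℕ => ((r : ℝ) + 1) ^ 2 * (d / 2) ^ r := by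
  have h1 := (summable_nat_add_iff 1).2 (summable_pow_mul_geometric_of_norm_lt_one 2
    (r := d / 2) (by rw [Real.norm_eq_abs, abs_of_pos (by positivity)]; linarith))
  refine (h1.mul_right (d / 2)⁻¹).congr fun r => ?_
  push_cast
  rw [pow_succ (d / 2) r]
  field_simp

/-- The first moment method for bicycles: there are `2 * (n + 2)` starting literals, and for each of
them the expected number of bicycles is of order `1 / n ^ 2`. -/
lemma measure_unsat_le {d : ℝ} (hd0 : 0 < d) (hd2 : d < 2) (n : ℕ) :
    randomFormula d (n + 2) {Φ | ¬ 0 < Φ.Z} ≤ ENNReal.ofReal (bicycleBound d / (n + 1)) := by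
  calc randomFormula d (n + 2) {Φ | ¬ 0 < Φ.Z}
      = ∫⁻ Φ, {Φ : Formula (n + 2) | ¬ 0 < Φ.Z}.indicator 1 Φ
          ∂(randomFormula d (n + 2)) := (lintegral_indicator_one .of_discrete).symm
    _ ≤ ∫⁻ Φ, ∑ x : Fin (n + 2) × Bool, ∑ r ∈ Finset.range (n + 2),
          (occurrences (r + 2) (BicycleAt clauseVar clauseSign x) Φ : ℝ≥0∞)
          ∂(randomFormula d (n + 2)) := by
        refine lintegral_mono fun Φ => ?_
        by_cases h : 0 < Φ.Z
        · rw [Set.indicator_of_notMem (by simpa using h.ne')]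
          exact zero_le
        · rw [Set.indicator_of_mem (by simpa using h), Pi.one_apply]
          obtain ⟨x, r, hr, h1⟩ := exists_occurrence_of_unsat h
          have h2 : (1 : ℝ≥0∞) ≤ occurrences (r + 2) (BicycleAt clauseVar clauseSign x) Φ := by
            exact_mod_cast h1
          exact (h2.trans (Finset.single_le_sum (f := fun r =>
            (occurrences (r + 2) (BicycleAt clauseVar clauseSign x) Φ : ℝ≥0∞))
            (fun _ _ => zero_le) (Finset.mem_range.2 hr))).trans
            (Finset.single_le_sum (f := fun x => ∑ r ∈ Finset.range (n + 2),
              (occurrences (r + 2) (BicycleAt clauseVar clauseSign x) Φ : ℝ≥0∞))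
              (fun _ _ => zero_le) (Finset.mem_univ x))
    _ = ∑ x : Fin (n + 2) × Bool, ∑ r ∈ Finset.range (n + 2),
          ∫⁻ Φ, (occurrences (r + 2) (BicycleAt clauseVar clauseSign x) Φ : ℝ≥0∞)
          ∂(randomFormula d (n + 2)) := by
        rw [lintegral_finsetSum _ fun _ _ => .of_discrete]
        exact Finset.sum_congr rfl fun x _ => lintegral_finsetSum _ fun _ _ => .of_discrete
    _ ≤ ∑ x : Fin (n + 2) × Bool, ∑ r ∈ Finset.range (n + 2),
          ENNReal.ofReal ((r + 1) ^ 2 * (d / 2) ^ r * (d ^ 2 / (4 * (n + 1) ^ 2))) :=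
        Finset.sum_le_sum fun x _ => Finset.sum_le_sum fun r _ =>
          lintegral_bicycleAt_le hd0.le n r x
    _ = ENNReal.ofReal ((n + 2 : ℕ) * 2 * ((∑ r ∈ Finset.range (n + 2),
          ((r : ℝ) + 1) ^ 2 * (d / 2) ^ r) * (d ^ 2 / (4 * (n + 1) ^ 2)))) := by
        rw [Finset.sum_const, Finset.card_univ, nsmul_eq_mul, Finset.sum_mul,
          ENNReal.ofReal_mul (by positivity),
          ENNReal.ofReal_sum_of_nonneg fun r _ => by positivity]
        congr 1
        rw [Fintype.card_prod, Fintype.card_fin, Fintype.card_bool, ← ENNReal.ofReal_natCast]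
        push_cast
        rfl
    _ ≤ ENNReal.ofReal (bicycleBound d / (n + 1)) := by
        refine ENNReal.ofReal_le_ofReal ?_
        have h1 : ∑ r ∈ Finset.range (n + 2), ((r : ℝ) + 1) ^ 2 * (d / 2) ^ r
            ≤ ∑' r : ℕ, ((r : ℝ) + 1) ^ 2 * (d / 2) ^ r :=
          (summable_bicycle hd0 hd2).sum_le_tsum _ fun r _ => by positivity
        set s := ∑ r ∈ Finset.range (n + 2), ((r : ℝ) + 1) ^ 2 * (d / 2) ^ r
        set K := ∑' r : ℕ, ((r : ℝ) + 1) ^ 2 * (d / 2) ^ r with hK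
        have hs : 0 ≤ s := Finset.sum_nonneg fun r _ => by positivity
        rw [bicycleBound, ← hK, le_div_iff₀ (by positivity)]
        have h2 : ((n + 2 : ℕ) : ℝ) * 2 * (s * (d ^ 2 / (4 * (n + 1) ^ 2))) * (n + 1)
            = d ^ 2 * s * ((n + 2) / (2 * (n + 1))) := by
          push_cast
          field_simp
          ring
        rw [h2]
        have h3 : ((n : ℝ) + 2) / (2 * (n + 1)) ≤ 1 := by
          rw [div_le_one (by positivity)]
          linarith [n.cast_nonneg (α := ℝ)]
        calc d ^ 2 * s * ((n + 2) / (2 * (n + 1))) ≤ d ^ 2 * s * 1 := by gcongr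
          _ ≤ d ^ 2 * K := by rw [mul_one]; gcongr

end Satisfiability

/-! ### Marginals and estimates lie in the unit interval -/

section UnitInterval

variable {n : ℕ}

lemma abs_sub_le_one {a b : ℝ} (ha : a ∈ Set.Icc (0 : ℝ) 1) (hb : b ∈ Set.Icc (0 : ℝ) 1) :
    |a - b| ≤ 1 :=
  abs_sub_le_iff.2 ⟨by linarith [ha.2, hb.1], by linarith [ha.1, hb.2]⟩

lemma normalizePair_mem_Icc {w : Bool → ℝ} (hw : ∀ t, 0 ≤ w t) (t : Bool) :
    normalizePair w t ∈ Set.Icc (0 : ℝ) 1 := by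
  unfold normalizePair
  split_ifs with h
  · norm_num
  · refine ⟨div_nonneg (hw t) (add_nonneg (hw _) (hw _)), div_le_one_of_le₀ ?_
      (add_nonneg (hw _) (hw _))⟩
    cases t
    · exact le_add_of_nonneg_left (hw _)
    · exact le_add_of_nonneg_right (hw _)

lemma clauseUpdate_nonneg {Φ : Formula n} {ν : Φ.Messages}
    (hν : ∀ a j t, ν a j t ∈ Set.Icc (0 : ℝ) 1) (a : Fin Φ.numClauses) (j : Fin 2) (t : Bool) :
    0 ≤ Φ.clauseUpdate ν a j t := by
  refine div_nonneg ?_ (add_nonneg zero_le_one (hν _ _ _).1)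
  split_ifs
  · exact sub_nonneg.2 (hν _ _ _).2
  · simp

lemma varUpdate_mem_Icc {Φ : Formula n} {ν : Φ.Messages} (hν : ∀ a j t, 0 ≤ ν a j t)
    (a : Fin Φ.numClauses) (j : Fin 2) (t : Bool) :
    Φ.varUpdate ν a j t ∈ Set.Icc (0 : ℝ) 1 := by
  refine normalizePair_mem_Icc (fun t => Finset.prod_nonneg fun e _ => ?_) t
  split_ifs
  · exact hν _ _ _
  · exact zero_le_one

lemma bpMessages_bounds (Φ : Formula n) (ℓ : ℕ) (a : Fin Φ.numClauses) (j : Fin 2) (t : Bool) :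
    0 ≤ (Φ.bpMessages ℓ).1 a j t ∧ (Φ.bpMessages ℓ).2 a j t ∈ Set.Icc (0 : ℝ) 1 := by
  induction ℓ generalizing a j t with
  | zero => norm_num [Formula.bpMessages]
  | succ ℓ ih =>
    have h1 := clauseUpdate_nonneg fun a j t => (ih a j t).2
    exact ⟨h1 a j t, varUpdate_mem_Icc h1 a j t⟩

lemma bpMarginal_mem_Icc (Φ : Formula n) (ℓ : ℕ) (x : Fin n) (t : Bool) :
    Φ.bpMarginal ℓ x t ∈ Set.Icc (0 : ℝ) 1 := by
  refine normalizePair_mem_Icc (fun t => Finset.prod_nonneg fun e _ => ?_) t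
  split_ifs
  · exact (bpMessages_bounds Φ ℓ _ _ _).1
  · exact zero_le_one

instance isZeroOrProbabilityMeasure_gibbs (Φ : Formula n) : IsZeroOrProbabilityMeasure Φ.gibbs :=
  inferInstanceAs (IsZeroOrProbabilityMeasure (uniformOn Φ.solutions))

lemma marginal_mem_Icc (Φ : Formula n) (x : Fin n) (t : Bool) :
    Φ.marginal x t ∈ Set.Icc (0 : ℝ) 1 :=
  ⟨measureReal_nonneg, measureReal_le_one⟩

lemma condMarginal_mem_Icc (Φ : Formula n) (k : ℕ) (τ : Fin n → Bool) (x : Fin n) (t : Bool) :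
    Φ.condMarginal k τ x t ∈ Set.Icc (0 : ℝ) 1 :=
  ⟨measureReal_nonneg, measureReal_le_one⟩

end UnitInterval

/-! ### Limits of conditional expectations -/

section Limits

open scoped ENNReal

variable {d : ℝ}

lemma condExpect_nonneg {n : ℕ} {f : Formula n → ℝ} (hf : ∀ Φ, 0 ≤ f Φ) : 0 ≤ condExpect d n f :=
  integral_nonneg hf

lemma cycleBound_nonneg (hd0 : 0 < d) (R : ℕ) : 0 ≤ cycleBound d R :=
  Finset.sum_nonneg fun r _ => by positivity

lemma gapBound_nonneg (hd0 : 0 < d) (h k : ℕ) : 0 ≤ gapBound d h k := by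
  have := Real.log_nonneg one_le_two
  have : 0 ≤ ∑ j ∈ Finset.range h, (1 / 2 : ℝ) ^ j * d ^ (j + 1 + k) :=
    Finset.sum_nonneg fun _ _ => by positivity
  unfold gapBound
  positivity

/-- An observable bounded by `1` has expectation at most `ℙ(not locally acyclic)` plus the
expectation of the gap on locally acyclic formulas; conditioning on satisfiability costs the factor
`1 / ℙ(satisfiable)`. -/
lemma condExpect_le (hd0 : 0 < d) (hd2 : d < 2) {h k n : ℕ} {f : Formula (n + 2) → ℝ}
    (hf0 : ∀ Φ, 0 ≤ f Φ) (hf1 : ∀ Φ, f Φ ≤ 1)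
    (hf : ∀ Φ, 0 < Φ.Z → LocallyAcyclic (2 * (h + k)) Φ → f Φ ≤ 2 * bpGap Φ h k 0)
    (hn : bicycleBound d / (n + 1) < 1) :
    condExpect d (n + 2) f ≤ (1 - bicycleBound d / (n + 1))⁻¹ *
      (cycleBound d (2 * (h + k)) / (n + 1) + 2 * gapBound d h k) := by
  have hP := isProbabilityMeasure_randomFormula d (nonempty_clause n)
  set P := randomFormula d (n + 2)
  set A : Set (Formula (n + 2)) := {Φ | LocallyAcyclic (2 * (h + k)) Φ}
  set S : Set (Formula (n + 2)) := {Φ | 0 < Φ.Z}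
  have hC := cycleBound_nonneg hd0 (2 * (h + k))
  have hg := gapBound_nonneg hd0 h k
  have h1 : ∫⁻ Φ in S, ENNReal.ofReal (f Φ) ∂P
      ≤ ENNReal.ofReal (cycleBound d (2 * (h + k)) / (n + 1) + 2 * gapBound d h k) := by
    calc ∫⁻ Φ in S, ENNReal.ofReal (f Φ) ∂P
        = ∫⁻ Φ, S.indicator (fun Φ => ENNReal.ofReal (f Φ)) Φ ∂P :=
          (lintegral_indicator .of_discrete _).symm
      _ ≤ ∫⁻ Φ, (Aᶜ.indicator 1 Φ + A.indicator (fun Φ => 2 * ENNReal.ofReal (bpGap Φ h k 0)) Φ)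
            ∂P := by
          refine lintegral_mono fun Φ => ?_
          by_cases hS : Φ ∈ S
          · rw [Set.indicator_of_mem hS]
            by_cases hA : Φ ∈ A
            · rw [Set.indicator_of_notMem (by simpa using hA), Set.indicator_of_mem hA, zero_add,
                ← ENNReal.ofReal_ofNat, ← ENNReal.ofReal_mul zero_le_two]
              exact ENNReal.ofReal_le_ofReal (hf Φ hS hA)
            · rw [Set.indicator_of_mem (s := Aᶜ) hA, Set.indicator_of_notMem hA, add_zero]
              exact ENNReal.ofReal_le_one.2 (hf1 Φ)
          · rw [Set.indicator_of_notMem hS]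
            exact zero_le
      _ = P Aᶜ + 2 * ∫⁻ Φ in A, ENNReal.ofReal (bpGap Φ h k 0) ∂P := by
          rw [lintegral_add_left .of_discrete, lintegral_indicator_one .of_discrete,
            lintegral_indicator .of_discrete, lintegral_const_mul _ .of_discrete]
      _ ≤ ENNReal.ofReal (cycleBound d (2 * (h + k)) / (n + 1))
            + ENNReal.ofReal 2 * ENNReal.ofReal (gapBound d h k) := by
          rw [ENNReal.ofReal_ofNat]
          gcongr
          · exact measure_not_locallyAcyclic_le hd0.le n _
          · exact lintegral_bpGap_le hd0.le n h k _ le_rfl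
      _ = _ := by
          rw [← ENNReal.ofReal_mul zero_le_two, ← ENNReal.ofReal_add (by positivity)
            (by positivity)]
  have h2 : ∫ Φ in S, f Φ ∂P ≤ cycleBound d (2 * (h + k)) / (n + 1) + 2 * gapBound d h k := by
    rw [integral_eq_lintegral_of_nonneg_ae (ae_of_all _ hf0)
      Measurable.of_discrete.aestronglyMeasurable]
    exact ENNReal.toReal_le_of_le_ofReal (by positivity) h1
  have h3 : 1 - bicycleBound d / (n + 1) ≤ P.real S := by
    have h4 : P.real Sᶜ ≤ bicycleBound d / (n + 1) := by
      refine ENNReal.toReal_le_of_le_ofReal ?_ (measure_unsat_le hd0 hd2 n)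
      exact div_nonneg (mul_nonneg (sq_nonneg d) (tsum_nonneg fun r => by positivity))
        (by positivity)
    rw [probReal_compl_eq_one_sub .of_discrete] at h4
    linarith
  have h5 : condExpect d (n + 2) f = (P.real S)⁻¹ * ∫ Φ in S, f Φ ∂P := by
    rw [condExpect, ProbabilityTheory.cond, integral_smul_measure, ENNReal.toReal_inv, smul_eq_mul]
    rfl
  rw [h5]
  have h6 : 0 < 1 - bicycleBound d / (n + 1) := by linarith
  gcongr
  exact integral_nonneg hf0

lemma tendsto_const_div_add_one (c : ℝ) :
    Tendsto (fun n : ℕ => c / ((n : ℝ) + 1)) atTop (𝓝 0) := by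
  simpa [Function.comp_def] using
    (tendsto_const_div_atTop_nhds_zero_nat c).comp (tendsto_add_atTop_nat 1)

lemma tendsto_condExpect_bound (d C g : ℝ) :
    Tendsto (fun n : ℕ => (1 - bicycleBound d / (n + 1))⁻¹ * (C / (n + 1) + g)) atTop (𝓝 g) := by
  have h1 : Tendsto (fun n : ℕ => (1 - bicycleBound d / ((n : ℝ) + 1))⁻¹) atTop (𝓝 (1 - 0)⁻¹) :=
    (tendsto_const_nhds.sub (tendsto_const_div_add_one _)).inv₀ (by norm_num)
  simpa using h1.mul ((tendsto_const_div_add_one C).add_const g)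

lemma gapBound_le (hd0 : 0 < d) (hd2 : d < 2) (h k : ℕ) :
    gapBound d h k ≤ Real.log 2 * (d * (1 - d / 2)⁻¹) * (d / 2) ^ k + 2 * d ^ k * (d / 2) ^ h := by
  have hlog := Real.log_nonneg one_le_two
  have h1 : (1 / 2 : ℝ) ^ k * ∑ j ∈ Finset.range h, (1 / 2) ^ j * d ^ (j + 1 + k)
      = d * (d / 2) ^ k * ∑ j ∈ Finset.range h, (d / 2) ^ j := by
    rw [Finset.mul_sum, Finset.mul_sum]
    refine Finset.sum_congr rfl fun j _ => ?_
    rw [div_eq_mul_one_div d 2, mul_pow, mul_pow]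
    ring
  have h2 : ∑ j ∈ Finset.range h, (d / 2) ^ j ≤ (1 - d / 2)⁻¹ := by
    rw [← tsum_geometric_of_lt_one (by positivity) (by linarith)]
    exact (summable_geometric_of_lt_one (by positivity) (by linarith)).sum_le_tsum _
      fun _ _ => by positivity
  have h3 : 2 * ((1 / 2 : ℝ) ^ h * d ^ (h + k)) = 2 * d ^ k * (d / 2) ^ h := by
    rw [div_eq_mul_one_div d 2, mul_pow]
    ring
  rw [gapBound, h1, h3]
  have h4 : d * (d / 2) ^ k * ∑ j ∈ Finset.range h, (d / 2) ^ j
      ≤ d * (d / 2) ^ k * (1 - d / 2)⁻¹ := by gcongr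
  have h5 := mul_le_mul_of_nonneg_left h4 hlog
  linarith

lemma exists_gapBound_lt (hd0 : 0 < d) (hd2 : d < 2) {ε : ℝ} (hε : 0 < ε) :
    ∃ k, ∀ᶠ h in atTop, gapBound d h k < ε := by
  have h1 : Tendsto (fun k : ℕ => (d / 2) ^ k) atTop (𝓝 0) :=
    tendsto_pow_atTop_nhds_zero_of_lt_one (by positivity) (by linarith)
  have h2 := h1.const_mul (Real.log 2 * (d * (1 - d / 2)⁻¹))
  rw [mul_zero] at h2
  obtain ⟨k, hk⟩ := (h2.eventually_lt_const (half_pos hε)).exists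
  have h3 := h1.const_mul (2 * d ^ k)
  rw [mul_zero] at h3
  refine ⟨k, (h3.eventually_lt_const (half_pos hε)).mono fun h hh => ?_⟩
  linarith [gapBound_le hd0 hd2 h k]

/-- The choice of depths for a given precision, uniformly in the observable: `k` is chosen first, and
then `h` may be any sufficiently large number. -/
lemma exists_eventually_condExpect_lt (hd0 : 0 < d) (hd2 : d < 2) {ε : ℝ} (hε : 0 < ε) :
    ∃ k, ∀ᶠ h in atTop, ∀ f : ∀ n, Formula (n + 2) → ℝ, (∀ n Φ, 0 ≤ f n Φ) →
      (∀ n Φ, f n Φ ≤ 1) → (∀ n Φ, 0 < Φ.Z → LocallyAcyclic (2 * (h + k)) Φ →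
        f n Φ ≤ 2 * bpGap Φ h k 0) → ∀ᶠ n in atTop, condExpect d (n + 2) (f n) < ε := by
  -- the gap enters the bound with the factor `2`
  obtain ⟨k, hk⟩ := exists_gapBound_lt hd0 hd2 (half_pos hε)
  refine ⟨k, hk.mono fun h hh f hf0 hf1 hf => ?_⟩
  have h1 := (tendsto_condExpect_bound d (cycleBound d (2 * (h + k)))
    (2 * gapBound d h k)).eventually_lt_const (show _ < ε by linarith)
  filter_upwards [h1, (tendsto_const_div_add_one (bicycleBound d)).eventually_lt_const one_pos] with n hn hn'
  exact (condExpect_le hd0 hd2 (hf0 n) (hf1 n) (hf n) hn').trans_lt hn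

/-- A sequence of observables in `[0, 1]` that on locally acyclic satisfiable formulas are
controlled by the gap of depth `ℓ = h + k`, however `ℓ` is split, vanishes in the limit. -/
lemma tendsto_limsup_condExpect (hd0 : 0 < d) (hd2 : d < 2)
    {f : ∀ _ n : ℕ, Formula (n + 2) → ℝ} (hf0 : ∀ ℓ n Φ, 0 ≤ f ℓ n Φ)
    (hf1 : ∀ ℓ n Φ, f ℓ n Φ ≤ 1)
    (hf : ∀ h k n Φ, 1 ≤ h + k → 0 < Φ.Z → LocallyAcyclic (2 * (h + k)) Φ →
      f (h + k) n Φ ≤ 2 * bpGap Φ h k 0) :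
    Tendsto (fun ℓ => limsup (fun n : ℕ => condExpect d (n + 2) (f ℓ n)) atTop) atTop (𝓝 0) := by
  -- fix `k` large enough, and let `h = ℓ - k` tend to infinity
  have key : ∀ ε > 0, ∀ᶠ ℓ in atTop, ∀ᶠ n in atTop, condExpect d (n + 2) (f ℓ n) < ε := by
    intro ε hε
    obtain ⟨k, hk⟩ := exists_eventually_condExpect_lt hd0 hd2 hε
    have h1 := (tendsto_sub_atTop_nat k).eventually (hk.and (eventually_ge_atTop 1))
    filter_upwards [h1, eventually_ge_atTop k] with ℓ hℓ hkℓ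
    obtain ⟨h, rfl⟩ := Nat.exists_eq_add_of_le' hkℓ
    rw [Nat.add_sub_cancel] at hℓ
    exact hℓ.1 (f (h + k)) (hf0 _) (hf1 _) fun n Φ => hf h k n Φ (by omega)
  have hb (ℓ : ℕ) : IsCoboundedUnder (· ≤ ·) atTop fun n : ℕ => condExpect d (n + 2) (f ℓ n) :=
    IsCoboundedUnder.of_frequently_ge (a := 0)
      (Frequently.of_forall fun n => condExpect_nonneg (hf0 ℓ n))
  refine Metric.tendsto_nhds.2 fun ε hε => (key (ε / 2) (half_pos hε)).mono fun ℓ hℓ => ?_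
  have h1 := limsup_le_of_le (hb ℓ) (hℓ.mono fun n hn => hn.le)
  have h2 : 0 ≤ limsup (fun n : ℕ => condExpect d (n + 2) (f ℓ n)) atTop :=
    le_limsup_of_frequently_le (Frequently.of_forall fun n => condExpect_nonneg (hf0 ℓ n))
      ⟨ε / 2, by simpa using hℓ.mono fun n hn => hn.le⟩
  rw [Real.dist_eq, sub_zero, abs_of_nonneg h2]
  linarith

/-- The value of a variable off the tree around `0` is one more boundary condition, so that it
hardly influences the marginal of `0`; as the joint law does not depend on the depth, any depth with
a small gap will do. -/
lemma tendsto_condExpect_joint (hd0 : 0 < d) (hd2 : d < 2) (s t : Bool) :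
    Tendsto (fun n : ℕ => condExpect d (n + 2) fun Φ =>
      |Φ.gibbs.real {σ | σ 0 = s ∧ σ 1 = t} - Φ.marginal 0 s * Φ.marginal 1 t|) atTop (𝓝 0) := by
  refine Metric.tendsto_nhds.2 fun ε hε => ?_
  obtain ⟨k, hk⟩ := exists_eventually_condExpect_lt hd0 hd2 hε
  obtain ⟨h, hh, hh1⟩ := (hk.and (eventually_ge_atTop 1)).exists
  refine (hh (fun n Φ =>
    |Φ.gibbs.real {σ | σ 0 = s ∧ σ 1 = t} - Φ.marginal 0 s * Φ.marginal 1 t|)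
    (fun n Φ => abs_nonneg _) (fun n Φ => ?_) fun n Φ hZ hΦ => ?_).mono fun n hn => ?_
  · have h1 := marginal_mem_Icc Φ 0 s
    have h2 := marginal_mem_Icc Φ 1 t
    exact abs_sub_le_one ⟨measureReal_nonneg, measureReal_le_one⟩
      ⟨mul_nonneg h1.1 h2.1, mul_le_one₀ h1.2 h2.1 h2.2⟩
  · exact abs_joint_sub_le hZ (by omega) 0 1 (hΦ.treeLike le_rfl) (hΦ.one_notMem (by omega)) s t
  · rw [Real.dist_eq, sub_zero, abs_of_nonneg (condExpect_nonneg fun Φ => abs_nonneg _)]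
    exact hn

end Limits

end TwoSat

theorem theorem1p2 (d : ℝ) (hd0 : 0 < d) (hd2 : d < 2) :
    Tendsto (fun ℓ : ℕ => limsup (fun n : ℕ =>
        TwoSat.condExpect d (n + 2) fun Φ =>
          ⨆ τ : Φ.solutions, |Φ.condMarginal (2 * ℓ) τ 0 true - Φ.bpMarginal ℓ 0 true|)
      atTop) atTop (𝓝 0) ∧
    (∀ t : Bool, Tendsto (fun ℓ : ℕ => limsup (fun n : ℕ =>
        TwoSat.condExpect d (n + 2) fun Φ => |Φ.marginal 0 t - Φ.bpMarginal ℓ 0 t|)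
      atTop) atTop (𝓝 0)) ∧
    Tendsto (fun ℓ : ℕ => limsup (fun n : ℕ =>
        TwoSat.condExpect d (n + 2) fun Φ =>
          ⨆ τ : Φ.solutions, |Φ.condMarginal (2 * ℓ) τ 0 true - Φ.marginal 0 true|)
      atTop) atTop (𝓝 0) ∧
    Tendsto (fun n : ℕ => ∑ s : Bool, ∑ t : Bool,
        TwoSat.condExpect d (n + 2) fun Φ =>
          |Φ.gibbs.real {σ | σ 0 = s ∧ σ 1 = t} - Φ.marginal 0 s * Φ.marginal 1 t|)
      atTop (𝓝 0) := by
  refine ⟨?_, fun t => ?_, ?_, ?_⟩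
  -- the bounds on the suprema hold for unsatisfiable formulas, too, as the supremum of the empty
  -- family is `0`
  · refine TwoSat.tendsto_limsup_condExpect hd0 hd2
      (fun ℓ n Φ => Real.iSup_nonneg fun τ => abs_nonneg _)
      (fun ℓ n Φ => Real.iSup_le (fun τ => TwoSat.abs_sub_le_one
        (TwoSat.condMarginal_mem_Icc _ _ _ _ _) (TwoSat.bpMarginal_mem_Icc _ _ _ _)) zero_le_one)
      fun h k n Φ hk hZ hΦ => ?_
    have h1 := TwoSat.bpGap_nonneg Φ h k 0
    refine Real.iSup_le (fun τ => ?_) (by linarith)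
    have h2 := TwoSat.abs_condMarginal_sub_le hk 0 (hΦ.treeLike le_rfl) τ τ.2 true
    linarith
  · refine TwoSat.tendsto_limsup_condExpect hd0 hd2 (fun ℓ n Φ => abs_nonneg _)
      (fun ℓ n Φ => TwoSat.abs_sub_le_one (TwoSat.marginal_mem_Icc _ _ _)
        (TwoSat.bpMarginal_mem_Icc _ _ _ _)) fun h k n Φ hk hZ hΦ => ?_
    have h1 := TwoSat.bpGap_nonneg Φ h k 0
    have h2 := TwoSat.abs_marginal_sub_le hZ hk 0 (hΦ.treeLike le_rfl) t
    linarith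
  · refine TwoSat.tendsto_limsup_condExpect hd0 hd2
      (fun ℓ n Φ => Real.iSup_nonneg fun τ => abs_nonneg _)
      (fun ℓ n Φ => Real.iSup_le (fun τ => TwoSat.abs_sub_le_one
        (TwoSat.condMarginal_mem_Icc _ _ _ _ _) (TwoSat.marginal_mem_Icc _ _ _)) zero_le_one)
      fun h k n Φ hk hZ hΦ => ?_
    have h1 := TwoSat.bpGap_nonneg Φ h k 0
    exact Real.iSup_le (fun τ => TwoSat.abs_condMarginal_sub_marginal_le hZ hk 0
      (hΦ.treeLike le_rfl) τ τ.2 true) (by linarith)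
  · simpa using tendsto_finsetSum Finset.univ fun s _ => tendsto_finsetSum Finset.univ fun t _ =>
      TwoSat.tendsto_condExpect_joint hd0 hd2 s t
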